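/- **Setting.** Let $n_1\ge 1$, $n_2\ge 0$, $K\ge 1$ be integers, $\rho,\sigma,R,\bar E,\gamma>0$, $\varepsilon\ge 0$ and $\tau\ge n_1-1$ real numbers. Write $w=\mathrm i\bar z$ and use the variables $(p,q,z,w)$ with Poisson bracket $$\{f,g\}=\sum_{j=1}^{n_1}\big(\partial_{q_j}f\,\partial_{p_j}g-\partial_{p_j}f\,\partial_{q_j}g\big)+\sum_{j=1}^{n_2}\big(\partial_{w_j}f\,\partial_{z_j}g-\partial_{z_j}f\,\partial_{w_j}g\big),\qquad L_\chi=\{\chi,\cdot\}.$$ With $|\cdot|$ the $\ell^1$-norm, $\mathcal P_\ell^{N}$ is the set of finite sums $\sum c_{m,\lambda,\bar\lambda,k}\,p^m z^\lambda w^{\bar\lambda}e^{\mathrm i k\cdot q}$ with complex coefficients, $2|m|+|\lambda|+|\bar\lambda|=\ell$ and $|k|\le N$. All functions may depend on a parameter $\omega^{(0)}\in W\subseteq\mathbb C^{n_1}$; for $g=\sum_k g_k(p,z,w)\,e^{\mathrm i k\cdot q}$ and $\alpha>0$ set $\|g\|_\alpha=\sum_k e^{|k|\alpha\sigma}\sup|g_k|$,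 the supremum being over $|p_j|<\alpha\rho$, $|z_j|,|w_j|<\alpha R$ and $\omega^{(0)}\in W$. A parameter-independent statement is the case of a one-point $W$. Consider Hamiltonians $$H^{(0)}=\omega^{(0)}\cdot p+\sum_{j}\Omega^{(0)}_jz_j\bar z_j+\sum_{\ell>2}\sum_{s\ge0}\varepsilon^sf^{(0,s)}_\ell+\sum_{\ell\le 2}\sum_{s\ge1}\varepsilon^sf^{(0,s)}_\ell,\qquad \text{(c')}\ \ f_\ell^{(0,s)}\in\mathcal P_\ell^{sK},$$ as formal expansions, with $\Omega^{(0)}=\Omega^{(0)}(\omega^{(0)})\in\mathbb C^{n_2}$. **Algorithm.** Let $$H^{(r-1)}=N^{(r-1)}+\sum_{\ell>2}\sum_{s\ge0}\varepsilon^sf^{(r-1,s)}_\ell+\sum_{\ell\le2}\sum_{s\ge r}\varepsilon^sf^{(r-1,s)}_\ell,\qquad N^{(r-1)}=\omega^{(r-1)}\cdot p+\sum_j\Omega_j^{(r-1)}z_j\bar z_j,$$ with $f^{(r-1,s)}_\ell\in\mathcal P_\ell^{sK}$. The $r$-th normalization step defines $\chi^{(r)}_0,\chi_1^{(r)},\chi_2^{(r)}$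 by the homological equations $$L_{\chi_0^{(r)}}(\omega^{(r-1)}\cdot p)+f_0^{(r-1,r)}=\langle f_0^{(r-1,r)}\rangle_q,\qquad L_{\chi_1^{(r)}}N^{(r-1)}+f_1^{(\mathrm I;r,r)}=0,\qquad L_{\chi_2^{(r)}}N^{(r-1)}+f_2^{(\mathrm{II};r,r)}=Z^{(r)},$$ where $Z^{(r)}$ consists of the terms of $f_2^{(\mathrm{II};r,r)}$ in the monomials $p_j$ and $z_jw_j$ (with $k=0$), and each $\chi_j^{(r)}$ is the solution that has no monomials with $k=0$, $\lambda=\bar\lambda$. The functions $f_\ell^{(\mathrm I;r,s)}$, $f_\ell^{(\mathrm{II};r,s)}$, $f_\ell^{(r,s)}$ are the terms of degree $\ell$ and order $\varepsilon^s$ (the $\omega$'s and $\Omega$'s being treated as constants) of $$H^{(\mathrm I;r)}=\exp(\varepsilon^rL_{\chi_0^{(r)}})H^{(r-1)},\qquad H^{(\mathrm{II};r)}=\exp(\varepsilon^rL_{\chi_1^{(r)}})H^{(\mathrm I;r)},\qquad H^{(r)}=\exp(\varepsilon^rL_{\chi_2^{(r)}})H^{(\mathrm{II};r)},$$ where the constant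 $\langle f_0^{(r-1,r)}\rangle_q$ is dropped and $\varepsilon^rZ^{(r)}$ is moved into the frequencies: $$\omega_j^{(r)}=\omega_j^{(r-1)}+\varepsilon^r\,\frac{\partial Z^{(r)}}{\partial p_j},\qquad \Omega_j^{(r)}=\Omega_j^{(r-1)}+\varepsilon^r\,\frac{\partial^2Z^{(r)}}{\partial z_j\partial\bar z_j}.$$ **Constants.** Let $\delta_r=\frac1{2\pi^2r^2}$, $d_0=0$, $d_r=d_{r-1}+3\delta_r$, $$M=\max\Big\{1,\ \frac{4\pi^4\bar EK^\tau}{\gamma}\Big(\frac{2e}{\rho\sigma}+\frac{e^2}{R^2}\Big)\Big\},\qquad \mathcal A=M^3\,2^{12(4+\tau)}\,2^8 .$$ **Lemma.** Let $r\ge1$ and assume that the non-resonance conditions hold up to order $r$: for all $1\le r'\le r$ and all $\omega^{(0)}\in W$, $$\big|k\cdot\omega^{(r'-1)}+l\cdot\Omega^{(r'-1)}\big|\ge\frac{\gamma}{(r'K)^\tau}\quad(k\in\mathbb Z^{n_1},\ 0<|k|\le r'K,\ l\in\mathbb Z^{n_2},\ |l|\le2),\qquad \big|l\cdot\Omega^{(r'-1)}\big|\ge\gamma\quad(0<|l|\le2).$$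 Then the algorithm can be iterated up to $H^{(r-1)}$, which has the form above with $f_\ell^{(r-1,s)}\in\mathcal P_\ell^{sK}$, and the $r$-th step can be performed as well: for every $r'\le r$ the homological equations are solved by $\chi_j^{(r')}\in\mathcal P_j^{r'K}$, and $H^{(r')}$ is of the same form with $r'$ in place of $r-1$. If moreover (d') $\|f_\ell^{(0,s)}\|_1\le\bar E/2^\ell$ for all $\ell,s$, then $$\Big(\frac{2e}{\rho\sigma}+\frac{e^2}{R^2}\Big)\frac1{\delta_r^2}\,\big\|\chi_j^{(r)}\big\|_{1-d_{r-1}-j\delta_r}\le\mathcal A^r\qquad(j=0,1,2),$$ $$\big\|f_\ell^{(r,s)}\big\|_{1-d_r}\le\frac{\bar E}{2^\ell}\,\mathcal A^s\qquad(s>r\text{ if }0\le\ell\le2,\quad s\ge0\text{ if }\ell\ge3),$$ and, for every $\omega^{(0)}\in W$, $$\max_{i}\big|\omega_i^{(r)}-\omega_i^{(r-1)}\big|\le\gamma\sigma(\varepsilon\mathcal A)^r,\qquad \max_j\big|\Omega_j^{(r)}-\Omega_j^{(r-1)}\big|\le\gamma(\varepsilon\mathcal A)^r .$$ -/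

import Mathlib

noncomputable section

namespace EllipticTori

/-- Indices `(m, ℓ, ℓ', k)` of the monomials `p^m z^ℓ w^ℓ' exp(i k·q)`, with `m ∈ ℕ^{n₁}`,
`ℓ, ℓ' ∈ ℕ^{n₂}`, `k ∈ ℤ^{n₁}`; here `w` stands for `i z̄`. -/
abbrev Idx (n₁ n₂ : ℕ) : Type :=
  (Fin n₁ → ℕ) × (Fin n₂ → ℕ) × (Fin n₂ → ℕ) × (Fin n₁ → ℤ)

namespace Idx

variable {n₁ n₂ : ℕ}

/-- The exponent of `p`. -/
abbrev m (a : Idx n₁ n₂) : Fin n₁ → ℕ := a.1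

/-- The exponent of `z`. -/
abbrev l (a : Idx n₁ n₂) : Fin n₂ → ℕ := a.2.1

/-- The exponent of `w = i z̄`. -/
abbrev lbar (a : Idx n₁ n₂) : Fin n₂ → ℕ := a.2.2.1

/-- The Fourier harmonic. -/
abbrev k (a : Idx n₁ n₂) : Fin n₁ → ℤ := a.2.2.2

end Idx

/-- The functions `∑ c_{m,ℓ,ℓ',k} p^m z^ℓ w^ℓ' exp(i k·q)` with finitely many complex coefficients.
They form an algebra under pointwise multiplication, which adds the indices. -/
abbrev TrigPoly (n₁ n₂ : ℕ) : Type := AddMonoidAlgebra ℂ (Idx n₁ n₂)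

variable {n₁ n₂ : ℕ}

/-- The `ℓ¹`-norm of an integer vector. -/
def l1 {n : ℕ} (k : Fin n → ℤ) : ℤ := ∑ j, |k j|

/-- The class `𝒫_d^N`: only monomials with `2|m| + |ℓ| + |ℓ'| = d` and `|k| ≤ N`. -/
def InClass (d N : ℕ) (g : TrigPoly n₁ n₂) : Prop :=
  ∀ a : Idx n₁ n₂, g.coeff a ≠ 0 →
    2 * ∑ j, a.m j + ∑ j, a.l j + ∑ j, a.lbar j = d ∧ l1 a.k ≤ N

/-- `∂/∂p_j`. -/
def dP (j : Fin n₁) (g : TrigPoly n₁ n₂) : TrigPoly n₁ n₂ :=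
  g.coeff.sum fun a c =>
    AddMonoidAlgebra.single (a.m - Pi.single j 1, a.l, a.lbar, a.k) ((a.m j : ℂ) * c)

/-- `∂/∂q_j`. -/
def dQ (j : Fin n₁) (g : TrigPoly n₁ n₂) : TrigPoly n₁ n₂ :=
  g.coeff.sum fun a c => AddMonoidAlgebra.single a (Complex.I * (a.k j : ℂ) * c)

/-- `∂/∂z_j`. -/
def dZ (j : Fin n₂) (g : TrigPoly n₁ n₂) : TrigPoly n₁ n₂ :=
  g.coeff.sum fun a c =>
    AddMonoidAlgebra.single (a.m, a.l - Pi.single j 1, a.lbar, a.k) ((a.l j : ℂ) * c)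

/-- `∂/∂w_j`, with `w = i z̄`. -/
def dW (j : Fin n₂) (g : TrigPoly n₁ n₂) : TrigPoly n₁ n₂ :=
  g.coeff.sum fun a c =>
    AddMonoidAlgebra.single (a.m, a.l, a.lbar - Pi.single j 1, a.k) ((a.lbar j : ℂ) * c)

/-- The Lie derivative `L_χ g = {χ, g}`. The momenta are `p` and `z = (x + i y)/√2`, and the
coordinates conjugated to them are `q` and `w = i z̄`. -/
def lie (χ g : TrigPoly n₁ n₂) : TrigPoly n₁ n₂ :=
  ∑ j, (dQ j χ * dP j g - dP j χ * dQ j g) + ∑ j, (dW j χ * dZ j g - dZ j χ * dW j g)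

/-- The value at `(p, z, w)` of the Fourier coefficient `g_k` in `g = ∑_k g_k(p,z,w) exp(i k·q)`. -/
def fourierCoeff (g : TrigPoly n₁ n₂) (k : Fin n₁ → ℤ) (p : Fin n₁ → ℂ) (z w : Fin n₂ → ℂ) : ℂ :=
  g.coeff.sum fun a c =>
    if a.k = k then c * ((∏ j, p j ^ a.m j) * (∏ j, z j ^ a.l j) * ∏ j, w j ^ a.lbar j) else 0

/-- The weighted Fourier norm `∑_k |g_k| exp(|k| σ)` of a family `g` of functions depending on a
parameter in `W`, where `|g_k|` is the supremum over `|p_j| < ρ`, `|z_j| < R`, `|w_j| < R` and over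
the parameter. -/
def wnorm {Λ : Type*} (W : Set Λ) (ρ σ R : ℝ) (g : Λ → TrigPoly n₁ n₂) : ENNReal :=
  ∑' k : Fin n₁ → ℤ,
    (⨆ ω ∈ W, ⨆ (p : Fin n₁ → ℂ) (_ : ∀ j, ‖p j‖ < ρ) (z : Fin n₂ → ℂ) (_ : ∀ j, ‖z j‖ < R)
      (w : Fin n₂ → ℂ) (_ : ∀ j, ‖w j‖ < R), ENNReal.ofReal ‖fourierCoeff (g ω) k p z w‖) *
    ENNReal.ofReal (Real.exp ((l1 k : ℝ) * σ))

/-- `k·ω + ℓ·Ω`. -/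
def divisor (ω : Fin n₁ → ℂ) (Ω : Fin n₂ → ℂ) (k : Fin n₁ → ℤ) (l : Fin n₂ → ℤ) : ℂ :=
  ∑ j, (k j : ℂ) * ω j + ∑ j, (l j : ℂ) * Ω j

/-- The non-resonance conditions at order `r` on the frequency vectors `ω`, `Ω`. -/
def NonResonant (K : ℕ) (γ τ : ℝ) (r : ℕ) (ω : Fin n₁ → ℂ) (Ω : Fin n₂ → ℂ) : Prop :=
  (∀ (k : Fin n₁ → ℤ) (l : Fin n₂ → ℤ), 0 < l1 k → l1 k ≤ (r * K : ℕ) → l1 l ≤ 2 →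
    γ / ((r * K : ℕ) : ℝ) ^ τ ≤ ‖divisor ω Ω k l‖) ∧
  (∀ l : Fin n₂ → ℤ, 0 < l1 l → l1 l ≤ 2 → γ ≤ ‖divisor ω Ω 0 l‖)

/-- `ω·p`. -/
def actionPart (ω : Fin n₁ → ℂ) : TrigPoly n₁ n₂ :=
  ∑ j, AddMonoidAlgebra.single (Pi.single j 1, 0, 0, 0) (ω j)

/-- `ω·p + ∑ Ω_j z_j z̄_j`, written through `z_j z̄_j = -i z_j w_j`. -/
def normalPart (ω : Fin n₁ → ℂ) (Ω : Fin n₂ → ℂ) : TrigPoly n₁ n₂ :=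
  actionPart ω +
    ∑ j, AddMonoidAlgebra.single (0, Pi.single j 1, Pi.single j 1, 0) (-Complex.I * Ω j)

/-- The average over the angles `q`. -/
def average (g : TrigPoly n₁ n₂) : TrigPoly n₁ n₂ :=
  g.coeff.sum fun a c => if a.k = 0 then AddMonoidAlgebra.single a c else 0

/-- The solution `χ` of the homological equation `L_χ (ω·p + ∑ Ω_j z_j z̄_j) + g = Z`, where `Z`
collects the monomials of `g` with `k = 0` and `ℓ = ℓ'`: every other coefficient of `g` is divided
by `-i [k·ω + (ℓ - ℓ')·Ω]`. -/
def solveHomological (ω : Fin n₁ → ℂ) (Ω : Fin n₂ → ℂ) (g : TrigPoly n₁ n₂) : TrigPoly n₁ n₂ :=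
  g.coeff.sum fun a c =>
    if a.k = 0 ∧ a.l = a.lbar then 0
    else AddMonoidAlgebra.single a
      (-(c / (Complex.I * divisor ω Ω a.k (fun j => (a.l j : ℤ) - (a.lbar j : ℤ)))))

/-- A Hamiltonian `ω·p + ∑_j Ω_j z_j z̄_j + ∑_{ℓ,s} ε^s f_ℓ^{(s)}`, given by its frequencies and the
terms of its expansion. -/
structure Ham (n₁ n₂ : ℕ) where
  /-- the frequencies on the torus -/
  ω : Fin n₁ → ℂ
  /-- the transverse frequencies -/
  Ω : Fin n₂ → ℂ
  /-- `f ℓ s` is `f_ℓ^{(s)}` -/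
  f : ℕ → ℕ → TrigPoly n₁ n₂

namespace Ham

/-- The Hamiltonian is in normal form up to order `r`: `f_ℓ^{(s)} ∈ 𝒫_ℓ^{sK}`, and the sums of the
terms with `ℓ = 0, 1, 2` start from `s = r + 1`. -/
def HasForm (K r : ℕ) (H : Ham n₁ n₂) : Prop :=
  (∀ l s, InClass l (s * K) (H.f l s)) ∧ ∀ l s, l ≤ 2 → s ≤ r → H.f l s = 0

/-- The generating function `χ₀^{(r)}`, where `H` is `H^{(r-1)}`. -/
def chi0 (r : ℕ) (H : Ham n₁ n₂) : TrigPoly n₁ n₂ := solveHomological H.ω H.Ω (H.f 0 r)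

/-- `f_ℓ^{(I;r,s)}`. -/
def fI (r : ℕ) (H : Ham n₁ n₂) (l s : ℕ) : TrigPoly n₁ n₂ :=
  if l = 0 ∧ s = r then 0
  else if l = 0 ∧ s < 2 * r then H.f 0 s
  else ∑ j ∈ Finset.range (s / r + 1),
    ((1 : ℂ) / (j.factorial : ℂ)) • (lie (H.chi0 r))^[j] (H.f (l + 2 * j) (s - j * r))

/-- The generating function `χ₁^{(r)}`. -/
def chi1 (r : ℕ) (H : Ham n₁ n₂) : TrigPoly n₁ n₂ := solveHomological H.ω H.Ω (H.fI r 1 r)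

/-- `f_ℓ^{(II;r,s)}`. -/
def fII (r : ℕ) (H : Ham n₁ n₂) (l s : ℕ) : TrigPoly n₁ n₂ :=
  if l ≤ 1 ∧ s = r then 0
  else if l ≤ 1 ∧ s < 2 * r then H.fI r l s
  else if l = 0 ∧ s = 2 * r then
    H.fI r 0 (2 * r) + ((1 : ℂ) / 2) • lie (H.chi1 r) (H.fI r 1 r)
  else if l = 0 ∧ s < 3 * r then H.fI r 0 s + lie (H.chi1 r) (H.fI r 1 (s - r))
  else ∑ j ∈ Finset.range (s / r + 1),
    ((1 : ℂ) / (j.factorial : ℂ)) • (lie (H.chi1 r))^[j] (H.fI r (l + j) (s - j * r))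

/-- The generating function `χ₂^{(r)}`. -/
def chi2 (r : ℕ) (H : Ham n₁ n₂) : TrigPoly n₁ n₂ := solveHomological H.ω H.Ω (H.fII r 2 r)

/-- `∂Z^{(r)}/∂p_j`, the coefficient of `p_j` in `f₂^{(II;r,r)}`. -/
def zP (r : ℕ) (H : Ham n₁ n₂) (j : Fin n₁) : ℂ :=
  (H.fII r 2 r).coeff (Pi.single j 1, 0, 0, 0)

/-- `∂²Z^{(r)}/∂z_j∂w_j`, the coefficient of `z_j w_j` in `f₂^{(II;r,r)}`. -/
def zZ (r : ℕ) (H : Ham n₁ n₂) (j : Fin n₂) : ℂ :=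
  (H.fII r 2 r).coeff (0, Pi.single j 1, Pi.single j 1, 0)

/-- `Z^{(r)} = ∑_j (∂Z/∂p_j) p_j + ∑_j (∂²Z/∂z_j∂w_j) z_j w_j`. -/
def Z (r : ℕ) (H : Ham n₁ n₂) : TrigPoly n₁ n₂ :=
  ∑ j, AddMonoidAlgebra.single (Pi.single j 1, 0, 0, 0) (H.zP r j) +
    ∑ j, AddMonoidAlgebra.single (0, Pi.single j 1, Pi.single j 1, 0) (H.zZ r j)

/-- `f_ℓ^{(r,s)}`. -/
def fNext (r : ℕ) (H : Ham n₁ n₂) (l s : ℕ) : TrigPoly n₁ n₂ :=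
  if l ≤ 2 ∧ s ≤ r then 0
  else if l ≤ 1 then
    ∑ j ∈ Finset.range (s / r),
      ((1 : ℂ) / (j.factorial : ℂ)) • (lie (H.chi2 r))^[j] (H.fII r l (s - j * r))
  else if l = 2 ∧ r ∣ s then
    ((((s / r : ℕ) : ℂ) - 1) / ((s / r).factorial : ℂ)) •
        (lie (H.chi2 r))^[s / r - 1] (H.fII r 2 r) +
      ((1 : ℂ) / ((s / r).factorial : ℂ)) • (lie (H.chi2 r))^[s / r - 1] (H.Z r) +
      ∑ i ∈ Finset.range (s / r - 1),
        ((1 : ℂ) / (i.factorial : ℂ)) • (lie (H.chi2 r))^[i] (H.fII r 2 (s - i * r))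
  else if l = 2 then
    ∑ i ∈ Finset.range (s / r),
      ((1 : ℂ) / (i.factorial : ℂ)) • (lie (H.chi2 r))^[i] (H.fII r 2 (s - i * r))
  else
    ∑ j ∈ Finset.range (s / r + 1),
      ((1 : ℂ) / (j.factorial : ℂ)) • (lie (H.chi2 r))^[j] (H.fII r l (s - j * r))

/-- The `r`-th normalization step, from `H^{(r-1)}` to `H^{(r)}`. The correction of `Ω_j` is
`ε^r ∂²Z/∂z_j∂z̄_j = i ε^r ∂²Z/∂z_j∂w_j`. -/
def step (ε : ℝ) (r : ℕ) (H : Ham n₁ n₂) : Ham n₁ n₂ where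
  ω := fun j => H.ω j + (ε : ℂ) ^ r * H.zP r j
  Ω := fun j => H.Ω j + (ε : ℂ) ^ r * (Complex.I * H.zZ r j)
  f := H.fNext r

/-- The sequence `H^{(r)}` produced from `H^{(0)}` by the formal algorithm. -/
def normalize (ε : ℝ) (H : Ham n₁ n₂) : ℕ → Ham n₁ n₂
  | 0 => H
  | r + 1 => (normalize ε H r).step ε (r + 1)

end Ham

/-- The component of degree `ℓ` and order `s` (the coefficient of `ε^s`) of the formal series
`N + ∑ ε^s f_ℓ^{(s)}`, for `N` of degree `2` and order `0`. -/
def components (N : TrigPoly n₁ n₂) (f : ℕ → ℕ → TrigPoly n₁ n₂) (l s : ℕ) : TrigPoly n₁ n₂ :=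
  (if l = 2 ∧ s = 0 then N else 0) + f l s

/-- The component of degree `ℓ` and order `s` of the Lie series `exp(ε^r L_χ)` applied to the formal
series with components `F`, when `χ` has degree `2 - d`, so that `L_χ` lowers degrees by `d`. -/
def lieSeries (r d : ℕ) (χ : TrigPoly n₁ n₂) (F : ℕ → ℕ → TrigPoly n₁ n₂) (l s : ℕ) :
    TrigPoly n₁ n₂ :=
  ∑ j ∈ Finset.range (s / r + 1),
    ((1 : ℂ) / (j.factorial : ℂ)) • (lie χ)^[j] (F (l + d * j) (s - j * r))

/-- The `r`-th normalization step can be performed on `H = H^{(r-1)}`: the generating functions are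
in their classes and solve the three homological equations, the intermediate Hamiltonians and
`H^{(r)}` have the prescribed form, and these are the Lie transforms of `H`, order by order in `ε`
(up to the constant `⟨f₀^{(r-1,r)}⟩`, and with `ε^r Z^{(r)}` moved into the frequencies). -/
structure StepPerformed (K : ℕ) (ε : ℝ) (r : ℕ) (H : Ham n₁ n₂) : Prop where
  chi0_mem : InClass 0 (r * K) (H.chi0 r)
  chi1_mem : InClass 1 (r * K) (H.chi1 r)
  chi2_mem : InClass 2 (r * K) (H.chi2 r)
  homological0 : lie (H.chi0 r) (actionPart H.ω) + H.f 0 r - average (H.f 0 r) = 0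
  homological1 : lie (H.chi1 r) (normalPart H.ω H.Ω) + H.fI r 1 r = 0
  homological2 : lie (H.chi2 r) (normalPart H.ω H.Ω) + H.fII r 2 r = H.Z r
  fI_mem : ∀ l s, InClass l (s * K) (H.fI r l s)
  fI_zero : ∀ l s, l ≤ 2 → s < r ∨ (l = 0 ∧ s = r) → H.fI r l s = 0
  fII_mem : ∀ l s, InClass l (s * K) (H.fII r l s)
  fII_zero : ∀ l s, l ≤ 2 → s < r ∨ (l ≤ 1 ∧ s = r) → H.fII r l s = 0
  next_form : (H.step ε r).HasForm K r
  lieI : ∀ l s, lieSeries r 2 (H.chi0 r) (components (normalPart H.ω H.Ω) H.f) l s =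
    components (normalPart H.ω H.Ω) (H.fI r) l s +
      if l = 0 ∧ s = r then average (H.f 0 r) else 0
  lieII : ∀ l s, lieSeries r 1 (H.chi1 r) (components (normalPart H.ω H.Ω) (H.fI r)) l s =
    components (normalPart H.ω H.Ω) (H.fII r) l s
  lieIII : ∀ l s, lieSeries r 0 (H.chi2 r) (components (normalPart H.ω H.Ω) (H.fII r)) l s =
    components (normalPart H.ω H.Ω) (H.step ε r).f l s + if l = 2 ∧ s = r then H.Z r else 0
  frequencies : normalPart (H.step ε r).ω (H.step ε r).Ω =
    normalPart H.ω H.Ω + ((ε : ℂ) ^ r) • H.Z r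

/-- `δ_r = 1 / (2 π² r²)`. -/
def delta (r : ℕ) : ℝ := 1 / (2 * Real.pi ^ 2 * (r : ℝ) ^ 2)

/-- `d_0 = 0`, `d_r = d_{r-1} + 3 δ_r`. -/
def dom : ℕ → ℝ
  | 0 => 0
  | r + 1 => dom r + 3 * delta (r + 1)

/-- `‖g‖_α`, the norm on the domain with parameters `α (ρ, σ, R)`. -/
def anorm {Λ : Type*} (W : Set Λ) (ρ σ R α : ℝ) (g : Λ → TrigPoly n₁ n₂) : ENNReal :=
  wnorm W (α * ρ) (α * σ) (α * R) g

/-- `2e/(ρσ) + e²/R²`. -/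
def lieConst (ρ σ R : ℝ) : ℝ := 2 * Real.exp 1 / (ρ * σ) + Real.exp 1 ^ 2 / R ^ 2

/-- `(2e/(ρσ) + e²/R²) δ_r⁻² ‖χ‖_α`. -/
def scaledNorm {Λ : Type*} (W : Set Λ) (ρ σ R : ℝ) (r : ℕ) (α : ℝ) (χ : Λ → TrigPoly n₁ n₂) :
    ENNReal :=
  ENNReal.ofReal (lieConst ρ σ R * (1 / delta r ^ 2)) * anorm W ρ σ R α χ

/-- `M = max {1, (4 π⁴ Ē K^τ / γ) (2e/(ρσ) + e²/R²)}`. -/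
def constM (K : ℕ) (ρ σ R Ebar γ τ : ℝ) : ℝ :=
  max 1 (4 * Real.pi ^ 4 * Ebar * (K : ℝ) ^ τ / γ * lieConst ρ σ R)

/-- `𝒜 = M³ 2^{12(4+τ)} 2⁸`. -/
def constA (K : ℕ) (ρ σ R Ebar γ τ : ℝ) : ℝ :=
  constM K ρ σ R Ebar γ τ ^ 3 * (2 : ℝ) ^ (12 * (4 + τ)) * 2 ^ 8

end EllipticTori

end

/-! Algebra. `lie χ N` is diagonal on monomials: for the normal part it multiplies the coefficient
of p^m z^λ w^λ̄ e^{ik·q} by i(k·ω + (λ-λ̄)·Ω). In degree at most 2 one has |λ-λ̄| ≤ 2, so the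
non-resonance conditions cover every divisor that is needed, and division solves the homological
equations (`lie_solveHomological`). The Lie series of the full Hamiltonian then differ from those of
the perturbation only through the iterates of `lie χ` on N, and these are rewritten with the
homological equations (`Ham.lieI`, `Ham.lieII`, `Ham.lieIII`).

Division. The norm takes suprema of Fourier coefficients on polydiscs, so dividing monomial by
monomial is a multiplier problem. For a complex number t the rotations z_j ↦ e^{iθ_j} z_j, w_j ↦
e^{-iθ_j} w_j with θ_j = Re(tΩ_j) preserve the polydisc and multiply the monomial of divisor ζ by
e^{i Re(tζ)}, up to a phase depending only on k. It therefore suffices to write 1/ζ, for |ζ| ≥ 1, as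
a superposition of the characters e^{i Re(tζ)} with finite total mass, giving 0 at ζ = 0. Squared
Fejér kernels give mass at most 10, whatever the dimensions (`norm_sum_mul_inv_le`,
`NormLE.solveHomological`). Likewise the resonant part is an average over rotations by cube roots of
unity, hence has norm at most that of the function.

Brackets. The sums over j in the Poisson bracket are derivatives along a single direction, so
Cauchy's estimate applies once and no dimension enters (`norm_bracketCoeff_le`). Splitting a domain
loss δ into j equal parts and using j^j/j! ≤ e^j bounds the j-th term of a Lie series by a j-th
power (`NormLE.lie_iterate`).

Accumulation of divisors. The divisor and domain losses at order r are polynomial in r, hence at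
most Q^n with Q = 2^{2(4+τ)} and n the number of binary digits of r: one factor Q for each scale 2^m
≤ r. For a term of degree l and order s, scale μ is charged at most 3⌊s/μ⌋-(3-l) times (truncated
subtractions). This count survives every Lie series: floors are superadditive, and a bracket with a
generator of degree i is taken on a term of degree higher by 2-i (`growthExp_step`). Summing
3⌊s/2^m⌋ over m gives at most 6s, whence Q^{6s} = 2^{12(4+τ)s} in 𝒜^s.

Induction. Each generator carries an additional small factor 1/(16r²), so a Lie series costs at most
1/(1-1/(16r²)). The product of all these losses stays below 2, and Σ 3δ_r ≤ 1/3 keeps all domains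
above half size (`stepEstimates`, `normalize_stepBound`). -/

noncomputable section

namespace EllipticTori

/-! ### Division by numbers of modulus at least one as a bounded multiplier. -/

section Multiplier

open MeasureTheory Real

/-- The tent function on `[-1, 1]`. -/
noncomputable def tent (x : ℝ) : ℝ := max 0 (1 - |x|)

lemma continuous_tent : Continuous tent := by unfold tent; fun_prop

lemma tent_eq_zero {x : ℝ} (h : 1 ≤ |x|) : tent x = 0 := max_eq_left (by linarith)

lemma tent_neg (x : ℝ) : tent (-x) = tent x := by simp [tent]

lemma tent_of_mem {x : ℝ} (h0 : 0 ≤ x) (h1 : x ≤ 1) : tent x = 1 - x := by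
  rw [tent, abs_of_nonneg h0, max_eq_right (by linarith)]

lemma integral_tent_mul (g : ℝ → ℂ) (hg : Continuous g) :
    ∫ x, (tent x : ℂ) * g x = ∫ x in (0 : ℝ)..1, (1 - (x : ℂ)) * (g x + g (-x)) := by
  have hc : Continuous fun x => (tent x : ℂ) * g x :=
    (Complex.continuous_ofReal.comp continuous_tent).mul hg
  have h1 : ∫ x, (tent x : ℂ) * g x = ∫ x in (-1 : ℝ)..1, (tent x : ℂ) * g x := by
    rw [intervalIntegral.integral_of_le (by norm_num)]
    refine (setIntegral_eq_integral_of_forall_compl_eq_zero fun x hx => ?_).symm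
    rw [tent_eq_zero, Complex.ofReal_zero, zero_mul]
    by_contra! h
    exact hx ⟨(abs_lt.1 h).1, (abs_lt.1 h).2.le⟩
  have h2 : ∫ x in (-1 : ℝ)..0, (tent x : ℂ) * g x = ∫ x in (0 : ℝ)..1, (tent x : ℂ) * g (-x) := by
    have := intervalIntegral.integral_comp_neg (a := 0) (b := 1) (fun x => (tent x : ℂ) * g x)
    simp only [tent_neg, neg_zero] at this
    rw [this]
  have hc' : Continuous fun x => (tent x : ℂ) * g (-x) :=
    (Complex.continuous_ofReal.comp continuous_tent).mul (hg.comp continuous_neg)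
  rw [h1, ← intervalIntegral.integral_add_adjacent_intervals (hc.intervalIntegrable _ 0)
    (hc.intervalIntegrable _ _), h2,
    ← intervalIntegral.integral_add (hc'.intervalIntegrable _ _) (hc.intervalIntegrable _ _)]
  refine intervalIntegral.integral_congr fun x hx => ?_
  rw [Set.uIcc_of_le zero_le_one] at hx
  simp only [tent_of_mem hx.1 hx.2]
  push_cast; ring

lemma integrable_tent : Integrable fun x => (tent x : ℂ) := by
  refine (Complex.continuous_ofReal.comp continuous_tent).integrable_of_hasCompactSupport ?_
  refine HasCompactSupport.intro (isCompact_Icc (a := (-1 : ℝ)) (b := 1)) fun x hx => ?_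
  simp only [Function.comp_apply, Complex.ofReal_eq_zero]
  refine tent_eq_zero ?_
  by_contra! h
  exact hx ⟨(abs_lt.1 h).1.le, (abs_lt.1 h).2.le⟩

lemma integral_one_sub_mul_exp {c : ℂ} (hc : c ≠ 0) :
    ∫ x in (0 : ℝ)..1, (1 - (x : ℂ)) * Complex.exp (c * x)
      = (Complex.exp c - 1 - c) / c ^ 2 := by
  have hd : ∀ x ∈ Set.uIcc (0 : ℝ) 1, HasDerivAt
      (fun y : ℝ => (1 - (y : ℂ)) * Complex.exp (c * y) / c + Complex.exp (c * y) / c ^ 2)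
      ((1 - (x : ℂ)) * Complex.exp (c * x)) x := by
    intro x _
    have h0 : HasDerivAt (fun y : ℝ => (y : ℂ)) 1 x := Complex.ofRealCLM.hasDerivAt
    have h1 : HasDerivAt (fun y : ℝ => Complex.exp (c * y)) (Complex.exp (c * x) * (c * 1)) x :=
      (h0.const_mul c).cexp
    refine ((((h0.const_sub 1).mul h1).div_const c).add (h1.div_const (c ^ 2))).congr_deriv ?_
    field_simp
    ring
  rw [intervalIntegral.integral_eq_sub_of_hasDerivAt hd]
  · simp only [Complex.ofReal_one, Complex.ofReal_zero, sub_self, zero_mul, zero_div, mul_one,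
      mul_zero, Complex.exp_zero, sub_zero, zero_add]
    field_simp
    ring
  · exact Continuous.intervalIntegrable (by fun_prop) _ _

/-- After folding the integral onto [0, 1] it equals (e^c + e^{-c} - 2)/c² with c = 2πit, and the
numerator is -4 sin²(πt). -/
lemma fourier_tent (t : ℝ) :
    FourierTransform.fourier (fun x : ℝ => (tent x : ℂ)) t = ((sinc (π * t) ^ 2 : ℝ) : ℂ) := by
  rw [fourier_real_eq_integral_exp_smul]
  simp only [smul_eq_mul]
  simp_rw [mul_comm _ ((tent _ : ℂ))]
  rw [integral_tent_mul _ (by fun_prop)]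
  rcases eq_or_ne t 0 with rfl | ht
  · simp only [mul_zero, Complex.ofReal_zero, zero_mul, Complex.exp_zero, sinc_zero, one_pow,
      Complex.ofReal_one]
    have : ∫ x in (0:ℝ)..1, (1 - (x : ℂ)) * (1 + 1) = ((∫ x in (0:ℝ)..1, (1 - x) * 2 : ℝ) : ℂ) := by
      rw [← intervalIntegral.integral_ofReal]
      refine intervalIntegral.integral_congr fun x _ => ?_
      push_cast; ring
    rw [this]
    rw [intervalIntegral.integral_mul_const, intervalIntegral.integral_sub (by simp) (by simp)]
    simp
    norm_num
  · set c : ℂ := 2 * (π * t : ℝ) * Complex.I with hc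
    have hpt : π * t ≠ 0 := mul_ne_zero pi_ne_zero ht
    have hc0 : c ≠ 0 := by
      rw [hc]; simp [ht, pi_ne_zero]
    have : ∀ x : ℝ, (1 - (x : ℂ)) * (Complex.exp (((-2 * π * x * t : ℝ) : ℂ) * Complex.I)
        + Complex.exp (((-2 * π * (-x) * t : ℝ) : ℂ) * Complex.I))
        = (1 - (x : ℂ)) * Complex.exp (-c * x) + (1 - (x : ℂ)) * Complex.exp (c * x) := by
      intro x
      rw [mul_add]
      congr 3 <;> rw [hc] <;> push_cast <;> ring
    simp_rw [this]
    rw [intervalIntegral.integral_add (Continuous.intervalIntegrable (by fun_prop) _ _)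
      (Continuous.intervalIntegrable (by fun_prop) _ _), integral_one_sub_mul_exp hc0,
      integral_one_sub_mul_exp (neg_ne_zero.2 hc0), sinc_of_ne_zero hpt]
    have e : Complex.exp c + Complex.exp (-c) = 2 - 4 * (sin (π * t) : ℂ) ^ 2 := by
      have h1 : Complex.exp c + Complex.exp (-c) = 2 * Complex.cos (2 * (π * t : ℝ)) := by
        rw [Complex.cos, hc, neg_mul]; ring
      rw [h1, Complex.cos_two_mul, Complex.cos_sq', Complex.ofReal_sin]; ring
    have hc2 : c ^ 2 = -4 * ((π * t : ℝ) : ℂ) ^ 2 := by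
      rw [hc, mul_pow, Complex.I_sq]; ring
    have hpt' : ((π * t : ℝ) : ℂ) ≠ 0 := Complex.ofReal_ne_zero.2 hpt
    rw [neg_sq, ← add_div]
    have : Complex.exp (-c) - 1 - -c + (Complex.exp c - 1 - c) = - 4 * (sin (π * t) : ℂ) ^ 2 := by
      linear_combination e
    rw [this, hc2, Complex.ofReal_pow, Complex.ofReal_div]
    field_simp

lemma sinc_sq_le (v : ℝ) : sinc v ^ 2 * (1 + v ^ 2) ≤ 2 := by
  have h1 : sinc v ^ 2 ≤ 1 := (sq_le_one_iff_abs_le_one _).2 (abs_sinc_le_one v)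
  have h2 : sinc v ^ 2 * v ^ 2 ≤ 1 := by
    rcases eq_or_ne v 0 with rfl | hv
    · simp
    · rw [sinc_of_ne_zero hv, div_pow, div_mul_cancel₀ _ (pow_ne_zero _ hv)]
      exact sin_sq_le_one v
  linarith

lemma sinc_sq_mul_sq_le (v : ℝ) : sinc v ^ 2 * v ^ 2 ≤ 1 := by
  rcases eq_or_ne v 0 with rfl | hv
  · simp
  · rw [sinc_of_ne_zero hv, div_pow, div_mul_cancel₀ _ (pow_ne_zero _ hv)]
    exact sin_sq_le_one v

/-- The Fejér kernel. -/
noncomputable def fejer (t : ℝ) : ℝ := sinc (π * t) ^ 2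

lemma continuous_fejer : Continuous fejer := by
  unfold fejer
  exact (continuous_sinc.comp (by fun_prop)).pow 2

lemma fejer_nonneg (t : ℝ) : 0 ≤ fejer t := sq_nonneg _

lemma fejer_le_one (t : ℝ) : fejer t ≤ 1 := (sq_le_one_iff_abs_le_one _).2 (abs_sinc_le_one _)

lemma fejer_mul_sq_le (t : ℝ) : fejer t * t ^ 2 ≤ 1 / π ^ 2 := by
  have := sinc_sq_mul_sq_le (π * t)
  rw [le_div_iff₀ (by positivity), fejer]
  linarith [mul_pow π t 2, mul_assoc (sinc (π * t) ^ 2) (t ^ 2) (π ^ 2), mul_comm (π^2) (t^2)]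

lemma integrable_fejer : Integrable fejer := by
  refine (integrable_inv_one_add_sq.const_mul 2).mono' continuous_fejer.aestronglyMeasurable
    (Filter.Eventually.of_forall fun t => ?_)
  rw [norm_of_nonneg (fejer_nonneg t), ← div_eq_mul_inv, le_div_iff₀ (by positivity)]
  have h := sinc_sq_le (π * t)
  have h1 : fejer t * (1 + t ^ 2) ≤ sinc (π * t) ^ 2 * (1 + (π * t) ^ 2) := by
    refine mul_le_mul_of_nonneg_left ?_ (sq_nonneg _)
    rw [mul_pow]
    have : 1 ≤ π ^ 2 := one_le_pow₀ (by linarith [pi_gt_three])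
    nlinarith [sq_nonneg t]
  linarith

/-- Fourier inversion applies because the tent is continuous and integrable, and its transform is
integrable. -/
lemma fourierInv_fejer (x : ℝ) :
    ∫ t : ℝ, Complex.exp (((2 * π * t * x : ℝ) : ℂ) * Complex.I) * (fejer t : ℂ) = tent x := by
  have h := Continuous.fourierInv_fourier_eq (f := fun x : ℝ => (tent x : ℂ))
    (Complex.continuous_ofReal.comp continuous_tent) integrable_tent (by
      have : FourierTransform.fourier (fun x : ℝ => (tent x : ℂ)) = fun t => (fejer t : ℂ) :=
        funext fourier_tent
      rw [this]
      exact integrable_fejer.ofReal)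
  have h2 := congrFun h x
  have : FourierTransform.fourier (fun x : ℝ => (tent x : ℂ)) = fun t => (fejer t : ℂ) :=
        funext fourier_tent
  rw [this, fourierInv_eq'] at h2
  simp only [smul_eq_mul] at h2
  rw [← h2]
  refine integral_congr_ae (Filter.Eventually.of_forall fun t => ?_)
  simp
  left
  congr 2
  ring

lemma integral_fejer : ∫ t, fejer t = 1 := by
  have := fourierInv_fejer 0
  simp [tent] at this
  rw [integral_complex_ofReal] at this
  exact_mod_cast this

/-- The multiplication formula ∫ f̂ g = ∫ f ĝ, with f the tent and g a modulated Fejér kernel, whose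
transform is a translated tent. The result is a convolution of tents, so it has compact support. -/
lemma integral_fejer_sq_exp (ξ : ℝ) :
    ∫ t : ℝ, Complex.exp (((2 * π * t * ξ : ℝ) : ℂ) * Complex.I) * ((fejer t ^ 2 : ℝ) : ℂ)
      = ∫ x : ℝ, (tent x : ℂ) * (tent (ξ - x) : ℂ) := by
  have hg : Integrable fun t : ℝ =>
      Complex.exp (((2 * π * t * ξ : ℝ) : ℂ) * Complex.I) * (fejer t : ℂ) := by
    refine integrable_fejer.ofReal.bdd_mul (c := 1) (by fun_prop)
      (Filter.Eventually.of_forall fun t => ?_)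
    rw [Complex.norm_exp_ofReal_mul_I]
  have h := VectorFourier.integral_fourierIntegral_smul_eq_flip (μ := volume) (ν := volume)
    (L := innerₗ ℝ) continuous_fourierChar continuous_inner integrable_tent hg
  have e1 : ∀ t, VectorFourier.fourierIntegral fourierChar volume (innerₗ ℝ)
      (fun x : ℝ => (tent x : ℂ)) t = (fejer t : ℂ) := fourier_tent
  have e2 : ∀ x, VectorFourier.fourierIntegral fourierChar volume (innerₗ ℝ).flip
      (fun t : ℝ => Complex.exp (((2 * π * t * ξ : ℝ) : ℂ) * Complex.I) * (fejer t : ℂ)) x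
      = (tent (ξ - x) : ℂ) := by
    intro x
    rw [flip_innerₗ]
    change FourierTransform.fourier (fun t : ℝ => Complex.exp (((2 * π * t * ξ : ℝ) : ℂ) * Complex.I)
      * (fejer t : ℂ)) x = _
    rw [fourier_real_eq_integral_exp_smul, ← fourierInv_fejer]
    refine integral_congr_ae (Filter.Eventually.of_forall fun t => ?_)
    simp only [smul_eq_mul]
    rw [← mul_assoc, ← Complex.exp_add]
    congr 2
    push_cast; ring
  simp only [e1, e2, smul_eq_mul] at h
  rw [← h]
  refine integral_congr_ae (Filter.Eventually.of_forall fun t => ?_)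
  simp only
  push_cast; ring

lemma integral_fejer_sq_exp_eq_zero {ξ : ℝ} (hξ : 2 ≤ |ξ|) :
    ∫ t : ℝ, Complex.exp (((2 * π * t * ξ : ℝ) : ℂ) * Complex.I) * ((fejer t ^ 2 : ℝ) : ℂ) = 0 := by
  rw [integral_fejer_sq_exp]
  refine (integral_congr_ae (Filter.Eventually.of_forall fun x => ?_)).trans (integral_zero _ _)
  rcases le_total 1 |x| with h | h
  · rw [tent_eq_zero h]; simp
  · rw [tent_eq_zero (x := ξ - x)]; · simp
    have := abs_sub_abs_le_abs_sub ξ x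
    linarith

lemma integral_fejer_sq : ∫ t : ℝ, fejer t ^ 2 = 2 / 3 := by
  have h := integral_fejer_sq_exp 0
  simp only [mul_zero, Complex.ofReal_zero, zero_mul, Complex.exp_zero, one_mul, zero_sub,
    tent_neg] at h
  rw [integral_complex_ofReal, integral_tent_mul (fun x => (tent x : ℂ))
    (Complex.continuous_ofReal.comp continuous_tent)] at h
  have : ∫ x in (0:ℝ)..1, (1 - (x : ℂ)) * ((tent x : ℂ) + (tent (-x) : ℂ))
      = ((∫ x in (0:ℝ)..1, 2 * (1 - x) ^ 2 : ℝ) : ℂ) := by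
    rw [← intervalIntegral.integral_ofReal]
    refine intervalIntegral.integral_congr fun x hx => ?_
    rw [Set.uIcc_of_le zero_le_one] at hx
    simp only [tent_neg, tent_of_mem hx.1 hx.2]
    push_cast; ring
  rw [this] at h
  rw [Complex.ofReal_injective h, intervalIntegral.integral_const_mul,
    intervalIntegral.integral_comp_sub_left (fun x => x ^ 2)]
  simp
  norm_num

lemma integrable_fejer_sq : Integrable fun t => fejer t ^ 2 := by
  refine integrable_fejer.mono' (continuous_fejer.pow 2).aestronglyMeasurable
    (Filter.Eventually.of_forall fun t => ?_)
  rw [norm_of_nonneg (sq_nonneg _), sq]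
  exact mul_le_of_le_one_left (fejer_nonneg t) (fejer_le_one t)

/-- The kernel is squared to obtain a finite second moment: a single Fejér kernel decays only like
t⁻². -/
lemma sq_mul_fejer_sq_le (t : ℝ) : t ^ 2 * fejer t ^ 2 ≤ 1 / π ^ 2 * fejer t := by
  have := mul_le_mul_of_nonneg_right (fejer_mul_sq_le t) (fejer_nonneg t)
  linarith [this]

lemma integrable_sq_mul_fejer_sq : Integrable fun t => t ^ 2 * fejer t ^ 2 := by
  refine (integrable_fejer.const_mul (1 / π ^ 2)).mono'
    (by have := continuous_fejer; exact (by fun_prop : Continuous _).aestronglyMeasurable)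
    (Filter.Eventually.of_forall fun t => ?_)
  rw [norm_of_nonneg (by positivity)]
  exact sq_mul_fejer_sq_le t

lemma integral_sq_mul_fejer_sq_le : ∫ t, t ^ 2 * fejer t ^ 2 ≤ 1 / π ^ 2 := by
  calc _ ≤ ∫ t, 1 / π ^ 2 * fejer t :=
        integral_mono integrable_sq_mul_fejer_sq (integrable_fejer.const_mul _) sq_mul_fejer_sq_le
    _ = 1 / π ^ 2 := by rw [integral_const_mul, integral_fejer, mul_one]

/-- The integral, over the rotations of `w` and over the segments from the origin, of `w` times a
character. -/
noncomputable def rotInt (w ζ : ℂ) : ℂ :=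
  ∫ θ in (0 : ℝ)..(2 * π), ∫ s in (0 : ℝ)..1, Complex.exp (θ * Complex.I) * w *
    Complex.exp (((s * (Complex.exp (θ * Complex.I) * w * ζ).re : ℝ) : ℂ) * Complex.I)

lemma continuous_re_exp_mul (q : ℂ) :
    Continuous fun θ : ℝ => (Complex.exp (θ * Complex.I) * q).re :=
  Complex.continuous_re.comp (by fun_prop)

lemma hasDerivAt_re_exp_mul (q : ℂ) (θ : ℝ) :
    HasDerivAt (fun θ : ℝ => (Complex.exp (θ * Complex.I) * q).re)
      (-(Complex.exp (θ * Complex.I) * q).im) θ := by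
  have h0 : HasDerivAt (fun y : ℝ => (y : ℂ)) 1 θ := Complex.ofRealCLM.hasDerivAt
  have h1 := ((h0.mul_const Complex.I).cexp).mul_const q
  have h2 := Complex.reCLM.hasFDerivAt.comp_hasDerivAt θ h1
  refine h2.congr_deriv ?_
  have : Complex.exp (θ * Complex.I) * (1 * Complex.I) * q
      = Complex.I * (Complex.exp (θ * Complex.I) * q) := by ring
  rw [this, Complex.reCLM_apply, Complex.I_mul_re]

/-- The θ-derivative of Re(e^{iθ}q) is -Im(e^{iθ}q), so the integrand is the derivative of a
2π-periodic function. -/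
lemma integral_im_mul_exp_re (q : ℂ) {s : ℝ} (hs : s ≠ 0) :
    ∫ θ in (0 : ℝ)..(2 * π), ((Complex.exp (θ * Complex.I) * q).im : ℂ) *
      Complex.exp (((s * (Complex.exp (θ * Complex.I) * q).re : ℝ) : ℂ) * Complex.I) = 0 := by
  have hd : ∀ θ ∈ Set.uIcc 0 (2 * π), HasDerivAt (fun θ : ℝ => Complex.I / s *
      Complex.exp (((s * (Complex.exp (θ * Complex.I) * q).re : ℝ) : ℂ) * Complex.I))
      (((Complex.exp (θ * Complex.I) * q).im : ℂ) *
      Complex.exp (((s * (Complex.exp (θ * Complex.I) * q).re : ℝ) : ℂ) * Complex.I)) θ := by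
    intro θ _
    have h := ((((hasDerivAt_re_exp_mul q θ).const_mul s).ofReal_comp).mul_const
      Complex.I).cexp.const_mul (Complex.I / s)
    refine h.congr_deriv ?_
    have hs' : (s : ℂ) ≠ 0 := Complex.ofReal_ne_zero.2 hs
    push_cast
    field_simp
    rw [Complex.I_sq]
    ring
  have hc := continuous_re_exp_mul q
  have hc' : Continuous fun θ : ℝ => (Complex.exp (θ * Complex.I) * q).im :=
    Complex.continuous_im.comp (by fun_prop)
  rw [intervalIntegral.integral_eq_sub_of_hasDerivAt hd
    (Continuous.intervalIntegrable (by fun_prop) _ _)]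
  simp [Complex.exp_two_pi_mul_I]

lemma integral_mul_exp_segment (u : ℝ) :
    ∫ s in (0 : ℝ)..1, (u : ℂ) * Complex.exp (((s * u : ℝ) : ℂ) * Complex.I)
      = -Complex.I * (Complex.exp ((u : ℂ) * Complex.I) - 1) := by
  have hd : ∀ s ∈ Set.uIcc (0 : ℝ) 1, HasDerivAt (fun s : ℝ => -Complex.I *
      Complex.exp (((s * u : ℝ) : ℂ) * Complex.I))
      ((u : ℂ) * Complex.exp (((s * u : ℝ) : ℂ) * Complex.I)) s := by
    intro s _
    have h := (((((hasDerivAt_id s).mul_const u).ofReal_comp).mul_const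
      Complex.I).cexp).const_mul (-Complex.I)
    refine h.congr_deriv ?_
    simp only [id, one_mul]
    linear_combination (-(u : ℂ) * Complex.exp (((s * u : ℝ) : ℂ) * Complex.I)) * Complex.I_mul_I
  rw [intervalIntegral.integral_eq_sub_of_hasDerivAt hd
    (Continuous.intervalIntegrable (by fun_prop) _ _)]
  simp
  ring

/-- With Z = e^{iθ}wζ the integrand becomes Z e^{is Re Z}. Its part with Im Z vanishes after
integration over θ, and its part with Re Z is an exact derivative in s. The average over θ is what
turns division by the complex number ζ into differences of characters of real phase. -/
lemma rotInt_mul (w ζ : ℂ) :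
    rotInt w ζ * ζ = -Complex.I * ∫ θ in (0 : ℝ)..(2 * π),
      (Complex.exp (((Complex.exp (θ * Complex.I) * w * ζ).re : ℂ) * Complex.I) - 1) := by
  set q := w * ζ with hq
  have hc := continuous_re_exp_mul q
  have hci : Continuous fun θ : ℝ => (Complex.exp (θ * Complex.I) * q).im :=
    Complex.continuous_im.comp (by fun_prop)
  have hc2 : Continuous (fun p : ℝ × ℝ => (Complex.exp (p.1 * Complex.I) * q).re) :=
    hc.comp continuous_fst
  have hci2 : Continuous (fun p : ℝ × ℝ => (Complex.exp (p.1 * Complex.I) * q).im) :=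
    hci.comp continuous_fst
  have hA : Continuous (Function.uncurry fun θ s : ℝ =>
      ((Complex.exp (θ * Complex.I) * q).re : ℂ) *
      Complex.exp (((s * (Complex.exp (θ * Complex.I) * q).re : ℝ) : ℂ) * Complex.I)) := by
    unfold Function.uncurry
    fun_prop
  have hB : Continuous (Function.uncurry fun θ s : ℝ =>
      ((Complex.exp (θ * Complex.I) * q).im : ℂ) *
      Complex.exp (((s * (Complex.exp (θ * Complex.I) * q).re : ℝ) : ℂ) * Complex.I)) := by
    unfold Function.uncurry
    fun_prop
  have hA' := intervalIntegral.continuous_parametric_intervalIntegral_of_continuous'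
    (μ := volume) hA 0 1
  have hB' := intervalIntegral.continuous_parametric_intervalIntegral_of_continuous'
    (μ := volume) hB 0 1
  have h1 : rotInt w ζ * ζ = ∫ θ in (0 : ℝ)..(2 * π),
      ((∫ s in (0 : ℝ)..1, ((Complex.exp (θ * Complex.I) * q).re : ℂ) *
      Complex.exp (((s * (Complex.exp (θ * Complex.I) * q).re : ℝ) : ℂ) * Complex.I)) +
      Complex.I * ∫ s in (0 : ℝ)..1, ((Complex.exp (θ * Complex.I) * q).im : ℂ) *
      Complex.exp (((s * (Complex.exp (θ * Complex.I) * q).re : ℝ) : ℂ) * Complex.I)) := by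
    rw [rotInt, ← intervalIntegral.integral_mul_const]
    refine intervalIntegral.integral_congr fun θ _ => ?_
    rw [← intervalIntegral.integral_mul_const, ← intervalIntegral.integral_const_mul,
      ← intervalIntegral.integral_add]
    · refine intervalIntegral.integral_congr fun s _ => ?_
      simp only [mul_assoc, ← hq]
      set Z := Complex.exp (θ * Complex.I) * q
      have : Complex.exp (θ * Complex.I) * (w * (Complex.exp (((s * Z.re : ℝ) : ℂ) * Complex.I) * ζ))
          = Z * Complex.exp (((s * Z.re : ℝ) : ℂ) * Complex.I) := by
        simp only [Z, hq]; ring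
      rw [this]
      linear_combination (-Complex.exp (((s * Z.re : ℝ) : ℂ) * Complex.I)) * Complex.re_add_im Z
    · exact Continuous.intervalIntegrable (by fun_prop) _ _
    · exact Continuous.intervalIntegrable (by fun_prop) _ _
  rw [h1, intervalIntegral.integral_add (hA'.intervalIntegrable _ _)
    ((hB'.const_mul Complex.I).intervalIntegrable _ _), intervalIntegral.integral_const_mul]
  -- The order of integration is exchanged because the cancellation in θ takes place for each fixed
  -- s > 0.
  have h2 : ∫ θ in (0 : ℝ)..(2 * π), ∫ s in (0 : ℝ)..1, ((Complex.exp (θ * Complex.I) * q).im : ℂ) *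
      Complex.exp (((s * (Complex.exp (θ * Complex.I) * q).re : ℝ) : ℂ) * Complex.I) = 0 := by
    rw [intervalIntegral_intervalIntegral_swap]
    · rw [intervalIntegral.integral_of_le zero_le_one]
      refine (setIntegral_congr_fun measurableSet_Ioc fun s hs => ?_).trans
        (by rw [integral_zero] : ∫ s in Set.Ioc (0 : ℝ) 1, (0 : ℂ) = 0)
      exact integral_im_mul_exp_re q hs.1.ne'
    · exact hB.continuousOn.integrableOn_compact (isCompact_uIcc.prod isCompact_uIcc) |>.mono_set
        (Set.prod_mono Set.uIoc_subset_uIcc Set.uIoc_subset_uIcc)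
  rw [h2, mul_zero, add_zero, ← intervalIntegral.integral_const_mul]
  refine intervalIntegral.integral_congr fun θ _ => ?_
  rw [integral_mul_exp_segment, mul_assoc (Complex.exp _) w ζ]

/-- The rotations of w average to zero; this agrees with the convention 0⁻¹ = 0 at resonances. -/
lemma rotInt_zero (w : ℂ) : rotInt w 0 = 0 := by
  have h : ∫ θ in (0 : ℝ)..(2 * π), Complex.exp (θ * Complex.I) = 0 := by
    have hd : ∀ θ ∈ Set.uIcc 0 (2 * π), HasDerivAt
        (fun θ : ℝ => -Complex.I * Complex.exp (θ * Complex.I)) (Complex.exp (θ * Complex.I)) θ := by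
      intro θ _
      have h0 : HasDerivAt (fun y : ℝ => (y : ℂ)) 1 θ := Complex.ofRealCLM.hasDerivAt
      refine ((h0.mul_const Complex.I).cexp.const_mul (-Complex.I)).congr_deriv ?_
      linear_combination (-Complex.exp (θ * Complex.I)) * Complex.I_mul_I
    rw [intervalIntegral.integral_eq_sub_of_hasDerivAt hd
      (Continuous.intervalIntegrable (by fun_prop) _ _)]
    simp [Complex.exp_two_pi_mul_I]
  simp [rotInt, h]

lemma continuous_rotInt (ζ : ℂ) : Continuous fun w => rotInt w ζ := by
  unfold rotInt
  refine intervalIntegral.continuous_parametric_intervalIntegral_of_continuous' ?_ _ _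
  have h : Continuous fun p : (ℂ × ℝ) × ℝ => (Complex.exp (p.1.2 * Complex.I) * p.1.1 * ζ).re :=
    Complex.continuous_re.comp (by fun_prop)
  refine intervalIntegral.continuous_parametric_intervalIntegral_of_continuous'
    (f := fun (p : ℂ × ℝ) (s : ℝ) => Complex.exp (p.2 * Complex.I) * p.1 *
    Complex.exp (((s * (Complex.exp (p.2 * Complex.I) * p.1 * ζ).re : ℝ) : ℂ) * Complex.I)) ?_ _ _
  unfold Function.uncurry
  fun_prop

lemma sum_mul_rotInt {ι : Type*} (A : Finset ι) (b ζ : ι → ℂ) (w : ℂ) :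
    ∑ i ∈ A, b i * rotInt w (ζ i) =
      ∫ θ in (0 : ℝ)..(2 * π), ∫ s in (0 : ℝ)..1, Complex.exp (θ * Complex.I) * w *
        ∑ i ∈ A, b i * Complex.exp
          (((s * (Complex.exp (θ * Complex.I) * w * ζ i).re : ℝ) : ℂ) * Complex.I) := by
  have hc : ∀ i, Continuous fun p : ℝ × ℝ => (Complex.exp (p.1 * Complex.I) * w * ζ i).re :=
    fun i => Complex.continuous_re.comp (by fun_prop)
  have hf : ∀ i, Continuous (Function.uncurry fun θ s : ℝ => Complex.exp (θ * Complex.I) * w *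
    (b i * Complex.exp
      (((s * (Complex.exp (θ * Complex.I) * w * ζ i).re : ℝ) : ℂ) * Complex.I))) := by
    intro i
    have := hc i
    unfold Function.uncurry
    fun_prop
  simp_rw [Finset.mul_sum]
  have h1 : ∀ θ : ℝ, ∫ s in (0 : ℝ)..1, ∑ i ∈ A, Complex.exp (θ * Complex.I) * w * (b i * Complex.exp
      (((s * (Complex.exp (θ * Complex.I) * w * ζ i).re : ℝ) : ℂ) * Complex.I))
      = ∑ i ∈ A, ∫ s in (0 : ℝ)..1, Complex.exp (θ * Complex.I) * w * (b i * Complex.exp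
      (((s * (Complex.exp (θ * Complex.I) * w * ζ i).re : ℝ) : ℂ) * Complex.I)) := by
    intro θ
    exact intervalIntegral.integral_finsetSum fun i _ =>
      Continuous.intervalIntegrable (by fun_prop) _ _
  simp_rw [h1]
  rw [intervalIntegral.integral_finsetSum fun i _ => Continuous.intervalIntegrable
    (intervalIntegral.continuous_parametric_intervalIntegral_of_continuous' (hf i) 0 1) _ _]
  refine Finset.sum_congr rfl fun i _ => ?_
  rw [rotInt, ← intervalIntegral.integral_const_mul]
  refine intervalIntegral.integral_congr fun θ _ => ?_
  rw [← intervalIntegral.integral_const_mul]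
  refine intervalIntegral.integral_congr fun s _ => ?_
  ring

/-- At fixed θ and s the sum is the exponential sum at t = s e^{iθ} w, which is why the hypothesis
is required for all complex t. The total mass is 2π‖w‖. -/
lemma norm_sum_mul_rotInt_le {ι : Type*} (A : Finset ι) (b ζ : ι → ℂ) (w : ℂ) {S : ℝ}
    (hS : ∀ t : ℂ, ‖∑ i ∈ A, b i * Complex.exp (((t * ζ i).re : ℂ) * Complex.I)‖ ≤ S) :
    ‖∑ i ∈ A, b i * rotInt w (ζ i)‖ ≤ 2 * π * (‖w‖ * S) := by
  rw [sum_mul_rotInt]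
  have h1 : ∀ θ s : ℝ, ‖Complex.exp (θ * Complex.I) * w * ∑ i ∈ A, b i * Complex.exp
      (((s * (Complex.exp (θ * Complex.I) * w * ζ i).re : ℝ) : ℂ) * Complex.I)‖ ≤ ‖w‖ * S := by
    intro θ s
    rw [norm_mul, norm_mul, Complex.norm_exp_ofReal_mul_I, one_mul]
    refine mul_le_mul_of_nonneg_left ?_ (norm_nonneg _)
    refine le_of_eq_of_le ?_ (hS (s * (Complex.exp (θ * Complex.I) * w)))
    simp_rw [mul_assoc (s : ℂ), Complex.re_ofReal_mul]
  have h2 := intervalIntegral.norm_integral_le_of_norm_le_const (a := 0) (b := 2 * π)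
    (C := ‖w‖ * S) (f := fun θ : ℝ => ∫ s in (0 : ℝ)..1, Complex.exp (θ * Complex.I) * w *
        ∑ i ∈ A, b i * Complex.exp
          (((s * (Complex.exp (θ * Complex.I) * w * ζ i).re : ℝ) : ℂ) * Complex.I))
    (fun θ _ => by
      have := intervalIntegral.norm_integral_le_of_norm_le_const (a := 0) (b := 1)
        (f := fun s : ℝ => Complex.exp (θ * Complex.I) * w *
        ∑ i ∈ A, b i * Complex.exp
          (((s * (Complex.exp (θ * Complex.I) * w * ζ i).re : ℝ) : ℂ) * Complex.I))
        (fun s _ => h1 θ s)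
      simpa using this)
  rw [sub_zero, abs_of_pos two_pi_pos] at h2
  linarith

/-- The product of two squared Fejér kernels. -/
noncomputable def fejerSqProd (v : ℝ × ℝ) : ℝ := fejer v.1 ^ 2 * fejer v.2 ^ 2

lemma fejerSqProd_nonneg (v : ℝ × ℝ) : 0 ≤ fejerSqProd v := by unfold fejerSqProd; positivity

lemma continuous_fejerSqProd : Continuous fejerSqProd := by
  have := continuous_fejer
  unfold fejerSqProd; fun_prop

lemma integrable_fejerSqProd : Integrable fejerSqProd :=
  integrable_fejer_sq.mul_prod integrable_fejer_sq

lemma integral_fejerSqProd : ∫ v, fejerSqProd v = 4 / 9 := by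
  unfold fejerSqProd
  rw [Measure.volume_eq_prod,
    integral_prod_mul (fun x => fejer x ^ 2) (fun x => fejer x ^ 2), integral_fejer_sq]
  norm_num

/-- The complex number with coordinates proportional to `v`, scaled so that the characters of
modulus at least one are annihilated by `fejerSqProd`. -/
noncomputable def scaledPoint (v : ℝ × ℝ) : ℂ := 4 * √2 * π * (v.1 - v.2 * Complex.I)

lemma continuous_scaledPoint : Continuous scaledPoint := by unfold scaledPoint; fun_prop

lemma norm_scaledPoint_sq (v : ℝ × ℝ) :
    ‖scaledPoint v‖ ^ 2 = 32 * π ^ 2 * (v.1 ^ 2 + v.2 ^ 2) := by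
  have h : scaledPoint v = ((4 * √2 * π * v.1 : ℝ) : ℂ) + ((-(4 * √2 * π * v.2) : ℝ) : ℂ) * Complex.I := by
    rw [scaledPoint]; push_cast; ring
  rw [h, ← Complex.normSq_eq_norm_sq, Complex.normSq_add_mul_I, neg_sq]
  simp only [mul_pow, Real.sq_sqrt zero_le_two]
  ring

lemma integral_fejerSqProd_mul_exp {ζ : ℂ} (hζ : 1 ≤ ‖ζ‖) :
    ∫ v, (fejerSqProd v : ℂ) * Complex.exp (((scaledPoint v * ζ).re : ℂ) * Complex.I) = 0 := by
  have h : ∀ v : ℝ × ℝ,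
      (fejerSqProd v : ℂ) * Complex.exp (((scaledPoint v * ζ).re : ℂ) * Complex.I) =
      (Complex.exp (((2 * π * v.1 * (2 * √2 * ζ.re) : ℝ) : ℂ) * Complex.I) *
        ((fejer v.1 ^ 2 : ℝ) : ℂ)) *
      (Complex.exp (((2 * π * v.2 * (2 * √2 * ζ.im) : ℝ) : ℂ) * Complex.I) *
        ((fejer v.2 ^ 2 : ℝ) : ℂ)) := by
    intro v
    have : (scaledPoint v * ζ).re
        = 2 * π * v.1 * (2 * √2 * ζ.re) + 2 * π * v.2 * (2 * √2 * ζ.im) := by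
      have h : scaledPoint v
          = ((4 * √2 * π * v.1 : ℝ) : ℂ) + ((-(4 * √2 * π * v.2) : ℝ) : ℂ) * Complex.I := by
        rw [scaledPoint]; push_cast; ring
      rw [h]
      simp only [Complex.mul_re, Complex.add_re, Complex.ofReal_re, Complex.ofReal_im,
        Complex.I_re, Complex.I_im, Complex.add_im, Complex.mul_im]
      ring
    rw [this, fejerSqProd, Complex.ofReal_add, add_mul, Complex.exp_add]
    push_cast; ring
  simp_rw [h]
  rw [Measure.volume_eq_prod, integral_prod_mul
    (fun x : ℝ => Complex.exp (((2 * π * x * (2 * √2 * ζ.re) : ℝ) : ℂ) * Complex.I) *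
        ((fejer x ^ 2 : ℝ) : ℂ))
    (fun x : ℝ => Complex.exp (((2 * π * x * (2 * √2 * ζ.im) : ℝ) : ℂ) * Complex.I) *
        ((fejer x ^ 2 : ℝ) : ℂ))]
  -- One coordinate of ζ is at least 1/√2 in modulus. The constant 4√2π of `scaledPoint` sends it
  -- outside the support, of radius 2, of the transform of the squared kernel.
  have key : 2 ≤ |2 * √2 * ζ.re| ∨ 2 ≤ |2 * √2 * ζ.im| := by
    by_contra! hh
    have h1 : ζ.re ^ 2 + ζ.im ^ 2 = ‖ζ‖ ^ 2 := by
      rw [← Complex.normSq_eq_norm_sq, Complex.normSq_apply]; ring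
    have h2 : (2 * √2 * ζ.re) ^ 2 < 2 ^ 2 := sq_lt_sq.2 (by simpa using hh.1)
    have h3 : (2 * √2 * ζ.im) ^ 2 < 2 ^ 2 := sq_lt_sq.2 (by simpa using hh.2)
    simp only [mul_pow, Real.sq_sqrt zero_le_two] at h2 h3
    nlinarith
  rcases key with h | h
  · rw [integral_fejer_sq_exp_eq_zero h, zero_mul]
  · rw [integral_fejer_sq_exp_eq_zero h, mul_zero]

/-- From (‖w‖-10)² ≥ 0: the first moment is replaced by second moments, which are computed
coordinate by coordinate. -/
lemma norm_scaledPoint_le (v : ℝ × ℝ) :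
    ‖scaledPoint v‖ ≤ (32 * π ^ 2 * (v.1 ^ 2 + v.2 ^ 2) / 10 + 10) / 2 := by
  rw [← norm_scaledPoint_sq]
  nlinarith [sq_nonneg (‖scaledPoint v‖ - 10)]

lemma integrable_fejerSqProd_bound : Integrable fun v : ℝ × ℝ =>
    fejerSqProd v * ((32 * π ^ 2 * (v.1 ^ 2 + v.2 ^ 2) / 10 + 10) / 2) := by
  have h1 := integrable_sq_mul_fejer_sq.mul_prod integrable_fejer_sq
  have h2 := integrable_fejer_sq.mul_prod integrable_sq_mul_fejer_sq
  have h3 := integrable_fejerSqProd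
  refine ((((h1.add h2).const_mul (32 * π ^ 2 / 20)).add (h3.const_mul 5))).congr
    (Filter.Eventually.of_forall fun v => ?_)
  simp only [Pi.add_apply, fejerSqProd]
  ring

/-- The quadratic part contributes at most (32π²/20)·2·(1/π²)(2/3) = 32/15 and the constant part
5·4/9 = 20/9; their sum is below 40/9. -/
lemma integral_fejerSqProd_bound : ∫ v : ℝ × ℝ,
    fejerSqProd v * ((32 * π ^ 2 * (v.1 ^ 2 + v.2 ^ 2) / 10 + 10) / 2) ≤ 40 / 9 := by
  have h1 := integrable_sq_mul_fejer_sq.mul_prod integrable_fejer_sq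
  have h2 := integrable_fejer_sq.mul_prod integrable_sq_mul_fejer_sq
  have h3 := integrable_fejerSqProd
  have e : (fun v : ℝ × ℝ =>
      fejerSqProd v * ((32 * π ^ 2 * (v.1 ^ 2 + v.2 ^ 2) / 10 + 10) / 2)) = fun v =>
      32 * π ^ 2 / 20 * ((v.1 ^ 2 * fejer v.1 ^ 2) * (fejer v.2 ^ 2)
        + (fejer v.1 ^ 2) * (v.2 ^ 2 * fejer v.2 ^ 2)) + 5 * fejerSqProd v := by
    funext v; simp only [fejerSqProd]; ring
  have h4 : Integrable fun v : ℝ × ℝ => 32 * π ^ 2 / 20 *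
      ((v.1 ^ 2 * fejer v.1 ^ 2) * (fejer v.2 ^ 2)
        + (fejer v.1 ^ 2) * (v.2 ^ 2 * fejer v.2 ^ 2)) := (h1.add h2).const_mul _
  rw [← Measure.volume_eq_prod] at h1 h2
  rw [e, integral_add h4 (h3.const_mul 5), integral_const_mul,
    integral_const_mul, integral_add h1 h2, integral_fejerSqProd, Measure.volume_eq_prod,
    integral_prod_mul (fun x => x ^ 2 * fejer x ^ 2) (fun x => fejer x ^ 2),
    integral_prod_mul (fun x => fejer x ^ 2) (fun x => x ^ 2 * fejer x ^ 2), integral_fejer_sq]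
  have := integral_sq_mul_fejer_sq_le
  rw [le_div_iff₀ (by positivity)] at this
  linarith

lemma integrable_fejerSqProd_mul_rotInt (ζ : ℂ) :
    Integrable fun v => (fejerSqProd v : ℂ) * rotInt (scaledPoint v) ζ := by
  refine (integrable_fejerSqProd_bound.const_mul (2 * π)).mono' ?_
    (Filter.Eventually.of_forall fun v => ?_)
  · have h1 := continuous_fejerSqProd
    have h2 := (continuous_rotInt ζ).comp continuous_scaledPoint
    exact ((Complex.continuous_ofReal.comp h1).mul h2).aestronglyMeasurable
  · have h := norm_sum_mul_rotInt_le {()} (fun _ => 1) (fun _ => ζ) (scaledPoint v) (S := 1)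
      (fun t => by
        rw [Finset.sum_singleton, one_mul, Complex.norm_exp_ofReal_mul_I])
    simp only [Finset.sum_singleton, one_mul, mul_one] at h
    rw [norm_mul, Complex.norm_real, norm_of_nonneg (fejerSqProd_nonneg v)]
    have := mul_le_mul_of_nonneg_left (h.trans (mul_le_mul_of_nonneg_left
      (norm_scaledPoint_le v) two_pi_pos.le)) (fejerSqProd_nonneg v)
    linarith

/-- Averaging `rotInt_mul` over the kernel annihilates the characters when ‖ζ‖ ≥ 1. Only the
constant -1 survives, and it gives -i·2π·(-4/9). -/
lemma integral_fejerSqProd_mul_rotInt {ζ : ℂ} (hζ : ζ = 0 ∨ 1 ≤ ‖ζ‖) :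
    ∫ v, (fejerSqProd v : ℂ) * rotInt (scaledPoint v) ζ = (8 * π / 9 * Complex.I) * ζ⁻¹ := by
  rcases hζ with rfl | hζ
  · simp [rotInt_zero]
  have hζ0 : ζ ≠ 0 := by rintro rfl; simp at hζ; linarith
  have hc : Continuous fun p : ℝ × ℝ × ℝ =>
      (Complex.exp (p.1 * Complex.I) * scaledPoint p.2 * ζ).re := by
    have := continuous_scaledPoint
    exact Complex.continuous_re.comp (by fun_prop)
  have hf := continuous_fejerSqProd
  have h1 : ∫ v, (fejerSqProd v : ℂ) * (rotInt (scaledPoint v) ζ * ζ) =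
      -Complex.I * ∫ v, ∫ θ in (0 : ℝ)..(2 * π), (fejerSqProd v : ℂ) * (Complex.exp
        (((Complex.exp (θ * Complex.I) * scaledPoint v * ζ).re : ℂ) * Complex.I) - 1) := by
    rw [← integral_const_mul]
    refine integral_congr_ae (Filter.Eventually.of_forall fun v => ?_)
    simp only
    rw [rotInt_mul, intervalIntegral.integral_const_mul]
    ring
  have h2 : ∫ v, ∫ θ in (0 : ℝ)..(2 * π), (fejerSqProd v : ℂ) * (Complex.exp
        (((Complex.exp (θ * Complex.I) * scaledPoint v * ζ).re : ℂ) * Complex.I) - 1)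
      = ∫ θ in (0 : ℝ)..(2 * π), ∫ v, (fejerSqProd v : ℂ) * (Complex.exp
        (((Complex.exp (θ * Complex.I) * scaledPoint v * ζ).re : ℂ) * Complex.I) - 1) := by
    refine (intervalIntegral_integral_swap ?_).symm
    have : IsFiniteMeasure (volume.restrict (Set.uIoc 0 (2 * π))) := by
      rw [Set.uIoc_of_le two_pi_pos.le]; infer_instance
    have hg : Integrable (fun p : ℝ × ℝ × ℝ => (2 : ℝ) * fejerSqProd p.2)
        ((volume.restrict (Set.uIoc 0 (2 * π))).prod volume) :=
      (integrable_const (2 : ℝ)).mul_prod integrable_fejerSqProd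
    refine hg.mono' ?_ (Filter.Eventually.of_forall fun p => ?_)
    · refine Continuous.aestronglyMeasurable ?_
      unfold Function.uncurry
      fun_prop
    · rw [Function.uncurry, norm_mul, Complex.norm_real, norm_of_nonneg (fejerSqProd_nonneg _),
        mul_comm]
      refine mul_le_mul_of_nonneg_right ?_ (fejerSqProd_nonneg _)
      refine (norm_sub_le _ _).trans ?_
      rw [Complex.norm_exp_ofReal_mul_I, norm_one]
      norm_num
  have h3 : ∀ θ : ℝ, ∫ v, (fejerSqProd v : ℂ) * (Complex.exp
        (((Complex.exp (θ * Complex.I) * scaledPoint v * ζ).re : ℂ) * Complex.I) - 1)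
      = -(4 / 9 : ℂ) := by
    intro θ
    have hi : Integrable fun v => (fejerSqProd v : ℂ) * Complex.exp
        (((scaledPoint v * (Complex.exp (θ * Complex.I) * ζ)).re : ℂ) * Complex.I) := by
      have hc' : Continuous fun v => (scaledPoint v * (Complex.exp (θ * Complex.I) * ζ)).re := by
        have := continuous_scaledPoint
        exact Complex.continuous_re.comp (by fun_prop)
      refine integrable_fejerSqProd.mono' (Continuous.aestronglyMeasurable (by fun_prop))
        (Filter.Eventually.of_forall fun v => ?_)
      rw [norm_mul, Complex.norm_real, norm_of_nonneg (fejerSqProd_nonneg _),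
        Complex.norm_exp_ofReal_mul_I, mul_one]
    have e : ∀ v, (fejerSqProd v : ℂ) * (Complex.exp
        (((Complex.exp (θ * Complex.I) * scaledPoint v * ζ).re : ℂ) * Complex.I) - 1)
        = (fejerSqProd v : ℂ) * Complex.exp
        (((scaledPoint v * (Complex.exp (θ * Complex.I) * ζ)).re : ℂ) * Complex.I)
        - (fejerSqProd v : ℂ) := by
      intro v
      rw [mul_sub, mul_one, mul_left_comm (scaledPoint v), mul_assoc]
    have h_int : Integrable fun v => (fejerSqProd v : ℂ) := integrable_fejerSqProd.ofReal
    simp_rw [e]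
    rw [integral_sub hi h_int, integral_fejerSqProd_mul_exp,
      integral_complex_ofReal, integral_fejerSqProd]
    · push_cast; ring
    · rw [norm_mul, Complex.norm_exp_ofReal_mul_I, one_mul]; exact hζ
  have h4 : (∫ v, (fejerSqProd v : ℂ) * rotInt (scaledPoint v) ζ) * ζ = 8 * π / 9 * Complex.I := by
    rw [← integral_mul_const]
    simp_rw [mul_assoc]
    rw [h1, h2]
    simp_rw [h3]
    rw [intervalIntegral.integral_const, sub_zero]
    simp only [Complex.real_smul]
    push_cast
    ring
  rw [← h4, mul_assoc, mul_inv_cancel₀ hζ0, mul_one]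

/-- Division by numbers of modulus at least one is bounded, with a universal constant, with respect
to the uniform norm of exponential sums. -/
theorem norm_sum_mul_inv_le {ι : Type*} (A : Finset ι) (b ζ : ι → ℂ)
    (hζ : ∀ i ∈ A, ζ i = 0 ∨ 1 ≤ ‖ζ i‖) {S : ℝ}
    (hS : ∀ t : ℂ, ‖∑ i ∈ A, b i * Complex.exp (((t * ζ i).re : ℂ) * Complex.I)‖ ≤ S) :
    ‖∑ i ∈ A, b i * (ζ i)⁻¹‖ ≤ 10 * S := by
  have hS0 : 0 ≤ S := (norm_nonneg _).trans (hS 0)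
  have h1 : (8 * π / 9 * Complex.I) * ∑ i ∈ A, b i * (ζ i)⁻¹
      = ∫ v, (fejerSqProd v : ℂ) * ∑ i ∈ A, b i * rotInt (scaledPoint v) (ζ i) := by
    have : ∀ v, (fejerSqProd v : ℂ) * ∑ i ∈ A, b i * rotInt (scaledPoint v) (ζ i)
        = ∑ i ∈ A, b i * ((fejerSqProd v : ℂ) * rotInt (scaledPoint v) (ζ i)) := by
      intro v
      rw [Finset.mul_sum]
      exact Finset.sum_congr rfl fun i _ => by ring
    simp_rw [this]
    rw [integral_finsetSum _ fun i _ => (integrable_fejerSqProd_mul_rotInt (ζ i)).const_mul (b i),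
      Finset.mul_sum]
    refine Finset.sum_congr rfl fun i hi => ?_
    rw [integral_const_mul, integral_fejerSqProd_mul_rotInt (hζ i hi)]
    ring
  have h2 : ‖∫ v, (fejerSqProd v : ℂ) * ∑ i ∈ A, b i * rotInt (scaledPoint v) (ζ i)‖
      ≤ 2 * π * S * (40 / 9) := by
    refine (norm_integral_le_of_norm_le (integrable_fejerSqProd_bound.const_mul (2 * π * S))
      (Filter.Eventually.of_forall fun v => ?_)).trans ?_
    · rw [norm_mul, Complex.norm_real, norm_of_nonneg (fejerSqProd_nonneg v)]
      have h3 := norm_sum_mul_rotInt_le A b ζ (scaledPoint v) hS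
      have h4 := mul_le_mul_of_nonneg_right (norm_scaledPoint_le v)
        (mul_nonneg two_pi_pos.le hS0)
      have := mul_le_mul_of_nonneg_left (h3.trans (by linarith : _ ≤ 2 * π * S *
        ((32 * π ^ 2 * (v.1 ^ 2 + v.2 ^ 2) / 10 + 10) / 2))) (fejerSqProd_nonneg v)
      linarith
    · rw [integral_const_mul]
      exact mul_le_mul_of_nonneg_left integral_fejerSqProd_bound (by positivity)
  rw [← h1, norm_mul] at h2
  have h3 : ‖(8 * π / 9 * Complex.I : ℂ)‖ = 8 * π / 9 := by
    have : (8 * π / 9 * Complex.I : ℂ) = ((8 * π / 9 : ℝ) : ℂ) * Complex.I := by push_cast; ring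
    rw [this, norm_mul, Complex.norm_I, mul_one, Complex.norm_real,
      norm_of_nonneg (by positivity)]
  rw [h3] at h2
  -- The constant 10 is the quotient of 2π·40/9 by 8π/9.
  have h4 : 8 * π / 9 * ‖∑ i ∈ A, b i * (ζ i)⁻¹‖ ≤ 8 * π / 9 * (10 * S) := by linarith
  exact le_of_mul_le_mul_left h4 (by positivity)

end Multiplier

/-! ### Derivatives, projections and brackets as linear and bilinear maps. -/

variable {n₁ n₂ : ℕ}

/-- The linear operator sending the monomial of index `a` to `T a`. -/
def monomialMap (T : Idx n₁ n₂ → TrigPoly n₁ n₂) : TrigPoly n₁ n₂ →ₗ[ℂ] TrigPoly n₁ n₂ where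
  toFun g := g.coeff.sum fun a c => c • T a
  map_add' f g := by
    rw [AddMonoidAlgebra.coeff_add]
    exact Finsupp.sum_add_index' (fun _ => zero_smul _ _) fun _ _ _ => add_smul _ _ _
  map_smul' c g := by
    rw [AddMonoidAlgebra.coeff_smul, Finsupp.sum_smul_index (h := fun a c => c • T a)
      fun _ => zero_smul ℂ _, RingHom.id_apply, Finsupp.smul_sum]
    simp only [mul_smul]

lemma sum_eq_monomialMap {T : Idx n₁ n₂ → TrigPoly n₁ n₂} {F : Idx n₁ n₂ → ℂ → TrigPoly n₁ n₂}
    (h : ∀ a c, F a c = c • T a) (g : TrigPoly n₁ n₂) : g.coeff.sum F = monomialMap T g := by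
  have : F = fun a c => c • T a := funext fun a => funext fun c => h a c
  rw [this]; rfl

lemma monomialMap_single (T : Idx n₁ n₂ → TrigPoly n₁ n₂) (a : Idx n₁ n₂) (c : ℂ) :
    monomialMap T (AddMonoidAlgebra.single a c) = c • T a := by
  change (Finsupp.single a c).sum (fun a c => c • T a) = _
  exact Finsupp.sum_single_index (zero_smul ℂ (T a))

lemma linearMap_ext_single {f g : TrigPoly n₁ n₂ →ₗ[ℂ] TrigPoly n₁ n₂}
    (h : ∀ a, f (AddMonoidAlgebra.single a 1) = g (AddMonoidAlgebra.single a 1)) : f = g := by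
  refine LinearMap.ext fun x => ?_
  induction x using AddMonoidAlgebra.induction_linear with
  | zero => simp
  | add x y hx hy => simp [hx, hy]
  | single a c =>
    have : AddMonoidAlgebra.single a c = c • (AddMonoidAlgebra.single a 1 : TrigPoly n₁ n₂) := by
      simp
    rw [this, map_smul, map_smul, h]

lemma dP_eq (j : Fin n₁) (g : TrigPoly n₁ n₂) : dP j g = monomialMap (fun a =>
    AddMonoidAlgebra.single (a.m - Pi.single j 1, a.l, a.lbar, a.k) (a.m j : ℂ)) g := by
  refine sum_eq_monomialMap (fun a c => ?_) g
  simp [mul_comm]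

lemma dQ_eq (j : Fin n₁) (g : TrigPoly n₁ n₂) : dQ j g = monomialMap (fun a =>
    AddMonoidAlgebra.single a (Complex.I * (a.k j : ℂ))) g := by
  refine sum_eq_monomialMap (fun a c => ?_) g
  simp [mul_comm]

lemma dZ_eq (j : Fin n₂) (g : TrigPoly n₁ n₂) : dZ j g = monomialMap (fun a =>
    AddMonoidAlgebra.single (a.m, a.l - Pi.single j 1, a.lbar, a.k) (a.l j : ℂ)) g := by
  refine sum_eq_monomialMap (fun a c => ?_) g
  simp [mul_comm]

lemma dW_eq (j : Fin n₂) (g : TrigPoly n₁ n₂) : dW j g = monomialMap (fun a =>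
    AddMonoidAlgebra.single (a.m, a.l, a.lbar - Pi.single j 1, a.k) (a.lbar j : ℂ)) g := by
  refine sum_eq_monomialMap (fun a c => ?_) g
  simp [mul_comm]

/-- The diagonal operator multiplying the coefficient of index `a` by `c a`. -/
def diag (c : Idx n₁ n₂ → ℂ) : TrigPoly n₁ n₂ →ₗ[ℂ] TrigPoly n₁ n₂ :=
  monomialMap fun a => AddMonoidAlgebra.single a (c a)

lemma coeff_diag (c : Idx n₁ n₂ → ℂ) (g : TrigPoly n₁ n₂) (a : Idx n₁ n₂) :
    (diag c g).coeff a = c a * g.coeff a := by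
  induction g using AddMonoidAlgebra.induction_linear with
  | zero => simp
  | add x y hx hy => simp [hx, hy, mul_add]
  | single b d =>
    rw [diag, monomialMap_single]
    by_cases h : b = a
    · subst h; simp [mul_comm]
    · simp [h]

lemma average_eq (g : TrigPoly n₁ n₂) : average g = diag (fun a => if a.k = 0 then 1 else 0) g := by
  refine sum_eq_monomialMap (fun a c => ?_) g
  split_ifs with h <;> simp [h]

/-- The projection on the monomials with `k = 0` and equal exponents of `z` and `w`. -/
def resonantPart : TrigPoly n₁ n₂ →ₗ[ℂ] TrigPoly n₁ n₂ :=
  diag fun a => if a.k = 0 ∧ a.l = a.lbar then 1 else 0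

/-- The small divisor of the monomial of index `a`. -/
def Idx.divisor (ω : Fin n₁ → ℂ) (Ω : Fin n₂ → ℂ) (a : Idx n₁ n₂) : ℂ :=
  EllipticTori.divisor ω Ω a.k fun j => (a.l j : ℤ) - (a.lbar j : ℤ)

lemma Idx.divisor_eq_zero (ω : Fin n₁ → ℂ) (Ω : Fin n₂ → ℂ) (a : Idx n₁ n₂)
    (h : a.k = 0 ∧ a.l = a.lbar) : a.divisor ω Ω = 0 := by
  simp [Idx.divisor, EllipticTori.divisor, h.1, h.2]

/-- No case distinction is needed: resonant monomials have divisor 0, and 0⁻¹ = 0. -/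
lemma solveHomological_eq (ω : Fin n₁ → ℂ) (Ω : Fin n₂ → ℂ) (g : TrigPoly n₁ n₂) :
    solveHomological ω Ω g = diag (fun a => Complex.I * (a.divisor ω Ω)⁻¹) g := by
  refine sum_eq_monomialMap (fun a c => ?_) g
  split_ifs with h
  · simp [Idx.divisor_eq_zero ω Ω a h]
  · simp only [AddMonoidAlgebra.smul_single, smul_eq_mul]
    congr 1
    rw [← Idx.divisor, div_eq_mul_inv, mul_inv, Complex.inv_I]
    ring

/-- The product of the images under two linear operators, as a bilinear map. -/
def mulBilin (S T : TrigPoly n₁ n₂ →ₗ[ℂ] TrigPoly n₁ n₂) :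
    TrigPoly n₁ n₂ →ₗ[ℂ] TrigPoly n₁ n₂ →ₗ[ℂ] TrigPoly n₁ n₂ :=
  (LinearMap.mul ℂ (TrigPoly n₁ n₂)).compl₁₂ S T

/-- `∂/∂p_j` as a linear map. -/
def dPLin (j : Fin n₁) : TrigPoly n₁ n₂ →ₗ[ℂ] TrigPoly n₁ n₂ := monomialMap fun a =>
  AddMonoidAlgebra.single (a.m - Pi.single j 1, a.l, a.lbar, a.k) (a.m j : ℂ)

/-- `∂/∂q_j` as a linear map. -/
def dQLin (j : Fin n₁) : TrigPoly n₁ n₂ →ₗ[ℂ] TrigPoly n₁ n₂ := monomialMap fun a =>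
  AddMonoidAlgebra.single a (Complex.I * (a.k j : ℂ))

/-- `∂/∂z_j` as a linear map. -/
def dZLin (j : Fin n₂) : TrigPoly n₁ n₂ →ₗ[ℂ] TrigPoly n₁ n₂ := monomialMap fun a =>
  AddMonoidAlgebra.single (a.m, a.l - Pi.single j 1, a.lbar, a.k) (a.l j : ℂ)

/-- `∂/∂w_j` as a linear map. -/
def dWLin (j : Fin n₂) : TrigPoly n₁ n₂ →ₗ[ℂ] TrigPoly n₁ n₂ := monomialMap fun a =>
  AddMonoidAlgebra.single (a.m, a.l, a.lbar - Pi.single j 1, a.k) (a.lbar j : ℂ)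

/-- The Lie derivative as a bilinear map. -/
def lieBilin : TrigPoly n₁ n₂ →ₗ[ℂ] TrigPoly n₁ n₂ →ₗ[ℂ] TrigPoly n₁ n₂ :=
  ∑ j, (mulBilin (dQLin j) (dPLin j) - mulBilin (dPLin j) (dQLin j)) +
    ∑ j, (mulBilin (dWLin j) (dZLin j) - mulBilin (dZLin j) (dWLin j))

lemma lieBilin_apply (χ g : TrigPoly n₁ n₂) : lieBilin χ g = lie χ g := by
  simp only [lieBilin, lie, LinearMap.add_apply, LinearMap.sum_apply, LinearMap.sub_apply, dP_eq,
    dQ_eq, dZ_eq, dW_eq, mulBilin, LinearMap.compl₁₂_apply, LinearMap.mul_apply', dPLin, dQLin,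
    dZLin, dWLin]

lemma lieBilin_eq (χ : TrigPoly n₁ n₂) : ⇑(lieBilin χ) = lie χ := funext (lieBilin_apply χ)

lemma lie_zero_right (χ : TrigPoly n₁ n₂) : lie χ 0 = 0 := by
  rw [← lieBilin_apply, map_zero]

lemma lie_add_right (χ f g : TrigPoly n₁ n₂) : lie χ (f + g) = lie χ f + lie χ g := by
  simp only [← lieBilin_apply, map_add]

lemma lie_iterate_zero (χ : TrigPoly n₁ n₂) (j : ℕ) : (lie χ)^[j] 0 = 0 :=
  Function.iterate_fixed (lie_zero_right χ) j

lemma lie_iterate_eq (χ : TrigPoly n₁ n₂) (j : ℕ) (g : TrigPoly n₁ n₂) :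
    (lie χ)^[j] g = (lieBilin χ ^ j) g := by
  rw [Module.End.coe_pow, lieBilin_eq]

lemma lie_iterate_add (χ f g : TrigPoly n₁ n₂) (j : ℕ) :
    (lie χ)^[j] (f + g) = (lie χ)^[j] f + (lie χ)^[j] g := by
  simp only [lie_iterate_eq, map_add]

lemma lie_iterate_sub (χ f g : TrigPoly n₁ n₂) (j : ℕ) :
    (lie χ)^[j] (f - g) = (lie χ)^[j] f - (lie χ)^[j] g := by
  simp only [lie_iterate_eq, map_sub]

/-! ### Classes of functions -/

/-- The degree of a monomial. -/
def Idx.deg (a : Idx n₁ n₂) : ℤ := 2 * ∑ j, (a.m j : ℤ) + ∑ j, (a.l j : ℤ) + ∑ j, (a.lbar j : ℤ)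

/-- The space of the functions of degree `d` with harmonics bounded by `N`, for integer `d`. -/
def degreeClass (d N : ℤ) : Submodule ℂ (TrigPoly n₁ n₂) where
  carrier := {g | ∀ a, g.coeff a ≠ 0 → a.deg = d ∧ l1 a.k ≤ N}
  zero_mem' := by simp
  add_mem' := by
    intro f g hf hg a ha
    by_cases h : f.coeff a = 0
    · refine hg a fun h' => ha ?_
      simp [h, h']
    · exact hf a h
  smul_mem' := by
    intro c f hf a ha
    refine hf a fun h => ha ?_
    simp [h]

lemma mem_degreeClass {d N : ℤ} {g : TrigPoly n₁ n₂} :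
    g ∈ degreeClass d N ↔ ∀ a, g.coeff a ≠ 0 → a.deg = d ∧ l1 a.k ≤ N := Iff.rfl

/-- Integer degrees allow derivatives to lower the degree without truncation; a class of negative
degree contains only 0. -/
lemma inClass_iff {d N : ℕ} {g : TrigPoly n₁ n₂} : InClass d N g ↔ g ∈ degreeClass (d : ℤ) (N : ℤ) := by
  rw [mem_degreeClass]
  refine forall_congr' fun a => imp_congr_right fun _ => ?_
  rw [Idx.deg, ← Nat.cast_inj (R := ℤ)]
  push_cast
  rfl

lemma single_mem_degreeClass {d N : ℤ} {a : Idx n₁ n₂} (h : a.deg = d ∧ l1 a.k ≤ N) (c : ℂ) :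
    AddMonoidAlgebra.single a c ∈ degreeClass d N := by
  intro b hb
  by_cases hab : a = b
  · exact hab ▸ h
  · simp [hab] at hb

lemma eq_sum_single (g : TrigPoly n₁ n₂) :
    g = ∑ a ∈ g.coeff.support, AddMonoidAlgebra.single a (g.coeff a) :=
  (AddMonoidAlgebra.sum_coeff_single g).symm

lemma monomialMap_mem {T : Idx n₁ n₂ → TrigPoly n₁ n₂} {d N d' N' : ℤ}
    (hT : ∀ a : Idx n₁ n₂, a.deg = d → l1 a.k ≤ N → T a ∈ degreeClass d' N')
    {g : TrigPoly n₁ n₂} (hg : g ∈ degreeClass d N) : monomialMap T g ∈ degreeClass d' N' := by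
  change ∑ a ∈ g.coeff.support, g.coeff a • T a ∈ _
  refine Submodule.sum_mem _ fun a ha => Submodule.smul_mem _ _ ?_
  have := hg a (Finsupp.mem_support_iff.1 ha)
  exact hT a this.1 this.2

lemma diag_mem (c : Idx n₁ n₂ → ℂ) {d N : ℤ} {g : TrigPoly n₁ n₂} (hg : g ∈ degreeClass d N) :
    diag c g ∈ degreeClass d N :=
  monomialMap_mem (fun _ h h' => single_mem_degreeClass ⟨h, h'⟩ _) hg

lemma l1_add_le {n : ℕ} (k k' : Fin n → ℤ) : l1 (k + k') ≤ l1 k + l1 k' := by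
  rw [l1, l1, l1, ← Finset.sum_add_distrib]
  exact Finset.sum_le_sum fun j _ => abs_add_le _ _

lemma l1_nonneg {n : ℕ} (k : Fin n → ℤ) : 0 ≤ l1 k := Finset.sum_nonneg fun _ _ => abs_nonneg _

lemma Idx.deg_add (a b : Idx n₁ n₂) : (a + b).deg = a.deg + b.deg := by
  simp only [Idx.deg, Idx.m, Idx.l, Idx.lbar, Prod.fst_add, Prod.snd_add, Pi.add_apply,
    Nat.cast_add, Finset.sum_add_distrib]
  ring

lemma mul_mem_degreeClass {d N d' N' : ℤ} {f g : TrigPoly n₁ n₂} (hf : f ∈ degreeClass d N)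
    (hg : g ∈ degreeClass d' N') : f * g ∈ degreeClass (d + d') (N + N') := by
  rw [eq_sum_single f, eq_sum_single g, Finset.sum_mul_sum]
  refine Submodule.sum_mem _ fun a ha => Submodule.sum_mem _ fun b hb => ?_
  rw [AddMonoidAlgebra.single_mul_single]
  have h1 := hf a (Finsupp.mem_support_iff.1 ha)
  have h2 := hg b (Finsupp.mem_support_iff.1 hb)
  refine single_mem_degreeClass ⟨by rw [Idx.deg_add, h1.1, h2.1], ?_⟩ _
  exact (l1_add_le a.k b.k).trans (add_le_add h1.2 h2.2)

lemma sum_sub_single {n : ℕ} (v : Fin n → ℕ) (j : Fin n) (h : v j ≠ 0) :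
    ∑ i, (((v - Pi.single j 1 : Fin n → ℕ) i : ℕ) : ℤ) = ∑ i, (v i : ℤ) - 1 := by
  have : ∀ i, (((v - Pi.single j 1 : Fin n → ℕ) i : ℕ) : ℤ) = v i - if i = j then 1 else 0 := by
    intro i
    rcases eq_or_ne i j with rfl | hij
    · simp; omega
    · simp [hij]
  simp_rw [this]
  simp [Finset.sum_sub_distrib]

lemma dP_mem (j : Fin n₁) {d N : ℤ} {g : TrigPoly n₁ n₂} (hg : g ∈ degreeClass d N) :
    dP j g ∈ degreeClass (d - 2) N := by
  rw [dP_eq]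
  refine monomialMap_mem (fun a h h' => ?_) hg
  -- When the exponent vanishes, the truncated subtraction gives a wrong index, but the coefficient
  -- is 0.
  by_cases ha : a.m j = 0
  · simp [ha]
  · refine single_mem_degreeClass ⟨?_, by exact h'⟩ _
    rw [← h, Idx.deg, Idx.deg, sum_sub_single _ _ ha]
    ring

lemma dQ_mem (j : Fin n₁) {d N : ℤ} {g : TrigPoly n₁ n₂} (hg : g ∈ degreeClass d N) :
    dQ j g ∈ degreeClass d N := by
  rw [dQ_eq]
  exact diag_mem _ hg

lemma dZ_mem (j : Fin n₂) {d N : ℤ} {g : TrigPoly n₁ n₂} (hg : g ∈ degreeClass d N) :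
    dZ j g ∈ degreeClass (d - 1) N := by
  rw [dZ_eq]
  refine monomialMap_mem (fun a h h' => ?_) hg
  by_cases ha : a.l j = 0
  · simp [ha]
  · refine single_mem_degreeClass ⟨?_, by exact h'⟩ _
    rw [← h, Idx.deg, Idx.deg, sum_sub_single _ _ ha]
    ring

lemma dW_mem (j : Fin n₂) {d N : ℤ} {g : TrigPoly n₁ n₂} (hg : g ∈ degreeClass d N) :
    dW j g ∈ degreeClass (d - 1) N := by
  rw [dW_eq]
  refine monomialMap_mem (fun a h h' => ?_) hg
  by_cases ha : a.lbar j = 0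
  · simp [ha]
  · refine single_mem_degreeClass ⟨?_, by exact h'⟩ _
    rw [← h, Idx.deg, Idx.deg, sum_sub_single _ _ ha]
    ring

/-- Each pair of conjugate variables has total degree 2: p counts 2 and q counts 0, while z and w
count 1 each. Every product in the bracket therefore loses 2. -/
lemma lie_mem {d N d' N' e : ℤ} {χ g : TrigPoly n₁ n₂} (hχ : χ ∈ degreeClass d N)
    (hg : g ∈ degreeClass d' N') (he : e = d + d' - 2) : lie χ g ∈ degreeClass e (N + N') := by
  subst he
  refine Submodule.add_mem _ (Submodule.sum_mem _ fun j _ => Submodule.sub_mem _ ?_ ?_)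
    (Submodule.sum_mem _ fun j _ => Submodule.sub_mem _ ?_ ?_)
  · exact (by ring : d + (d' - 2) = d + d' - 2) ▸ mul_mem_degreeClass (dQ_mem j hχ) (dP_mem j hg)
  · exact (by ring : d - 2 + d' = d + d' - 2) ▸ mul_mem_degreeClass (dP_mem j hχ) (dQ_mem j hg)
  · exact (by ring : d - 1 + (d' - 1) = d + d' - 2) ▸
      mul_mem_degreeClass (dW_mem j hχ) (dZ_mem j hg)
  · exact (by ring : d - 1 + (d' - 1) = d + d' - 2) ▸
      mul_mem_degreeClass (dZ_mem j hχ) (dW_mem j hg)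

lemma lie_iterate_mem {d N d' N' : ℤ} {χ g : TrigPoly n₁ n₂} (hχ : χ ∈ degreeClass d N)
    (hg : g ∈ degreeClass d' N') (j : ℕ) :
    (lie χ)^[j] g ∈ degreeClass (d' + j * (d - 2)) (N' + j * N) := by
  induction j with
  | zero => simpa using hg
  | succ j ih =>
    rw [Function.iterate_succ_apply']
    have := lie_mem hχ ih rfl
    convert this using 2 <;> push_cast <;> ring

/-! ### The homological operator -/

lemma dP_single (j : Fin n₁) (a : Idx n₁ n₂) (c : ℂ) : dP j (AddMonoidAlgebra.single a c) =
    AddMonoidAlgebra.single (a.m - Pi.single j 1, a.l, a.lbar, a.k) (c * (a.m j : ℂ)) := by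
  rw [dP_eq, monomialMap_single]; simp

lemma dQ_single (j : Fin n₁) (a : Idx n₁ n₂) (c : ℂ) : dQ j (AddMonoidAlgebra.single a c) =
    AddMonoidAlgebra.single a (c * (Complex.I * (a.k j : ℂ))) := by
  rw [dQ_eq, monomialMap_single]; simp

lemma dZ_single (j : Fin n₂) (a : Idx n₁ n₂) (c : ℂ) : dZ j (AddMonoidAlgebra.single a c) =
    AddMonoidAlgebra.single (a.m, a.l - Pi.single j 1, a.lbar, a.k) (c * (a.l j : ℂ)) := by
  rw [dZ_eq, monomialMap_single]; simp

lemma dW_single (j : Fin n₂) (a : Idx n₁ n₂) (c : ℂ) : dW j (AddMonoidAlgebra.single a c) =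
    AddMonoidAlgebra.single (a.m, a.l, a.lbar - Pi.single j 1, a.k) (c * (a.lbar j : ℂ)) := by
  rw [dW_eq, monomialMap_single]; simp

lemma single_sub_add_single (a : Idx n₁ n₂) (v : Idx n₁ n₂) (c x : ℂ) :
    (AddMonoidAlgebra.single a c * AddMonoidAlgebra.single v x : TrigPoly n₁ n₂) =
      AddMonoidAlgebra.single (a + v) (c * x) := AddMonoidAlgebra.single_mul_single ..

lemma dP_actionPart (i : Fin n₁) (ω : Fin n₁ → ℂ) :
    dP i (actionPart ω : TrigPoly n₁ n₂) = AddMonoidAlgebra.single 0 (ω i) := by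
  rw [actionPart, dP_eq, map_sum]
  simp_rw [← dP_eq, dP_single]
  rw [Finset.sum_eq_single i]
  · simp only [Idx.m, Idx.l, Idx.lbar, Idx.k, Pi.single_eq_same, Nat.cast_one, mul_one, tsub_self]
    rfl
  · intro j _ hj
    simp [Idx.m, Idx.l, Idx.lbar, hj.symm]
  · simp

lemma dQ_actionPart (i : Fin n₁) (ω : Fin n₁ → ℂ) : dQ i (actionPart ω : TrigPoly n₁ n₂) = 0 := by
  rw [actionPart, dQ_eq, map_sum]
  simp_rw [← dQ_eq, dQ_single]
  simp [Idx.k]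

lemma dZ_actionPart (i : Fin n₂) (ω : Fin n₁ → ℂ) : dZ i (actionPart ω : TrigPoly n₁ n₂) = 0 := by
  rw [actionPart, dZ_eq, map_sum]
  simp_rw [← dZ_eq, dZ_single]
  simp [Idx.l]

lemma dW_actionPart (i : Fin n₂) (ω : Fin n₁ → ℂ) : dW i (actionPart ω : TrigPoly n₁ n₂) = 0 := by
  rw [actionPart, dW_eq, map_sum]
  simp_rw [← dW_eq, dW_single]
  simp [Idx.lbar]

lemma lie_actionPart (χ : TrigPoly n₁ n₂) (ω : Fin n₁ → ℂ) :
    lie χ (actionPart ω) = diag (fun a => Complex.I * ∑ j, (a.k j : ℂ) * ω j) χ := by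
  have : lieBilin.flip (actionPart ω : TrigPoly n₁ n₂) =
      diag (fun a => Complex.I * ∑ j, (a.k j : ℂ) * ω j) := by
    refine linearMap_ext_single fun a => ?_
    rw [LinearMap.flip_apply, lieBilin_apply, lie]
    simp only [dP_actionPart, dQ_actionPart, dZ_actionPart, dW_actionPart, dQ_single, mul_zero,
      sub_zero, Finset.sum_const_zero, add_zero, single_sub_add_single, diag, monomialMap_single,
      one_mul, one_smul]
    ext b
    simp only [AddMonoidAlgebra.coeff_sum, AddMonoidAlgebra.coeff_single, Finsupp.coe_finsetSum,
      Finset.sum_apply, Finsupp.single_apply]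
    split_ifs
    · rw [Finset.mul_sum]; exact Finset.sum_congr rfl fun j _ => by ring
    · simp
  rw [← this, LinearMap.flip_apply, lieBilin_apply]

/-- The part `∑ Ω_j z_j z̄_j` of the normal form. -/
def oscillatorPart (Ω : Fin n₂ → ℂ) : TrigPoly n₁ n₂ :=
  ∑ j, AddMonoidAlgebra.single (0, Pi.single j 1, Pi.single j 1, 0) (-Complex.I * Ω j)

lemma dP_oscillatorPart (i : Fin n₁) (Ω : Fin n₂ → ℂ) :
    dP i (oscillatorPart Ω : TrigPoly n₁ n₂) = 0 := by
  rw [oscillatorPart, dP_eq, map_sum]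
  simp_rw [← dP_eq, dP_single]
  simp [Idx.m]

lemma dQ_oscillatorPart (i : Fin n₁) (Ω : Fin n₂ → ℂ) :
    dQ i (oscillatorPart Ω : TrigPoly n₁ n₂) = 0 := by
  rw [oscillatorPart, dQ_eq, map_sum]
  simp_rw [← dQ_eq, dQ_single]
  simp [Idx.k]

lemma dZ_oscillatorPart (i : Fin n₂) (Ω : Fin n₂ → ℂ) :
    dZ i (oscillatorPart Ω : TrigPoly n₁ n₂) =
      AddMonoidAlgebra.single (0, 0, Pi.single i 1, 0) (-Complex.I * Ω i) := by
  rw [oscillatorPart, dZ_eq, map_sum]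
  simp_rw [← dZ_eq, dZ_single]
  rw [Finset.sum_eq_single i]
  · simp [Idx.l, Idx.lbar]
  · intro j _ hj
    simp [Idx.m, Idx.l, Idx.lbar, hj.symm]
  · simp

lemma dW_oscillatorPart (i : Fin n₂) (Ω : Fin n₂ → ℂ) :
    dW i (oscillatorPart Ω : TrigPoly n₁ n₂) =
      AddMonoidAlgebra.single (0, Pi.single i 1, 0, 0) (-Complex.I * Ω i) := by
  rw [oscillatorPart, dW_eq, map_sum]
  simp_rw [← dW_eq, dW_single]
  rw [Finset.sum_eq_single i]
  · simp [Idx.l, Idx.lbar]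
  · intro j _ hj
    simp [Idx.m, Idx.l, Idx.lbar, hj.symm]
  · simp

lemma sub_single_add_single {n : ℕ} (v : Fin n → ℕ) (j : Fin n) (h : v j ≠ 0) :
    v - Pi.single j 1 + Pi.single j 1 = v := by
  ext i
  rcases eq_or_ne i j with rfl | hij
  · simp; omega
  · simp [hij]

lemma lie_oscillatorPart (χ : TrigPoly n₁ n₂) (Ω : Fin n₂ → ℂ) :
    lie χ (oscillatorPart Ω) =
      diag (fun a => Complex.I * ∑ j, ((a.l j : ℂ) - a.lbar j) * Ω j) χ := by
  have : lieBilin.flip (oscillatorPart Ω : TrigPoly n₁ n₂) =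
      diag (fun a => Complex.I * ∑ j, ((a.l j : ℂ) - a.lbar j) * Ω j) := by
    refine linearMap_ext_single fun a => ?_
    rw [LinearMap.flip_apply, lieBilin_apply, lie]
    simp only [dP_oscillatorPart, dQ_oscillatorPart, dZ_oscillatorPart, dW_oscillatorPart,
      dZ_single, dW_single, mul_zero, sub_zero, Finset.sum_const_zero, zero_add,
      single_sub_add_single, diag, monomialMap_single, one_mul, one_smul]
    have h1 : ∀ j, (AddMonoidAlgebra.single ((a.m, a.l, a.lbar - Pi.single j 1, a.k) +
        (0, 0, Pi.single j 1, 0)) ((a.lbar j : ℂ) * (-Complex.I * Ω j)) : TrigPoly n₁ n₂) =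
        AddMonoidAlgebra.single a ((a.lbar j : ℂ) * (-Complex.I * Ω j)) := by
      intro j
      by_cases h : a.lbar j = 0
      · simp [h]
      · congr 1
        simp only [Prod.mk_add_mk, add_zero, sub_single_add_single _ _ h]
    have h2 : ∀ j, (AddMonoidAlgebra.single ((a.m, a.l - Pi.single j 1, a.lbar, a.k) +
        (0, Pi.single j 1, 0, 0)) ((a.l j : ℂ) * (-Complex.I * Ω j)) : TrigPoly n₁ n₂) =
        AddMonoidAlgebra.single a ((a.l j : ℂ) * (-Complex.I * Ω j)) := by
      intro j
      by_cases h : a.l j = 0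
      · simp [h]
      · congr 1
        simp only [Prod.mk_add_mk, add_zero, sub_single_add_single _ _ h]
    simp only [h1, h2]
    ext b
    simp only [AddMonoidAlgebra.coeff_sum, AddMonoidAlgebra.coeff_sub,
      AddMonoidAlgebra.coeff_single, Finsupp.coe_finsetSum, Finsupp.coe_sub, Pi.sub_apply,
      Finset.sum_apply, Finsupp.single_apply]
    split_ifs
    · rw [Finset.mul_sum]; exact Finset.sum_congr rfl fun j _ => by ring
    · simp
  rw [← this, LinearMap.flip_apply, lieBilin_apply]

/-- The factor i from ∂_q meets the real pairing k·ω, and the -i of z_j z̄_j = -i z_j w_j gives the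
same prefactor i to the part with Ω. -/
lemma lie_normalPart (χ : TrigPoly n₁ n₂) (ω : Fin n₁ → ℂ) (Ω : Fin n₂ → ℂ) :
    lie χ (normalPart ω Ω) = diag (fun a => Complex.I * a.divisor ω Ω) χ := by
  have : (normalPart ω Ω : TrigPoly n₁ n₂) = actionPart ω + oscillatorPart Ω := rfl
  rw [this, lie_add_right, lie_actionPart, lie_oscillatorPart]
  ext a
  simp only [AddMonoidAlgebra.coeff_add, Finsupp.coe_add, Pi.add_apply, coeff_diag, Idx.divisor,
    EllipticTori.divisor]
  push_cast
  ring

/-- The homological equation is solved by `solveHomological`, up to the resonant terms. -/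
lemma lie_solveHomological (ω : Fin n₁ → ℂ) (Ω : Fin n₂ → ℂ) (g : TrigPoly n₁ n₂)
    (h : ∀ a : Idx n₁ n₂, g.coeff a ≠ 0 → (a.k = 0 ∧ a.l = a.lbar) ∨ a.divisor ω Ω ≠ 0) :
    lie (solveHomological ω Ω g) (normalPart ω Ω) = resonantPart g - g := by
  rw [lie_normalPart, solveHomological_eq]
  ext a
  simp only [coeff_diag, resonantPart, AddMonoidAlgebra.coeff_sub, Finsupp.coe_sub, Pi.sub_apply]
  by_cases hg : g.coeff a = 0
  · simp [hg]
  by_cases ha : a.k = 0 ∧ a.l = a.lbar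
  · simp [ha, Idx.divisor_eq_zero ω Ω a ha]
  · have := (h a hg).resolve_left ha
    rw [if_neg ha]
    field_simp
    rw [Complex.I_sq]
    ring

/-- Degree at most 2 bounds |λ-λ̄| by 2. For k = 0 the available bound γ is stronger than the one
stated, as rK ≥ 1 and τ ≥ 0. -/
lemma divisor_bound {K r : ℕ} {γ τ : ℝ} (hγ : 0 < γ) (hτ : 0 ≤ τ) (hK : 1 ≤ K) (hr : 1 ≤ r)
    {ω : Fin n₁ → ℂ} {Ω : Fin n₂ → ℂ} (h : NonResonant K γ τ r ω Ω) (a : Idx n₁ n₂)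
    (hd : a.deg ≤ 2) (hk : l1 a.k ≤ (r * K : ℕ)) :
    (a.k = 0 ∧ a.l = a.lbar) ∨ γ / ((r * K : ℕ) : ℝ) ^ τ ≤ ‖a.divisor ω Ω‖ := by
  have hl : l1 (fun j => (a.l j : ℤ) - (a.lbar j : ℤ)) ≤ 2 := by
    have h1 : l1 (fun j => (a.l j : ℤ) - (a.lbar j : ℤ)) ≤
        ∑ j, (a.l j : ℤ) + ∑ j, (a.lbar j : ℤ) := by
      rw [l1, ← Finset.sum_add_distrib]
      refine Finset.sum_le_sum fun j _ => (abs_sub _ _).trans ?_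
      simp
    have h2 : (0 : ℤ) ≤ ∑ j, (a.m j : ℤ) := Finset.sum_nonneg fun _ _ => Int.natCast_nonneg _
    rw [Idx.deg] at hd
    linarith
  by_cases hk0 : a.k = 0
  · by_cases hl0 : a.l = a.lbar
    · exact Or.inl ⟨hk0, hl0⟩
    · right
      have h3 : 0 < l1 (fun j => (a.l j : ℤ) - (a.lbar j : ℤ)) := by
        refine lt_of_le_of_ne (l1_nonneg _) fun h0 => hl0 ?_
        rw [l1, eq_comm, Finset.sum_eq_zero_iff_of_nonneg fun _ _ => abs_nonneg _] at h0
        funext j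
        have := h0 j (Finset.mem_univ j)
        rw [abs_eq_zero] at this
        omega
      have h4 := h.2 _ h3 hl
      rw [Idx.divisor, hk0]
      refine le_trans (div_le_self hγ.le (Real.one_le_rpow ?_ hτ)) h4
      exact_mod_cast Nat.mul_pos hr hK
  · right
    have h3 : 0 < l1 a.k := by
      refine lt_of_le_of_ne (l1_nonneg _) fun h0 => hk0 ?_
      rw [l1, eq_comm, Finset.sum_eq_zero_iff_of_nonneg fun _ _ => abs_nonneg _] at h0
      funext j
      exact abs_eq_zero.1 (h0 j (Finset.mem_univ j))
    exact h.1 _ _ h3 hk hl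

/-! ### Lie series acting on the components of a Hamiltonian. -/

lemma lieSeries_term_mem {K r : ℕ} {d : ℕ} {χ : TrigPoly n₁ n₂}
    (hχ : χ ∈ degreeClass (2 - d : ℤ) (r * K : ℕ)) {F : ℕ → ℕ → TrigPoly n₁ n₂}
    (hF : ∀ l s, InClass l (s * K) (F l s)) {l s j : ℕ} (hj : j * r ≤ s) :
    InClass l (s * K) ((lie χ)^[j] (F (l + d * j) (s - j * r))) := by
  rw [inClass_iff]
  have := lie_iterate_mem hχ (inClass_iff.1 (hF (l + d * j) (s - j * r))) j
  convert this using 2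
  · push_cast; ring
  · push_cast [Nat.cast_sub hj]; ring

lemma inClass_add {d N : ℕ} {f g : TrigPoly n₁ n₂} (hf : InClass d N f) (hg : InClass d N g) :
    InClass d N (f + g) := by
  rw [inClass_iff] at *; exact add_mem hf hg

lemma inClass_smul {d N : ℕ} {f : TrigPoly n₁ n₂} (c : ℂ) (hf : InClass d N f) :
    InClass d N (c • f) := by
  rw [inClass_iff] at *; exact Submodule.smul_mem _ c hf

lemma inClass_zero (d N : ℕ) : InClass d N (0 : TrigPoly n₁ n₂) := by
  rw [inClass_iff]; exact zero_mem _

lemma inClass_sum {d N : ℕ} {ι : Type*} {A : Finset ι} {f : ι → TrigPoly n₁ n₂}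
    (h : ∀ i ∈ A, InClass d N (f i)) : InClass d N (∑ i ∈ A, f i) := by
  simp only [inClass_iff] at *; exact Submodule.sum_mem _ h

lemma inClass_solveHomological {d N : ℕ} {g : TrigPoly n₁ n₂} (hg : InClass d N g)
    (ω : Fin n₁ → ℂ) (Ω : Fin n₂ → ℂ) : InClass d N (solveHomological ω Ω g) := by
  rw [inClass_iff, solveHomological_eq] at *; exact diag_mem _ hg

lemma mul_le_of_mem_range_div {r s j : ℕ} (hj : j ∈ Finset.range (s / r + 1)) : j * r ≤ s :=
  (Nat.mul_le_mul_right r (Nat.lt_succ_iff.1 (Finset.mem_range.1 hj))).trans (Nat.div_mul_le_self s r)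

/-- The j-th iterate on N has order jr and degree 2-dj, so N is felt only on that line of the (l, s)
plane. -/
lemma lieSeries_components (r d : ℕ) (χ N : TrigPoly n₁ n₂) (f : ℕ → ℕ → TrigPoly n₁ n₂)
    (l s : ℕ) : lieSeries r d χ (components N f) l s =
      ∑ j ∈ Finset.range (s / r + 1), ((1 : ℂ) / (j.factorial : ℂ)) •
        (if l + d * j = 2 ∧ s = j * r then (lie χ)^[j] N else 0) + lieSeries r d χ f l s := by
  rw [lieSeries, lieSeries, ← Finset.sum_add_distrib]
  refine Finset.sum_congr rfl fun j hj => ?_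
  have := mul_le_of_mem_range_div hj
  rw [components, lie_iterate_add, smul_add]
  congr 2
  by_cases h : l + d * j = 2 ∧ s - j * r = 0
  · rw [if_pos h, if_pos ⟨h.1, by omega⟩]
  · rw [if_neg h, if_neg fun h' => h ⟨h'.1, by omega⟩, lie_iterate_zero]

lemma lieSeries_of_lt {r s : ℕ} (h : s < r) (d : ℕ) (χ : TrigPoly n₁ n₂)
    (f : ℕ → ℕ → TrigPoly n₁ n₂) (l : ℕ) : lieSeries r d χ f l s = f l s := by
  simp [lieSeries, Nat.div_eq_of_lt h]

lemma lieSeries_of_lt_two_mul {r s : ℕ} (h : r ≤ s) (h' : s < 2 * r) (d : ℕ) (χ : TrigPoly n₁ n₂)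
    (f : ℕ → ℕ → TrigPoly n₁ n₂) (l : ℕ) :
    lieSeries r d χ f l s = f l s + lie χ (f (l + d) (s - r)) := by
  have : s / r = 1 := Nat.div_eq_of_lt_le (by omega) (by omega)
  simp [lieSeries, this, Finset.sum_range_succ]

lemma lieSeries_of_lt_three_mul {r s : ℕ} (h : 2 * r ≤ s) (h' : s < 3 * r) (d : ℕ)
    (χ : TrigPoly n₁ n₂) (f : ℕ → ℕ → TrigPoly n₁ n₂) (l : ℕ) :
    lieSeries r d χ f l s = f l s + lie χ (f (l + d) (s - r)) +
      ((1 : ℂ) / 2) • lie χ (lie χ (f (l + d * 2) (s - 2 * r))) := by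
  have : s / r = 2 := Nat.div_eq_of_lt_le (by omega) (by omega)
  simp [lieSeries, this, Finset.sum_range_succ]

/-! ### The formal normalization step. -/

namespace Ham

variable {K r : ℕ} {H : Ham n₁ n₂}

lemma chi0_mem (hH : H.HasForm K (r - 1)) : InClass 0 (r * K) (H.chi0 r) :=
  inClass_solveHomological (hH.1 0 r) _ _

/-- The recursive formula is the Lie series of the perturbation, without the term removed by the
homological equation. For l = 0 and s < 2r the bracket would act on a degree-2 term of order below
r, which vanishes. -/
lemma fI_eq (hr : 1 ≤ r) (hH : H.HasForm K (r - 1)) (l s : ℕ) :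
    H.fI r l s = lieSeries r 2 (H.chi0 r) H.f l s - if l = 0 ∧ s = r then H.f 0 r else 0 := by
  rw [fI]
  split_ifs with h1 h2
  · obtain ⟨rfl, rfl⟩ := h1
    rw [lieSeries_of_lt_two_mul le_rfl (by omega), hH.2 (0 + 2) (s - s) (by omega) (by omega),
      lie_zero_right, add_zero, sub_self]
  · obtain ⟨rfl, h2⟩ := h2
    rw [sub_zero]
    rcases lt_or_ge s r with h | h
    · rw [lieSeries_of_lt h]
    · rw [lieSeries_of_lt_two_mul h h2, hH.2 (0 + 2) (s - r) (by omega) (by omega),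
        lie_zero_right, add_zero]
  · rw [sub_zero]; rfl

lemma fI_mem (hH : H.HasForm K (r - 1)) (l s : ℕ) : InClass l (s * K) (H.fI r l s) := by
  rw [fI]
  split_ifs with h1 h2
  · exact inClass_zero _ _
  · exact h2.1 ▸ hH.1 0 s
  · refine inClass_sum fun j hj => inClass_smul _ ?_
    exact lieSeries_term_mem (d := 2) (inClass_iff.1 (chi0_mem hH)) hH.1 (mul_le_of_mem_range_div hj)

lemma fI_zero (hr : 1 ≤ r) (hH : H.HasForm K (r - 1)) (l s : ℕ) (hl : l ≤ 2)
    (h : s < r ∨ (l = 0 ∧ s = r)) : H.fI r l s = 0 := by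
  rcases h with h | h
  · rw [fI_eq hr hH, lieSeries_of_lt h, if_neg (by omega), hH.2 l s hl (by omega), sub_zero]
  · rw [fI, if_pos h]

lemma chi1_mem (hH : H.HasForm K (r - 1)) : InClass 1 (r * K) (H.chi1 r) :=
  inClass_solveHomological (fI_mem hH 1 r) _ _

/-- Both corrections come from the iterates on N: the first one equals -f₁, and half of the second
equals -½ L f₁. The latter leaves one half of the bracket in degree 0 and order 2r. -/
lemma fII_eq (hr : 1 ≤ r) (hH : H.HasForm K (r - 1)) (l s : ℕ) :
    H.fII r l s = lieSeries r 1 (H.chi1 r) (H.fI r) l s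
      - (if l = 1 ∧ s = r then H.fI r 1 r else 0)
      - if l = 0 ∧ s = 2 * r then ((1 : ℂ) / 2) • lie (H.chi1 r) (H.fI r 1 r) else 0 := by
  have hz := fI_zero hr hH
  rw [fII]
  by_cases h1 : l ≤ 1 ∧ s = r
  · obtain ⟨hl, rfl⟩ := h1
    rw [if_pos ⟨hl, rfl⟩, lieSeries_of_lt_two_mul le_rfl (by omega), if_neg (by omega : ¬(l = 0 ∧ s = 2 * s)),
      hz (l + 1) (s - s) (by omega) (by omega), lie_zero_right]
    interval_cases l
    · rw [hz 0 s (by omega) (by omega)]; simp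
    · simp
  rw [if_neg h1]
  by_cases h2 : l ≤ 1 ∧ s < 2 * r
  · rw [if_pos h2, if_neg (by omega), if_neg (by omega), sub_zero, sub_zero]
    rcases lt_or_ge s r with h | h
    · rw [lieSeries_of_lt h]
    · rw [lieSeries_of_lt_two_mul h h2.2, hz (l + 1) (s - r) (by omega) (by omega),
        lie_zero_right, add_zero]
  rw [if_neg h2]
  by_cases h3 : l = 0 ∧ s = 2 * r
  · obtain ⟨rfl, rfl⟩ := h3
    rw [if_pos ⟨rfl, rfl⟩, if_neg (by omega), if_pos ⟨rfl, rfl⟩,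
      lieSeries_of_lt_three_mul le_rfl (by omega), hz (0 + 1 * 2) (2 * r - 2 * r) (by omega)
      (by omega), lie_zero_right, lie_zero_right, smul_zero, add_zero, sub_zero, zero_add,
      (by omega : 2 * r - r = r), add_sub_assoc]
    congr 1
    have : lie (H.chi1 r) (H.fI r 1 r) = ((1 : ℂ) / 2) • lie (H.chi1 r) (H.fI r 1 r)
        + ((1 : ℂ) / 2) • lie (H.chi1 r) (H.fI r 1 r) := by
      rw [← add_smul]; norm_num
    rw [eq_sub_iff_add_eq, ← this]
  rw [if_neg h3]
  by_cases h4 : l = 0 ∧ s < 3 * r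
  · obtain ⟨rfl, h4⟩ := h4
    rw [if_pos ⟨rfl, h4⟩, if_neg (by omega), if_neg (by omega), sub_zero, sub_zero,
      lieSeries_of_lt_three_mul (by omega) h4, hz (0 + 1 * 2) (s - 2 * r) (by omega) (by omega),
      lie_zero_right, lie_zero_right, smul_zero, add_zero, zero_add]
  rw [if_neg h4, if_neg (by omega), if_neg (by omega), sub_zero, sub_zero]
  simp [lieSeries]

lemma lieSeries_mem {d : ℕ} {χ : TrigPoly n₁ n₂}
    (hχ : χ ∈ degreeClass (2 - d : ℤ) (r * K : ℕ)) {F : ℕ → ℕ → TrigPoly n₁ n₂}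
    (hF : ∀ l s, InClass l (s * K) (F l s)) (l s : ℕ) :
    InClass l (s * K) (lieSeries r d χ F l s) :=
  inClass_sum fun _ hj => inClass_smul _ (lieSeries_term_mem hχ hF (mul_le_of_mem_range_div hj))

lemma fII_mem (hr : 1 ≤ r) (hH : H.HasForm K (r - 1)) (l s : ℕ) :
    InClass l (s * K) (H.fII r l s) := by
  have h1 := inClass_iff.1 (chi1_mem hH)
  rw [fII_eq hr hH, inClass_iff]
  refine sub_mem (sub_mem (inClass_iff.1 (lieSeries_mem (d := 1) h1 (fI_mem hH) l s)) ?_) ?_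
  · split_ifs with h
    · obtain ⟨rfl, rfl⟩ := h
      exact inClass_iff.1 (fI_mem hH 1 s)
    · exact zero_mem _
  · split_ifs with h
    · obtain ⟨rfl, rfl⟩ := h
      refine Submodule.smul_mem _ _ ?_
      have := lie_mem (e := (0 : ℕ)) h1 (inClass_iff.1 (fI_mem hH 1 r)) (by norm_num)
      convert this using 2
      push_cast; ring
    · exact zero_mem _

lemma fII_zero (hr : 1 ≤ r) (hH : H.HasForm K (r - 1)) (l s : ℕ) (hl : l ≤ 2)
    (h : s < r ∨ (l ≤ 1 ∧ s = r)) : H.fII r l s = 0 := by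
  rcases h with h | h
  · rw [fII_eq hr hH, lieSeries_of_lt h, if_neg (by omega), if_neg (by omega),
      fI_zero hr hH l s hl (Or.inl h), sub_zero, sub_zero]
  · rw [fII, if_pos h]

lemma chi2_mem (hr : 1 ≤ r) (hH : H.HasForm K (r - 1)) : InClass 2 (r * K) (H.chi2 r) :=
  inClass_solveHomological (fII_mem hr hH 2 r) _ _

/-- In degree 2, the conditions k = 0 and λ = λ̄ leave only the monomials p_j and z_j w_j. -/
lemma Z_eq (hr : 1 ≤ r) (hH : H.HasForm K (r - 1)) : H.Z r = resonantPart (H.fII r 2 r) := by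
  have hm := fII_mem hr hH 2 r
  rw [Z, resonantPart]
  unfold zP zZ
  generalize H.fII r 2 r = g at hm ⊢
  ext a
  rw [coeff_diag]
  simp only [AddMonoidAlgebra.coeff_add, AddMonoidAlgebra.coeff_sum, AddMonoidAlgebra.coeff_single,
    Finsupp.coe_add, Pi.add_apply, Finsupp.coe_finsetSum, Finset.sum_apply, Finsupp.single_apply]
  have hP : ∀ j : Fin n₁, (if (((Pi.single j 1, 0, 0, 0) : Idx n₁ n₂) = a) then
      g.coeff (Pi.single j 1, 0, 0, 0) else 0) =
      (if (((Pi.single j 1, 0, 0, 0) : Idx n₁ n₂) = a) then 1 else 0) * g.coeff a := by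
    intro j; split_ifs with h
    · rw [h, one_mul]
    · rw [zero_mul]
  have hZ : ∀ j : Fin n₂, (if (((0, Pi.single j 1, Pi.single j 1, 0) : Idx n₁ n₂) = a) then
      g.coeff (0, Pi.single j 1, Pi.single j 1, 0) else 0) =
      (if (((0, Pi.single j 1, Pi.single j 1, 0) : Idx n₁ n₂) = a) then 1 else 0)
        * g.coeff a := by
    intro j; split_ifs with h
    · rw [h, one_mul]
    · rw [zero_mul]
  simp_rw [hP, hZ, ← Finset.sum_mul, ← add_mul]
  by_cases hg : g.coeff a = 0
  · simp [hg]
  congr 1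
  have hd := (hm a hg).1
  obtain ⟨m, l, lb, k⟩ := a
  simp only [Idx.m, Idx.l, Idx.lbar] at hd
  simp only [Prod.mk.injEq]
  by_cases h : k = 0 ∧ l = lb
  · obtain ⟨rfl, rfl⟩ := h
    rw [if_pos (by exact ⟨rfl, rfl⟩)]
    -- The degree condition reads 2|m| + 2|λ| = 2, so exactly one exponent is 1.
    have hd' : ∑ j, m j + ∑ j, l j = 1 := by omega
    have key : ∀ {n : ℕ} (v : Fin n → ℕ), ∑ j, v j = 1 → ∃ i, v = Pi.single i 1 := by
      intro n v hv
      have : ∃ i, v i ≠ 0 := by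
        by_contra! h
        simp [h] at hv
      obtain ⟨i, hi⟩ := this
      have h1 := Finset.add_sum_erase Finset.univ v (Finset.mem_univ i)
      refine ⟨i, funext fun j => ?_⟩
      rcases eq_or_ne j i with rfl | hj
      · simp; omega
      · have h2 := Finset.single_le_sum (f := v) (fun _ _ => Nat.zero_le _)
          (Finset.mem_erase.2 ⟨hj, Finset.mem_univ j⟩)
        simp [hj]; omega
    rcases Nat.eq_zero_or_pos (∑ j, m j) with h0 | h0
    · obtain ⟨i, rfl⟩ := key l (by omega)
      have hm0 : m = 0 := by
        funext j
        exact (Finset.sum_eq_zero_iff.1 h0) j (Finset.mem_univ j)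
      subst hm0
      rw [Finset.sum_eq_zero, Finset.sum_eq_single i, zero_add]
      · simp
      · intro j _ hj
        rw [if_neg]
        intro hh
        have := congrFun hh.2.1 j
        simp [hj] at this
      · simp
      · intro j _
        rw [if_neg]
        intro hh
        have := congrFun hh.1 j
        simp at this
    · obtain ⟨i, rfl⟩ := key m (by omega)
      have hl0 : l = 0 := by
        funext j
        exact (Finset.sum_eq_zero_iff.1 (by omega : ∑ j, l j = 0)) j (Finset.mem_univ j)
      subst hl0
      rw [Finset.sum_eq_single i, Finset.sum_eq_zero, add_zero]
      · simp
      · intro j _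
        rw [if_neg]
        intro hh
        have := congrFun hh.2.1 j
        simp at this
      · intro j _ hj
        rw [if_neg]
        intro hh
        have := congrFun hh.1 j
        simp [hj] at this
      · simp
  · rw [if_neg (by exact h), Finset.sum_eq_zero, Finset.sum_eq_zero, add_zero]
    · intro j _
      rw [if_neg]
      rintro ⟨_, rfl, rfl, rfl⟩
      exact h ⟨rfl, rfl⟩
    · intro j _
      rw [if_neg]
      rintro ⟨_, rfl, rfl, rfl⟩
      exact h ⟨rfl, rfl⟩

end Ham

namespace Ham
variable {K r : ℕ} {H : Ham n₁ n₂}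

/-- The full Lie series has one more term, j = s/r; it acts on a component of order s mod r < r,
which is zero. -/
lemma fNext_of_le_one (hr : 1 ≤ r) (hH : H.HasForm K (r - 1)) {l : ℕ} (hl : l ≤ 1) (s : ℕ) :
    H.fNext r l s = lieSeries r 0 (H.chi2 r) (H.fII r) l s := by
  have hz := fII_zero hr hH
  rw [fNext]
  by_cases h : l ≤ 2 ∧ s ≤ r
  · rw [if_pos h]
    rcases lt_or_eq_of_le h.2 with h' | rfl
    · rw [lieSeries_of_lt h', hz l s h.1 (Or.inl h')]
    · rw [lieSeries_of_lt_two_mul le_rfl (by omega), hz l s h.1 (Or.inr ⟨hl, rfl⟩),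
        hz (l + 0) (s - s) h.1 (by omega), lie_zero_right, add_zero]
  · have h1 := Nat.mod_add_div s r
    have h2 := Nat.mod_lt s hr
    rw [if_neg h, if_pos hl, lieSeries, Finset.sum_range_succ, zero_mul, add_zero,
      hz l (s - s / r * r) (by omega) (Or.inl (by rw [mul_comm]; omega)), lie_iterate_zero,
      smul_zero, add_zero]
    simp only [zero_mul, add_zero]

lemma fNext_of_not_dvd (hr : 1 ≤ r) (hH : H.HasForm K (r - 1)) {s : ℕ} (hs : ¬ r ∣ s) :
    H.fNext r 2 s = lieSeries r 0 (H.chi2 r) (H.fII r) 2 s := by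
  have hz := fII_zero hr hH
  rw [fNext]
  by_cases h : s ≤ r
  · rw [if_pos ⟨le_rfl, h⟩]
    have h' : s < r := lt_of_le_of_ne h (by rintro rfl; exact hs dvd_rfl)
    rw [lieSeries_of_lt h', hz 2 s le_rfl (Or.inl h')]
  · have h1 := Nat.mod_add_div s r
    have h2 := Nat.mod_lt s hr
    rw [if_neg (by omega), if_neg (by omega), if_neg (fun h => hs h.2), if_pos rfl, lieSeries,
      Finset.sum_range_succ, zero_mul, add_zero,
      hz 2 (s - s / r * r) (by omega) (Or.inl (by rw [mul_comm]; omega)), lie_iterate_zero,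
      smul_zero, add_zero]
    simp only [zero_mul, add_zero]

lemma fNext_of_two_lt {l : ℕ} (hl : 2 < l) (s : ℕ) :
    H.fNext r l s = lieSeries r 0 (H.chi2 r) (H.fII r) l s := by
  rw [fNext, if_neg (by omega), if_neg (by omega), if_neg (by omega), if_neg (by omega), lieSeries]
  simp

lemma lieSeries_fII_mul (hr : 1 ≤ r) (hH : H.HasForm K (r - 1)) (n : ℕ) :
    lieSeries r 0 (H.chi2 r) (H.fII r) 2 ((n + 1) * r) =
      ∑ i ∈ Finset.range n, ((1 : ℂ) / (i.factorial : ℂ)) •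
        (lie (H.chi2 r))^[i] (H.fII r 2 ((n + 1) * r - i * r)) +
      ((1 : ℂ) / (n.factorial : ℂ)) • (lie (H.chi2 r))^[n] (H.fII r 2 r) := by
  rw [lieSeries, Nat.mul_div_cancel _ hr, Finset.sum_range_succ, Finset.sum_range_succ]
  simp only [zero_mul, add_zero]
  rw [fII_zero hr hH 2 ((n + 1) * r - (n + 1) * r) le_rfl (by omega), lie_iterate_zero, smul_zero,
    add_zero, (by rw [add_mul]; omega : (n + 1) * r - n * r = r)]

/-- With L = `lie (H.chi2 r)` and f = `H.fII r 2 r`, the (n+1)-st iterate on N is Lⁿ(Z - f). Its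
coefficient 1/(n+1)! combines with the 1/n! of Lⁿf into n/(n+1)!, the coefficient in `fNext`. -/
lemma lieIII_dvd (hr : 1 ≤ r) (hH : H.HasForm K (r - 1)) {N : TrigPoly n₁ n₂}
    (hN : lie (H.chi2 r) N + H.fII r 2 r = H.Z r) (n : ℕ) :
    lieSeries r 0 (H.chi2 r) (components N (H.fII r)) 2 ((n + 1) * r) =
      H.fNext r 2 ((n + 1) * r) + if n = 0 then H.Z r else 0 := by
  rw [lieSeries_components, lieSeries_fII_mul hr hH, Nat.mul_div_cancel _ hr,
    Finset.sum_eq_single (n + 1)]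
  · rw [if_pos ⟨by omega, rfl⟩, Function.iterate_succ_apply, eq_sub_of_add_eq hN, lie_iterate_sub]
    rw [fNext]
    rcases Nat.eq_zero_or_pos n with rfl | hn
    · simp
    · have : ¬ (n + 1) * r ≤ r := by
        rw [not_le]; nlinarith
      rw [if_neg (fun h => this h.2), if_neg (by omega), if_pos ⟨rfl, Dvd.intro_left _ rfl⟩,
        if_neg (by omega), Nat.mul_div_cancel _ hr, add_tsub_cancel_right, add_zero]
      have hf : ((n + 1).factorial : ℂ) = (n + 1) * n.factorial := by
        rw [Nat.factorial_succ]; push_cast; ring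
      have h1 : (1 : ℂ) / n.factorial = (n + 1 : ℂ) / ((n + 1).factorial : ℂ) := by
        rw [hf, div_mul_eq_div_div, div_self (by exact_mod_cast n.succ_ne_zero)]
      rw [h1]
      push_cast
      module
  · intro j _ hj
    rw [if_neg, smul_zero]
    rintro ⟨_, h⟩
    exact hj (Nat.eq_of_mul_eq_mul_right hr h).symm
  · intro h
    simp at h

lemma lieIII (hr : 1 ≤ r) (hH : H.HasForm K (r - 1)) {N : TrigPoly n₁ n₂}
    (hN : lie (H.chi2 r) N + H.fII r 2 r = H.Z r) (l s : ℕ) :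
    lieSeries r 0 (H.chi2 r) (components N (H.fII r)) l s =
      components N (H.fNext r) l s + if l = 2 ∧ s = r then H.Z r else 0 := by
  by_cases hl : l = 2
  · subst hl
    by_cases hs : r ∣ s
    · obtain ⟨n, rfl⟩ := hs
      rw [mul_comm r n]
      rcases n with _ | n
      · rw [zero_mul, lieSeries_of_lt hr, if_neg (by omega), add_zero, components, components,
          fII_zero hr hH 2 0 le_rfl (Or.inl hr), fNext, if_pos ⟨rfl, rfl⟩,
          if_pos ⟨le_rfl, Nat.zero_le r⟩]
      · have hne : ¬ (2 = 2 ∧ (n + 1) * r = 0) := fun h =>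
          absurd h.2 (Nat.mul_pos n.succ_pos hr).ne'
        rw [lieIII_dvd hr hH hN, components, if_neg hne, zero_add]
        congr 1
        refine if_congr ⟨?_, ?_⟩ rfl rfl
        · rintro rfl; simp
        · rintro ⟨_, h⟩
          have := Nat.eq_of_mul_eq_mul_right hr (h.trans (one_mul r).symm)
          omega
    · rw [lieSeries_components, components, fNext_of_not_dvd hr hH hs,
        if_neg (by rintro ⟨_, rfl⟩; exact hs (dvd_zero r)),
        if_neg (by rintro ⟨_, rfl⟩; exact hs dvd_rfl), zero_add, add_zero, Finset.sum_eq_zero,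
        zero_add]
      intro j _
      rw [if_neg, smul_zero]
      rintro ⟨_, rfl⟩
      exact hs (Dvd.intro_left _ rfl)
  · have h1 : H.fNext r l s = lieSeries r 0 (H.chi2 r) (H.fII r) l s := by
      rcases Nat.lt_or_ge 2 l with h | h
      · exact fNext_of_two_lt h s
      · exact fNext_of_le_one hr hH (by omega) s
    rw [lieSeries_components, components, h1, if_neg (by omega), if_neg (by omega), zero_add,
      add_zero, Finset.sum_eq_zero, zero_add]
    intro j _
    rw [if_neg (by omega), smul_zero]

lemma lieII (hr : 1 ≤ r) (hH : H.HasForm K (r - 1)) {N : TrigPoly n₁ n₂}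
    (hN : lie (H.chi1 r) N + H.fI r 1 r = 0) (l s : ℕ) :
    lieSeries r 1 (H.chi1 r) (components N (H.fI r)) l s = components N (H.fII r) l s := by
  rw [lieSeries_components, components, fII_eq hr hH]
  have hN' : lie (H.chi1 r) N = -H.fI r 1 r := eq_neg_of_add_eq_zero_left hN
  -- The condition l + j = 2, s = jr leaves just (2, 0), (1, r) and (0, 2r).
  have h0 : ∑ j ∈ Finset.range (s / r + 1), ((1 : ℂ) / (j.factorial : ℂ)) •
      (if l + 1 * j = 2 ∧ s = j * r then (lie (H.chi1 r))^[j] N else 0) =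
      (if l = 2 ∧ s = 0 then N else 0) - (if l = 1 ∧ s = r then H.fI r 1 r else 0)
      - if l = 0 ∧ s = 2 * r then ((1 : ℂ) / 2) • lie (H.chi1 r) (H.fI r 1 r) else 0 := by
    by_cases hl : l ≤ 2
    · by_cases hs : s = (2 - l) * r
      · have hdiv : s / r = 2 - l := by rw [hs, Nat.mul_div_cancel _ hr]
        rw [Finset.sum_eq_single (2 - l)]
        · rw [if_pos ⟨by omega, hs⟩]
          interval_cases l
          · have h1 : (lie (H.chi1 r))^[2 - 0] N = - lie (H.chi1 r) (H.fI r 1 r) := by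
              change lie _ (lie _ N) = _
              rw [hN', ← lieBilin_apply, map_neg, lieBilin_apply]
            rw [h1, if_neg (by omega), if_neg (by omega), if_pos ⟨rfl, hs⟩]
            simp
          · rw [if_neg (by omega), if_pos ⟨rfl, by omega⟩, if_neg (by omega)]
            simp [hN']
          · rw [if_pos ⟨rfl, by omega⟩, if_neg (by omega), if_neg (by omega)]
            simp
        · intro j _ hj
          rw [if_neg (by omega), smul_zero]
        · intro h
          rw [hdiv] at h
          simp at h
      · rw [Finset.sum_eq_zero, if_neg, if_neg, if_neg, sub_zero, sub_zero]
        · rintro ⟨rfl, h⟩; exact hs h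
        · rintro ⟨rfl, h⟩; exact hs (by simpa using h)
        · rintro ⟨rfl, h⟩; exact hs (by simpa using h)
        · intro j _
          rw [if_neg, smul_zero]
          rintro ⟨h, h'⟩
          exact hs (by rw [h']; congr 1; omega)
    · rw [Finset.sum_eq_zero, if_neg (by omega), if_neg (by omega), if_neg (by omega), sub_zero,
        sub_zero]
      intro j _
      rw [if_neg (by omega), smul_zero]
  rw [h0]
  abel

lemma lieI (hr : 1 ≤ r) (hH : H.HasForm K (r - 1)) {N : TrigPoly n₁ n₂}
    (hN : lie (H.chi0 r) N + H.f 0 r - average (H.f 0 r) = 0) (l s : ℕ) :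
    lieSeries r 2 (H.chi0 r) (components N H.f) l s =
      components N (H.fI r) l s + if l = 0 ∧ s = r then average (H.f 0 r) else 0 := by
  rw [lieSeries_components, components, fI_eq hr hH]
  have hN' : lie (H.chi0 r) N = average (H.f 0 r) - H.f 0 r := by
    rw [eq_sub_iff_add_eq]; exact sub_eq_zero.1 hN
  have h0 : ∑ j ∈ Finset.range (s / r + 1), ((1 : ℂ) / (j.factorial : ℂ)) •
      (if l + 2 * j = 2 ∧ s = j * r then (lie (H.chi0 r))^[j] N else 0) =
      (if l = 2 ∧ s = 0 then N else 0) - (if l = 0 ∧ s = r then H.f 0 r else 0)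
      + if l = 0 ∧ s = r then average (H.f 0 r) else 0 := by
    by_cases h2 : l = 2 ∧ s = 0
    · obtain ⟨rfl, rfl⟩ := h2
      simp
    by_cases h1 : l = 0 ∧ s = r
    · obtain ⟨rfl, rfl⟩ := h1
      rw [if_neg h2, if_pos ⟨rfl, rfl⟩, if_pos ⟨rfl, rfl⟩, Nat.div_self hr]
      simp [Finset.sum_range_succ, hN']
      abel
    · rw [if_neg h1, if_neg h1, if_neg h2, sub_zero, add_zero]
      refine Finset.sum_eq_zero fun j _ => ?_
      rw [if_neg, smul_zero]
      rintro ⟨h, h'⟩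
      rcases j with _ | _ | j
      · exact h2 ⟨by omega, by simpa using h'⟩
      · exact h1 ⟨by omega, by simpa using h'⟩
      · omega
  rw [h0]
  abel

lemma fNext_mem (hr : 1 ≤ r) (hH : H.HasForm K (r - 1)) (l s : ℕ) :
    InClass l (s * K) (H.fNext r l s) := by
  have h2 := inClass_iff.1 (chi2_mem hr hH)
  have hser : InClass l (s * K) (lieSeries r 0 (H.chi2 r) (H.fII r) l s) :=
    lieSeries_mem (d := 0) (by simpa using h2) (fII_mem hr hH) l s
  by_cases hl : l = 2 ∧ r ∣ s
  · obtain ⟨rfl, n, rfl⟩ := hl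
    have hZ : InClass 2 (r * K) (H.Z r) := by
      rw [Z_eq hr hH, inClass_iff]
      exact diag_mem _ (inClass_iff.1 (fII_mem hr hH 2 r))
    rw [fNext]
    by_cases h1 : 2 ≤ 2 ∧ r * n ≤ r
    · rw [if_pos h1]; exact inClass_zero _ _
    · rw [if_neg h1, if_neg (by omega), if_pos ⟨rfl, Dvd.intro n rfl⟩]
      have hterm : ∀ {g : TrigPoly n₁ n₂}, InClass 2 (r * K) g →
          InClass 2 (r * n * K) ((lie (H.chi2 r))^[r * n / r - 1] g) := by
        intro g hg
        have hn : 1 ≤ n := by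
          rcases n with _ | n
          · omega
          · omega
        rw [Nat.mul_div_cancel_left _ hr]
        rw [inClass_iff] at hg ⊢
        have := lie_iterate_mem h2 hg (n - 1)
        convert this using 2
        · push_cast; ring
        · push_cast [Nat.cast_sub hn]; ring
      refine inClass_add (inClass_add (inClass_smul _ (hterm (fII_mem hr hH 2 r)))
        (inClass_smul _ (hterm hZ))) (inClass_sum fun i hi => inClass_smul _ ?_)
      have hi' : i * r ≤ r * n := by
        rw [Nat.mul_div_cancel_left _ hr, Finset.mem_range] at hi
        rw [mul_comm]
        exact Nat.mul_le_mul_left r (by omega)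
      have := lieSeries_term_mem (d := 0) (χ := H.chi2 r) (by simpa using h2) (fII_mem hr hH)
        (l := 2) hi'
      simpa using this
  · rcases Nat.lt_trichotomy l 2 with h | rfl | h
    · rw [fNext_of_le_one hr hH (by omega)]; exact hser
    · rw [fNext_of_not_dvd hr hH fun h => hl ⟨rfl, h⟩]; exact hser
    · rw [fNext_of_two_lt h]; exact hser

lemma frequencies (ε : ℝ) (H : Ham n₁ n₂) : normalPart (H.step ε r).ω (H.step ε r).Ω =
    normalPart H.ω H.Ω + ((ε : ℂ) ^ r) • H.Z r := by
  simp only [normalPart, actionPart, step, Z, smul_add, Finset.smul_sum,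
    AddMonoidAlgebra.smul_single, smul_eq_mul]
  rw [add_add_add_comm, ← Finset.sum_add_distrib, ← Finset.sum_add_distrib]
  congr 1
  · refine Finset.sum_congr rfl fun j _ => ?_
    rw [← AddMonoidAlgebra.single_add]
  · refine Finset.sum_congr rfl fun j _ => ?_
    rw [← AddMonoidAlgebra.single_add]
    congr 1
    linear_combination (-(ε : ℂ) ^ r * H.zZ r j) * Complex.I_mul_I

lemma step_hasForm (ε : ℝ) (hr : 1 ≤ r) (hH : H.HasForm K (r - 1)) :
    (H.step ε r).HasForm K r := by
  refine ⟨fNext_mem hr hH, fun l s hl hs => ?_⟩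
  change H.fNext r l s = 0
  rw [fNext, if_pos ⟨hl, hs⟩]

lemma stepPerformed {γ τ : ℝ} (ε : ℝ) (hγ : 0 < γ) (hτ : 0 ≤ τ) (hK : 1 ≤ K) (hr : 1 ≤ r)
    (hH : H.HasForm K (r - 1)) (hnr : NonResonant K γ τ r H.ω H.Ω) :
    StepPerformed K ε r H := by
  have hsolve : ∀ {d : ℕ} {g : TrigPoly n₁ n₂}, d ≤ 2 → InClass d (r * K) g →
      lie (solveHomological H.ω H.Ω g) (normalPart H.ω H.Ω) = resonantPart g - g := by
    intro d g hd hg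
    refine lie_solveHomological _ _ _ fun a ha => ?_
    have h1 := inClass_iff.1 hg a ha
    refine (divisor_bound hγ hτ hK hr hnr a (by rw [h1.1]; exact_mod_cast hd)
      (by exact_mod_cast h1.2)).imp_right fun h => ?_
    rw [← norm_pos_iff]
    refine lt_of_lt_of_le (div_pos hγ (Real.rpow_pos_of_pos ?_ τ)) h
    exact_mod_cast Nat.mul_pos hr hK
  -- In degree 0 there are no powers of z or w, so resonance means k = 0.
  have h0 : resonantPart (H.f 0 r) = average (H.f 0 r) := by
    rw [average_eq]
    ext a
    rw [resonantPart, coeff_diag, coeff_diag]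
    by_cases ha : (H.f 0 r).coeff a = 0
    · simp [ha]
    · congr 1
      have hd := (hH.1 0 r a ha).1
      have h1 : ∑ j, a.l j = 0 := by omega
      have h2 : ∑ j, a.lbar j = 0 := by omega
      have : a.l = a.lbar := by
        funext j
        rw [Finset.sum_eq_zero_iff.1 h1 j (Finset.mem_univ j),
          Finset.sum_eq_zero_iff.1 h2 j (Finset.mem_univ j)]
      simp [this]
  -- Equal exponents of z and w force an even degree.
  have h1 : resonantPart (H.fI r 1 r) = 0 := by
    ext a
    rw [resonantPart, coeff_diag]
    by_cases ha : (H.fI r 1 r).coeff a = 0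
    · simp [ha]
    · have hd := (fI_mem hH 1 r a ha).1
      have : ¬ (a.k = 0 ∧ a.l = a.lbar) := by
        rintro ⟨-, h⟩
        rw [h] at hd
        omega
      simp [this]
  have hN0 : lie (H.chi0 r) (normalPart H.ω H.Ω) + H.f 0 r - average (H.f 0 r) = 0 := by
    rw [chi0, hsolve (by norm_num) (hH.1 0 r), h0]; abel
  -- χ₀ depends on the angles only, so the equation solved with the whole normal part is the one
  -- with ω·p.
  have hosc : lie (H.chi0 r) (oscillatorPart H.Ω) = 0 := by
    rw [lie_oscillatorPart]
    ext a
    rw [coeff_diag]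
    by_cases ha : (H.chi0 r).coeff a = 0
    · simp [ha]
    · have hd := (chi0_mem hH a ha).1
      have h1 : ∑ j, a.l j = 0 := by omega
      have h2 : ∑ j, a.lbar j = 0 := by omega
      have : ∀ j, ((a.l j : ℂ) - a.lbar j) = 0 := by
        intro j
        rw [Finset.sum_eq_zero_iff.1 h1 j (Finset.mem_univ j),
          Finset.sum_eq_zero_iff.1 h2 j (Finset.mem_univ j), sub_self]
      simp [this]
  have hN1 : lie (H.chi1 r) (normalPart H.ω H.Ω) + H.fI r 1 r = 0 := by
    rw [chi1, hsolve (by norm_num) (fI_mem hH 1 r), h1]; abel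
  have hN2 : lie (H.chi2 r) (normalPart H.ω H.Ω) + H.fII r 2 r = H.Z r := by
    rw [chi2, hsolve le_rfl (fII_mem hr hH 2 r), Z_eq hr hH]; abel
  exact
    { chi0_mem := chi0_mem hH
      chi1_mem := chi1_mem hH
      chi2_mem := chi2_mem hr hH
      homological0 := by
        have : (normalPart H.ω H.Ω : TrigPoly n₁ n₂) = actionPart H.ω + oscillatorPart H.Ω := rfl
        rw [this, lie_add_right, hosc, add_zero] at hN0
        exact hN0
      homological1 := hN1
      homological2 := hN2
      fI_mem := fI_mem hH
      fI_zero := fI_zero hr hH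
      fII_mem := fII_mem hr hH
      fII_zero := fII_zero hr hH
      next_form := step_hasForm ε hr hH
      lieI := lieI hr hH hN0
      lieII := lieII hr hH hN1
      lieIII := lieIII hr hH hN2
      frequencies := frequencies ε H }

lemma normalize_hasForm (ε : ℝ) (h0 : H.HasForm K 0) (r : ℕ) :
    (normalize ε H r).HasForm K r := by
  induction r with
  | zero => exact h0
  | succ r ih => exact step_hasForm ε (Nat.succ_pos r) ih

end Ham

/-! ### Fourier coefficients of products and brackets. -/

/-- The value of a monomial without its exponential factor. -/
def Idx.eval (a : Idx n₁ n₂) (p : Fin n₁ → ℂ) (z w : Fin n₂ → ℂ) : ℂ :=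
  (∏ j, p j ^ a.m j) * (∏ j, z j ^ a.l j) * ∏ j, w j ^ a.lbar j

/-- `fourierCoeff` as a linear map. -/
def fourierCoeffLin (k : Fin n₁ → ℤ) (p : Fin n₁ → ℂ) (z w : Fin n₂ → ℂ) :
    TrigPoly n₁ n₂ →ₗ[ℂ] ℂ where
  toFun g := fourierCoeff g k p z w
  map_add' f g := by
    rw [fourierCoeff, AddMonoidAlgebra.coeff_add, Finsupp.sum_add_index' (by simp)]
    · rfl
    · intro a b c; split_ifs <;> ring
  map_smul' c g := by
    rw [fourierCoeff, AddMonoidAlgebra.coeff_smul, Finsupp.sum_smul_index (by simp),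
      RingHom.id_apply, fourierCoeff, Finsupp.smul_sum]
    refine Finsupp.sum_congr fun a _ => ?_
    split_ifs <;> simp [mul_assoc]

lemma fourierCoeffLin_apply (k : Fin n₁ → ℤ) (p : Fin n₁ → ℂ) (z w : Fin n₂ → ℂ)
    (g : TrigPoly n₁ n₂) : fourierCoeffLin k p z w g = fourierCoeff g k p z w := rfl

lemma fourierCoeff_single (a : Idx n₁ n₂) (c : ℂ) (k : Fin n₁ → ℤ) (p : Fin n₁ → ℂ)
    (z w : Fin n₂ → ℂ) : fourierCoeff (AddMonoidAlgebra.single a c) k p z w =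
      if a.k = k then c * a.eval p z w else 0 := by
  rw [fourierCoeff, AddMonoidAlgebra.coeff_single, Finsupp.sum_single_index (by simp)]
  rfl

lemma fourierCoeff_eq_sum (g : TrigPoly n₁ n₂) (k : Fin n₁ → ℤ) (p : Fin n₁ → ℂ)
    (z w : Fin n₂ → ℂ) : fourierCoeff g k p z w =
      ∑ a ∈ g.coeff.support with a.k = k, g.coeff a * a.eval p z w := by
  rw [fourierCoeff, Finsupp.sum, Finset.sum_filter]
  rfl

lemma fourierCoeff_add (f g : TrigPoly n₁ n₂) (k : Fin n₁ → ℤ) (p : Fin n₁ → ℂ)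
    (z w : Fin n₂ → ℂ) :
    fourierCoeff (f + g) k p z w = fourierCoeff f k p z w + fourierCoeff g k p z w :=
  map_add (fourierCoeffLin k p z w) f g

lemma fourierCoeff_smul (c : ℂ) (g : TrigPoly n₁ n₂) (k : Fin n₁ → ℤ) (p : Fin n₁ → ℂ)
    (z w : Fin n₂ → ℂ) : fourierCoeff (c • g) k p z w = c * fourierCoeff g k p z w :=
  map_smul (fourierCoeffLin k p z w) c g

lemma fourierCoeff_zero (k : Fin n₁ → ℤ) (p : Fin n₁ → ℂ) (z w : Fin n₂ → ℂ) :
    fourierCoeff (0 : TrigPoly n₁ n₂) k p z w = 0 := map_zero (fourierCoeffLin k p z w)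

lemma Idx.eval_add (a b : Idx n₁ n₂) (p : Fin n₁ → ℂ) (z w : Fin n₂ → ℂ) :
    (a + b).eval p z w = a.eval p z w * b.eval p z w := by
  simp only [Idx.eval, Idx.m, Idx.l, Idx.lbar, Prod.fst_add, Prod.snd_add, Pi.add_apply, pow_add,
    Finset.prod_mul_distrib]
  ring

lemma fourierCoeff_single_mul (a : Idx n₁ n₂) (c : ℂ) (g : TrigPoly n₁ n₂) (k : Fin n₁ → ℤ)
    (p : Fin n₁ → ℂ) (z w : Fin n₂ → ℂ) :
    fourierCoeff (AddMonoidAlgebra.single a c * g) k p z w =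
      c * a.eval p z w * fourierCoeff g (k - a.k) p z w := by
  induction g using AddMonoidAlgebra.induction_linear with
  | zero => simp [fourierCoeff_zero]
  | add x y hx hy => rw [mul_add, fourierCoeff_add, hx, hy, fourierCoeff_add]; ring
  | single b d =>
    rw [AddMonoidAlgebra.single_mul_single, fourierCoeff_single, fourierCoeff_single, Idx.eval_add]
    have : (a + b).k = k ↔ b.k = k - a.k := by
      rw [eq_sub_iff_add_eq', Idx.k, Idx.k, Idx.k, Prod.snd_add, Prod.snd_add, Prod.snd_add]
    simp only [this]
    split_ifs <;> ring

/-- The functions with harmonics in `F`. -/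
def harmonicsIn (F : Finset (Fin n₁ → ℤ)) : Submodule ℂ (TrigPoly n₁ n₂) where
  carrier := {g | ∀ a, g.coeff a ≠ 0 → a.k ∈ F}
  zero_mem' := by simp
  add_mem' := by
    intro f g hf hg a ha
    by_cases h : f.coeff a = 0
    · refine hg a fun h' => ha ?_
      simp [h, h']
    · exact hf a h
  smul_mem' := by
    intro c f hf a ha
    refine hf a fun h => ha ?_
    simp [h]

/-- The set F need only contain the harmonics of f, so a single F serves for χ and all its
derivatives. -/
lemma fourierCoeff_mul {F : Finset (Fin n₁ → ℤ)} {f : TrigPoly n₁ n₂} (hf : f ∈ harmonicsIn F)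
    (g : TrigPoly n₁ n₂) (k : Fin n₁ → ℤ) (p : Fin n₁ → ℂ) (z w : Fin n₂ → ℂ) :
    fourierCoeff (f * g) k p z w =
      ∑ k' ∈ F, fourierCoeff f k' p z w * fourierCoeff g (k - k') p z w := by
  have h1 : fourierCoeff (f * g) k p z w =
      ∑ a ∈ f.coeff.support, f.coeff a * a.eval p z w * fourierCoeff g (k - a.k) p z w := by
    conv_lhs => rw [eq_sum_single f, Finset.sum_mul, ← fourierCoeffLin_apply, map_sum]
    refine Finset.sum_congr rfl fun a _ => ?_
    rw [fourierCoeffLin_apply, fourierCoeff_single_mul]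
  rw [h1, ← Finset.sum_fiberwise_of_maps_to (s := f.coeff.support) (t := F) (g := fun a => a.k)
    fun a ha => hf a (Finsupp.mem_support_iff.1 ha)]
  refine Finset.sum_congr rfl fun k' _ => ?_
  rw [fourierCoeff_eq_sum, Finset.sum_mul]
  refine Finset.sum_congr rfl fun a ha => ?_
  rw [(Finset.mem_filter.1 ha).2]

lemma monomialMap_single_mem_harmonicsIn {F : Finset (Fin n₁ → ℤ)} {T : Idx n₁ n₂ → Idx n₁ n₂}
    (hT : ∀ a, (T a).k = a.k) (c : Idx n₁ n₂ → ℂ) {g : TrigPoly n₁ n₂} (hg : g ∈ harmonicsIn F) :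
    monomialMap (fun a => AddMonoidAlgebra.single (T a) (c a)) g ∈ harmonicsIn F := by
  refine Submodule.sum_mem _ fun a ha => Submodule.smul_mem _ _ fun b hb => ?_
  by_cases h : T a = b
  · rw [← h, hT]; exact hg a (Finsupp.mem_support_iff.1 ha)
  · simp [h] at hb

lemma mem_harmonicsIn_image (g : TrigPoly n₁ n₂) :
    g ∈ harmonicsIn (g.coeff.support.image fun a => a.k) := fun _ ha =>
  Finset.mem_image_of_mem _ (Finsupp.mem_support_iff.2 ha)

lemma fourierCoeff_dQ (j : Fin n₁) (g : TrigPoly n₁ n₂) (k : Fin n₁ → ℤ) (p : Fin n₁ → ℂ)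
    (z w : Fin n₂ → ℂ) :
    fourierCoeff (dQ j g) k p z w = Complex.I * (k j : ℂ) * fourierCoeff g k p z w := by
  rw [dQ_eq]
  induction g using AddMonoidAlgebra.induction_linear with
  | zero => simp [fourierCoeff_zero]
  | add x y hx hy => rw [map_add, fourierCoeff_add, hx, hy, fourierCoeff_add]; ring
  | single b d =>
    rw [monomialMap_single, fourierCoeff_smul, fourierCoeff_single, fourierCoeff_single]
    split_ifs with h
    · rw [h]; ring
    · ring

/-- The contribution of the harmonics `k'` of `χ` and `k''` of `g` to the Lie derivative. -/
def bracketCoeff (χ g : TrigPoly n₁ n₂) (k' k'' : Fin n₁ → ℤ) (p : Fin n₁ → ℂ)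
    (z w : Fin n₂ → ℂ) : ℂ :=
  Complex.I * fourierCoeff χ k' p z w * ∑ j, (k' j : ℂ) * fourierCoeff (dP j g) k'' p z w -
    Complex.I * fourierCoeff g k'' p z w * ∑ j, (k'' j : ℂ) * fourierCoeff (dP j χ) k' p z w +
    (∑ j, fourierCoeff (dW j χ) k' p z w * fourierCoeff (dZ j g) k'' p z w +
      ∑ j, (-fourierCoeff (dZ j χ) k' p z w) * fourierCoeff (dW j g) k'' p z w)

lemma fourierCoeff_lie (χ g : TrigPoly n₁ n₂) (k : Fin n₁ → ℤ) (p : Fin n₁ → ℂ)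
    (z w : Fin n₂ → ℂ) : fourierCoeff (lie χ g) k p z w =
      ∑ k' ∈ χ.coeff.support.image fun a => a.k, bracketCoeff χ g k' (k - k') p z w := by
  have hχ := mem_harmonicsIn_image χ
  generalize χ.coeff.support.image (fun a => a.k) = F at hχ ⊢
  have h1 : ∀ j, dP j χ ∈ harmonicsIn F := fun j => by
    rw [dP_eq]
    exact monomialMap_single_mem_harmonicsIn (T := fun a => (a.m - Pi.single j 1, a.l, a.lbar, a.k)) (fun _ => rfl) _ hχ
  have h2 : ∀ j, dQ j χ ∈ harmonicsIn F := fun j => by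
    rw [dQ_eq]
    exact monomialMap_single_mem_harmonicsIn (T := fun a => a) (fun _ => rfl) _ hχ
  have h3 : ∀ j, dZ j χ ∈ harmonicsIn F := fun j => by
    rw [dZ_eq]
    exact monomialMap_single_mem_harmonicsIn (T := fun a => (a.m, a.l - Pi.single j 1, a.lbar, a.k)) (fun _ => rfl) _ hχ
  have h4 : ∀ j, dW j χ ∈ harmonicsIn F := fun j => by
    rw [dW_eq]
    exact monomialMap_single_mem_harmonicsIn (T := fun a => (a.m, a.l, a.lbar - Pi.single j 1, a.k)) (fun _ => rfl) _ hχ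
  rw [lie, ← fourierCoeffLin_apply, map_add, map_sum, map_sum]
  simp only [map_sub, fourierCoeffLin_apply]
  simp only [fun j => fourierCoeff_mul (h1 j), fun j => fourierCoeff_mul (h2 j),
    fun j => fourierCoeff_mul (h3 j), fun j => fourierCoeff_mul (h4 j), fourierCoeff_dQ]
  simp only [← Finset.sum_sub_distrib]
  rw [Finset.sum_comm, Finset.sum_comm (s := Finset.univ (α := Fin n₂)), ← Finset.sum_add_distrib]
  refine Finset.sum_congr rfl fun k' _ => ?_
  rw [bracketCoeff, ← Finset.sum_add_distrib, Finset.mul_sum, Finset.mul_sum,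
    ← Finset.sum_sub_distrib]
  congr 1 <;> refine Finset.sum_congr rfl fun j _ => ?_ <;> ring

/-! ### Cauchy estimates -/

lemma hasDerivAt_prod_pow {n : ℕ} (p u : Fin n → ℂ) (m : Fin n → ℕ) :
    HasDerivAt (fun t : ℂ => ∏ j, (p j + t * u j) ^ m j)
      (∑ j, u j * (m j * ∏ i, p i ^ (m - Pi.single j 1 : Fin n → ℕ) i)) 0 := by
  have h : ∀ j ∈ (Finset.univ : Finset (Fin n)),
      HasDerivAt (fun t : ℂ => (p j + t * u j) ^ m j) (m j * p j ^ (m j - 1) * u j) 0 := by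
    intro j _
    have h0 : HasDerivAt (fun t : ℂ => p j + t * u j) (u j) 0 := by
      simpa using ((hasDerivAt_id (0 : ℂ)).mul_const (u j)).const_add (p j)
    simpa using h0.fun_pow (m j)
  refine (HasDerivAt.fun_finsetProd h).congr_deriv ?_
  refine Finset.sum_congr rfl fun j _ => ?_
  have h1 := Finset.mul_prod_erase Finset.univ (fun i => p i ^ (m - Pi.single j 1 : Fin n → ℕ) i)
    (Finset.mem_univ j)
  have : ∏ i ∈ Finset.univ.erase j, p i ^ (m - Pi.single j 1 : Fin n → ℕ) i =
      ∏ i ∈ Finset.univ.erase j, (p i + 0 * u i) ^ m i := by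
    refine Finset.prod_congr rfl fun i hi => ?_
    simp [Finset.ne_of_mem_erase hi]
  rw [← h1, this, smul_eq_mul]
  simp
  ring

/-- The derivative of a Fourier coefficient in a direction `(u, v, y)`. -/
def dirDeriv (g : TrigPoly n₁ n₂) (k : Fin n₁ → ℤ) (p : Fin n₁ → ℂ) (z w : Fin n₂ → ℂ)
    (u : Fin n₁ → ℂ) (v y : Fin n₂ → ℂ) : ℂ :=
  ∑ j, u j * fourierCoeff (dP j g) k p z w + (∑ j, v j * fourierCoeff (dZ j g) k p z w +
    ∑ j, y j * fourierCoeff (dW j g) k p z w)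

lemma hasDerivAt_fourierCoeff (g : TrigPoly n₁ n₂) (k : Fin n₁ → ℤ) (p : Fin n₁ → ℂ)
    (z w : Fin n₂ → ℂ) (u : Fin n₁ → ℂ) (v y : Fin n₂ → ℂ) :
    HasDerivAt (fun t : ℂ => fourierCoeff g k (fun j => p j + t * u j) (fun j => z j + t * v j)
      (fun j => w j + t * y j)) (dirDeriv g k p z w u v y) 0 := by
  induction g using AddMonoidAlgebra.induction_linear with
  | zero =>
    simp only [fourierCoeff_zero, dirDeriv, dP_eq, dZ_eq, dW_eq, map_zero, mul_zero,
      Finset.sum_const_zero, add_zero]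
    exact hasDerivAt_const _ _
  | add f g hf hg =>
    simp only [fourierCoeff_add]
    refine (hf.add hg).congr_deriv ?_
    simp only [dirDeriv, dP_eq, dZ_eq, dW_eq, map_add, fourierCoeff_add, mul_add,
      Finset.sum_add_distrib]
    ring
  | single a c =>
    simp only [fourierCoeff_single]
    by_cases hk : a.k = k
    · have h := (((hasDerivAt_prod_pow p u a.m).mul (hasDerivAt_prod_pow z v a.l)).mul
        (hasDerivAt_prod_pow w y a.lbar)).const_mul c
      simp only [if_pos hk]
      refine h.congr_deriv ?_
      have hk' : ∀ (m : Fin n₁ → ℕ) (l lb : Fin n₂ → ℕ), Idx.k (m, l, lb, a.k) = k := fun _ _ _ => hk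
      simp only [dirDeriv, dP_single, dZ_single, dW_single, fourierCoeff_single, hk', if_true,
        Idx.eval, zero_mul, add_zero, Pi.mul_apply]
      rw [add_mul, mul_add, mul_add, add_assoc]
      simp only [Finset.sum_mul, Finset.mul_sum]
      congr 1
      · exact Finset.sum_congr rfl fun j _ => by ring
      congr 1
      · exact Finset.sum_congr rfl fun j _ => by ring
      · exact Finset.sum_congr rfl fun j _ => by ring
    · have hk' : ∀ (m : Fin n₁ → ℕ) (l lb : Fin n₂ → ℕ), ¬ Idx.k (m, l, lb, a.k) = k := fun _ _ _ => hk
      simp only [dirDeriv, dP_single, dZ_single, dW_single, fourierCoeff_single, hk',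
        if_false, mul_zero, Finset.sum_const_zero, add_zero]
      exact hasDerivAt_const _ _

lemma differentiable_fourierCoeff (g : TrigPoly n₁ n₂) (k : Fin n₁ → ℤ) (p : Fin n₁ → ℂ)
    (z w : Fin n₂ → ℂ) (u : Fin n₁ → ℂ) (v y : Fin n₂ → ℂ) :
    Differentiable ℂ (fun t : ℂ => fourierCoeff g k (fun j => p j + t * u j)
      (fun j => z j + t * v j) (fun j => w j + t * y j)) := by
  simp only [fourierCoeff_eq_sum, Idx.eval]
  fun_prop

/-- The bound holds only in the open disc, so Cauchy's estimate is used on circles of radius c/‖f'‖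
< T, for all c below ‖f'‖ T. -/
lemma norm_deriv_mul_le_of_ball {f : ℂ → ℂ} (hf : Differentiable ℂ f) {f' : ℂ}
    (hf' : HasDerivAt f f' 0) {T S : ℝ} (hT : 0 < T) (hS : ∀ t, ‖t‖ < T → ‖f t‖ ≤ S) :
    ‖f'‖ * T ≤ S := by
  refine le_of_forall_lt_imp_le_of_dense fun c hc => ?_
  have hS0 : 0 ≤ S := (norm_nonneg _).trans (hS 0 (by simpa using hT))
  by_cases hc0 : c ≤ 0
  · exact hc0.trans hS0
  push Not at hc0
  have hf0 : 0 < ‖f'‖ := by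
    by_contra! h
    have : ‖f'‖ = 0 := le_antisymm h (norm_nonneg _)
    rw [this, zero_mul] at hc
    linarith
  have hT' : 0 < c / ‖f'‖ := div_pos hc0 hf0
  have hlt : c / ‖f'‖ < T := by rwa [div_lt_iff₀ hf0, mul_comm]
  have := Complex.norm_deriv_le_of_forall_mem_sphere_norm_le hT' hf.diffContOnCl (c := 0) (C := S)
    fun t ht => hS t (by rw [mem_sphere_zero_iff_norm] at ht; rw [ht]; exact hlt)
  rw [hf'.deriv, le_div_iff₀ hT', mul_div_cancel₀ _ hf0.ne'] at this
  exact this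

/-- The Cauchy estimate for directional derivatives. -/
lemma norm_dirDeriv_le {g : TrigPoly n₁ n₂} {k : Fin n₁ → ℤ} {a b a' b' A S : ℝ}
    {p : Fin n₁ → ℂ} {z w : Fin n₂ → ℂ} {u : Fin n₁ → ℂ} {v y : Fin n₂ → ℂ}
    (hp : ∀ j, ‖p j‖ < a) (hz : ∀ j, ‖z j‖ < b) (hw : ∀ j, ‖w j‖ < b) (hA : 0 ≤ A)
    (hu : ∀ j, ‖u j‖ ≤ A * (a' - a)) (hv : ∀ j, ‖v j‖ ≤ A * (b' - b))
    (hy : ∀ j, ‖y j‖ ≤ A * (b' - b))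
    (hS : ∀ p z w, (∀ j, ‖p j‖ < a') → (∀ j, ‖z j‖ < b') → (∀ j, ‖w j‖ < b') →
      ‖fourierCoeff g k p z w‖ ≤ S) : ‖dirDeriv g k p z w u v y‖ ≤ A * S := by
  rcases hA.eq_or_lt with rfl | hA
  · have hu0 : ∀ j, u j = 0 := fun j => norm_le_zero_iff.1 (by simpa using hu j)
    have hv0 : ∀ j, v j = 0 := fun j => norm_le_zero_iff.1 (by simpa using hv j)
    have hy0 : ∀ j, y j = 0 := fun j => norm_le_zero_iff.1 (by simpa using hy j)
    simp [dirDeriv, hu0, hv0, hy0]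
  -- A complex displacement t with ‖t‖ < 1/A along the direction stays inside the larger polydisc.
  have key : ∀ {n : ℕ} {x d : Fin n → ℂ} {c c' : ℝ}, (∀ j, ‖x j‖ < c) →
      (∀ j, ‖d j‖ ≤ A * (c' - c)) → ∀ t : ℂ, ‖t‖ < 1 / A → ∀ j, ‖x j + t * d j‖ < c' := by
    intro n x d c c' hx hd t ht j
    have h1 : ‖t‖ * ‖d j‖ ≤ 1 / A * (A * (c' - c)) :=
      mul_le_mul ht.le (hd j) (norm_nonneg _) (by positivity)
    rw [← mul_assoc, one_div_mul_cancel hA.ne', one_mul] at h1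
    calc ‖x j + t * d j‖ ≤ ‖x j‖ + ‖t‖ * ‖d j‖ := by
          rw [← norm_mul]; exact norm_add_le _ _
      _ < c + (c' - c) := add_lt_add_of_lt_of_le (hx j) h1
      _ = c' := by ring
  have := norm_deriv_mul_le_of_ball (differentiable_fourierCoeff g k p z w u v y)
    (hasDerivAt_fourierCoeff g k p z w u v y) (T := 1 / A) (S := S) (by positivity)
    fun t ht => hS _ _ _ (key hp hu t ht) (key hz hv t ht) (key hw hy t ht)
  rw [mul_one_div, div_le_iff₀ hA] at this
  linarith

/-! ### Calculus of the weighted norms for families depending on a parameter. -/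

/-- The supremum of the `k`-th Fourier coefficient over a polydisc and over the parameters. -/
def harmonicNorm {Λ : Type*} (W : Set Λ) (ρ R : ℝ) (g : Λ → TrigPoly n₁ n₂) (k : Fin n₁ → ℤ) :
    ENNReal :=
  ⨆ ω ∈ W, ⨆ (p : Fin n₁ → ℂ) (_ : ∀ j, ‖p j‖ < ρ) (z : Fin n₂ → ℂ) (_ : ∀ j, ‖z j‖ < R)
    (w : Fin n₂ → ℂ) (_ : ∀ j, ‖w j‖ < R), ENNReal.ofReal ‖fourierCoeff (g ω) k p z w‖

lemma anorm_eq_tsum {Λ : Type*} (W : Set Λ) (ρ σ R α : ℝ) (g : Λ → TrigPoly n₁ n₂) :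
    anorm W ρ σ R α g = ∑' k, harmonicNorm W (α * ρ) (α * R) g k *
      ENNReal.ofReal (Real.exp ((l1 k : ℝ) * (α * σ))) := rfl

section

variable {Λ : Type*} {W : Set Λ} {ρ σ R α : ℝ}

lemma le_harmonicNorm {g : Λ → TrigPoly n₁ n₂} {ω : Λ} (hω : ω ∈ W) {p : Fin n₁ → ℂ}
    {z w : Fin n₂ → ℂ} (hp : ∀ j, ‖p j‖ < ρ) (hz : ∀ j, ‖z j‖ < R) (hw : ∀ j, ‖w j‖ < R)
    (k : Fin n₁ → ℤ) :
    ENNReal.ofReal ‖fourierCoeff (g ω) k p z w‖ ≤ harmonicNorm W ρ R g k :=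
  le_iSup₂_of_le ω hω <| le_iSup₂_of_le p hp <| le_iSup₂_of_le z hz <|
    le_iSup₂_of_le w hw le_rfl

lemma harmonicNorm_le {g : Λ → TrigPoly n₁ n₂} {k : Fin n₁ → ℤ} {B : ENNReal}
    (h : ∀ ω ∈ W, ∀ p z w, (∀ j, ‖p j‖ < ρ) → (∀ j, ‖z j‖ < R) → (∀ j, ‖w j‖ < R) →
      ENNReal.ofReal ‖fourierCoeff (g ω) k p z w‖ ≤ B) : harmonicNorm W ρ R g k ≤ B :=
  iSup₂_le fun ω hω => iSup₂_le fun p hp => iSup₂_le fun z hz => iSup₂_le fun w hw =>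
    h ω hω p z w hp hz hw

/-- `‖g‖_α ≤ B`. -/
def NormLE (W : Set Λ) (ρ σ R α : ℝ) (g : Λ → TrigPoly n₁ n₂) (B : ℝ) : Prop :=
  anorm W ρ σ R α g ≤ ENNReal.ofReal B

lemma NormLE.mono_right {g : Λ → TrigPoly n₁ n₂} {B C : ℝ} (h : NormLE W ρ σ R α g B)
    (hBC : B ≤ C) : NormLE W ρ σ R α g C := h.trans (ENNReal.ofReal_le_ofReal hBC)

lemma anorm_congr {f g : Λ → TrigPoly n₁ n₂} (h : ∀ ω ∈ W, f ω = g ω) :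
    anorm W ρ σ R α f = anorm W ρ σ R α g := by
  have key : ∀ {f g : Λ → TrigPoly n₁ n₂}, (∀ ω ∈ W, f ω = g ω) → ∀ k,
      harmonicNorm W (α * ρ) (α * R) f k ≤ harmonicNorm W (α * ρ) (α * R) g k :=
    fun h k => harmonicNorm_le fun ω hω p z w hp hz hw => by
      rw [h ω hω]; exact le_harmonicNorm hω hp hz hw k
  rw [anorm_eq_tsum, anorm_eq_tsum]
  refine tsum_congr fun k => ?_
  rw [le_antisymm (key h k) (key (fun ω hω => (h ω hω).symm) k)]

lemma NormLE.congr {f g : Λ → TrigPoly n₁ n₂} {B : ℝ} (hf : NormLE W ρ σ R α f B)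
    (h : ∀ ω ∈ W, g ω = f ω) : NormLE W ρ σ R α g B := (anorm_congr h).trans_le hf

/-- Finiteness allows the supremum to be used as a real constant in pointwise estimates. -/
lemma harmonicNorm_ne_top {g : Λ → TrigPoly n₁ n₂} {B : ℝ} (hg : NormLE W ρ σ R α g B)
    (k : Fin n₁ → ℤ) : harmonicNorm W (α * ρ) (α * R) g k ≠ ⊤ := by
  intro htop
  have h1 : anorm W ρ σ R α g = ⊤ := by
    rw [anorm_eq_tsum]
    refine ENNReal.tsum_eq_top_of_eq_top ⟨k, ?_⟩
    rw [htop, ENNReal.top_mul]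
    simp [Real.exp_pos]
  rw [NormLE, h1] at hg
  exact ENNReal.ofReal_ne_top (top_le_iff.1 hg)

/-- A termwise estimate of the Fourier coefficients gives an estimate of the norm. -/
lemma anorm_le_of_coeff {f g : Λ → TrigPoly n₁ n₂} {c : ℝ} (hc : 0 ≤ c)
    (h : ∀ k (S : ℝ), (∀ ω ∈ W, ∀ p z w, (∀ j, ‖p j‖ < α * ρ) → (∀ j, ‖z j‖ < α * R) →
        (∀ j, ‖w j‖ < α * R) → ‖fourierCoeff (g ω) k p z w‖ ≤ S) →
      ∀ ω ∈ W, ∀ p z w, (∀ j, ‖p j‖ < α * ρ) → (∀ j, ‖z j‖ < α * R) →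
        (∀ j, ‖w j‖ < α * R) → ‖fourierCoeff (f ω) k p z w‖ ≤ c * S) {B : ℝ}
    (hg : NormLE W ρ σ R α g B) : NormLE W ρ σ R α f (c * B) := by
  rw [NormLE, ENNReal.ofReal_mul hc]
  refine le_trans ?_ (mul_le_mul' le_rfl hg)
  rw [anorm_eq_tsum, anorm_eq_tsum, ← ENNReal.tsum_mul_left]
  refine ENNReal.tsum_le_tsum fun k => ?_
  rw [← mul_assoc (ENNReal.ofReal c)]
  refine mul_le_mul' ?_ le_rfl
  have hfin := harmonicNorm_ne_top hg k
  refine harmonicNorm_le fun ω hω p z w hp hz hw => ?_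
  have := h k (harmonicNorm W (α * ρ) (α * R) g k).toReal (fun ω hω p z w hp hz hw => by
    rw [← ENNReal.ofReal_le_iff_le_toReal hfin]
    exact le_harmonicNorm hω hp hz hw k) ω hω p z w hp hz hw
  calc _ ≤ ENNReal.ofReal (c * (harmonicNorm W (α * ρ) (α * R) g k).toReal) :=
        ENNReal.ofReal_le_ofReal this
    _ = _ := by rw [ENNReal.ofReal_mul hc, ENNReal.ofReal_toReal hfin]

lemma NormLE.const_smul {g : Λ → TrigPoly n₁ n₂} {B : ℝ} (hg : NormLE W ρ σ R α g B) (c : ℂ) :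
    NormLE W ρ σ R α (fun ω => c • g ω) (‖c‖ * B) := by
  refine anorm_le_of_coeff (norm_nonneg c) (fun k S hS ω hω p z w hp hz hw => ?_) hg
  rw [fourierCoeff_smul, norm_mul]
  exact mul_le_mul_of_nonneg_left (hS ω hω p z w hp hz hw) (norm_nonneg c)

lemma NormLE.zero {B : ℝ} : NormLE W ρ σ R α (fun _ => (0 : TrigPoly n₁ n₂)) B := by
  rw [NormLE, anorm_eq_tsum]
  have : ∀ k, harmonicNorm W (α * ρ) (α * R) (fun _ => (0 : TrigPoly n₁ n₂)) k = 0 := fun k =>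
    le_antisymm (harmonicNorm_le fun ω hω p z w _ _ _ => by simp [fourierCoeff_zero]) zero_le
  simp [this]

lemma anorm_add_le (f g : Λ → TrigPoly n₁ n₂) : anorm W ρ σ R α (fun ω => f ω + g ω) ≤
    anorm W ρ σ R α f + anorm W ρ σ R α g := by
  rw [anorm_eq_tsum, anorm_eq_tsum, anorm_eq_tsum, ← ENNReal.tsum_add]
  refine ENNReal.tsum_le_tsum fun k => ?_
  rw [← add_mul]
  refine mul_le_mul' ?_ le_rfl
  refine harmonicNorm_le fun ω hω p z w hp hz hw => ?_
  rw [fourierCoeff_add]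
  refine (ENNReal.ofReal_le_ofReal (norm_add_le _ _)).trans ?_
  rw [ENNReal.ofReal_add (norm_nonneg _) (norm_nonneg _)]
  exact add_le_add (le_harmonicNorm hω hp hz hw k) (le_harmonicNorm hω hp hz hw k)

lemma NormLE.add {f g : Λ → TrigPoly n₁ n₂} {B C : ℝ} (hf : NormLE W ρ σ R α f B)
    (hg : NormLE W ρ σ R α g C) (hB : 0 ≤ B) (hC : 0 ≤ C) :
    NormLE W ρ σ R α (fun ω => f ω + g ω) (B + C) := by
  rw [NormLE, ENNReal.ofReal_add hB hC]
  exact (anorm_add_le f g).trans (add_le_add hf hg)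

lemma NormLE.sum {ι : Type*} {s : Finset ι} {f : ι → Λ → TrigPoly n₁ n₂} {B : ι → ℝ}
    (hf : ∀ i ∈ s, NormLE W ρ σ R α (f i) (B i)) (hB : ∀ i ∈ s, 0 ≤ B i) :
    NormLE W ρ σ R α (fun ω => ∑ i ∈ s, f i ω) (∑ i ∈ s, B i) := by
  classical
  induction s using Finset.induction_on with
  | empty => simpa using NormLE.zero
  | insert a s ha ih =>
    simp only [Finset.sum_insert ha]
    exact (hf a (Finset.mem_insert_self a s)).add
      (ih (fun i hi => hf i (Finset.mem_insert_of_mem hi))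
        fun i hi => hB i (Finset.mem_insert_of_mem hi)) (hB a (Finset.mem_insert_self a s))
      (Finset.sum_nonneg fun i hi => hB i (Finset.mem_insert_of_mem hi))

lemma NormLE.mono_left {g : Λ → TrigPoly n₁ n₂} {B α' : ℝ} (hg : NormLE W ρ σ R α g B)
    (h : α' ≤ α) (hρ : 0 ≤ ρ) (hσ : 0 ≤ σ) (hR : 0 ≤ R) : NormLE W ρ σ R α' g B := by
  refine le_trans ?_ hg
  rw [anorm_eq_tsum, anorm_eq_tsum]
  refine ENNReal.tsum_le_tsum fun k => mul_le_mul' ?_ ?_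
  · exact harmonicNorm_le fun ω hω p z w hp hz hw => le_harmonicNorm hω
      (fun j => (hp j).trans_le (by gcongr)) (fun j => (hz j).trans_le (by gcongr))
      (fun j => (hw j).trans_le (by gcongr)) k
  · refine ENNReal.ofReal_le_ofReal (Real.exp_le_exp.2 ?_)
    have : (0 : ℝ) ≤ l1 k := by exact_mod_cast l1_nonneg k
    gcongr

end

lemma abs_le_l1 {n : ℕ} (k : Fin n → ℤ) (j : Fin n) : ‖(k j : ℂ)‖ ≤ l1 k := by
  rw [Complex.norm_intCast]
  have : |k j| ≤ l1 k := Finset.single_le_sum (f := fun i => |k i|)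
    (fun i _ => abs_nonneg _) (Finset.mem_univ j)
  exact_mod_cast this

/-- The estimate of the Poisson bracket of two harmonics. -/
lemma norm_bracketCoeff_le {χ g : TrigPoly n₁ n₂} {k' k'' : Fin n₁ → ℤ} {ρ R α α' α'' X Y : ℝ}
    (hρ : 0 < ρ) (hR : 0 < R) (h : α'' < α) (h' : α'' < α')
    (hX : ∀ p z w, (∀ j, ‖p j‖ < α * ρ) → (∀ j, ‖z j‖ < α * R) → (∀ j, ‖w j‖ < α * R) →
      ‖fourierCoeff χ k' p z w‖ ≤ X)
    (hY : ∀ p z w, (∀ j, ‖p j‖ < α' * ρ) → (∀ j, ‖z j‖ < α' * R) → (∀ j, ‖w j‖ < α' * R) →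
      ‖fourierCoeff g k'' p z w‖ ≤ Y) {p : Fin n₁ → ℂ} {z w : Fin n₂ → ℂ}
    (hp : ∀ j, ‖p j‖ < α'' * ρ) (hz : ∀ j, ‖z j‖ < α'' * R) (hw : ∀ j, ‖w j‖ < α'' * R) :
    ‖bracketCoeff χ g k' k'' p z w‖ ≤
      (l1 k' / ((α' - α'') * ρ) + l1 k'' / ((α - α'') * ρ) +
        1 / ((α - α'') * (α' - α'') * R ^ 2)) * (X * Y) := by
  have hD : 0 < α - α'' := sub_pos.2 h
  have hd : 0 < α' - α'' := sub_pos.2 h'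
  have hl : ∀ k : Fin n₁ → ℤ, (0 : ℝ) ≤ l1 k := fun k => by exact_mod_cast l1_nonneg k
  have lt1 : ∀ {c β β' : ℝ}, 0 < c → β < β' → ∀ {n : ℕ} {x : Fin n → ℂ}, (∀ j, ‖x j‖ < β * c) →
      ∀ j, ‖x j‖ < β' * c := fun hc hβ _ _ hx j => (hx j).trans (by gcongr)
  have hX1 := hX p z w (lt1 hρ h hp) (lt1 hR h hz) (lt1 hR h hw)
  have hY1 := hY p z w (lt1 hρ h' hp) (lt1 hR h' hz) (lt1 hR h' hw)
  have hX0 : 0 ≤ X := (norm_nonneg _).trans hX1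
  have hY0 : 0 ≤ Y := (norm_nonneg _).trans hY1
  -- The whole sum is the derivative of g along k', whose components are at most |k'|; no factor n₁
  -- appears.
  have e1 : ‖∑ j, (k' j : ℂ) * fourierCoeff (dP j g) k'' p z w‖ ≤
      l1 k' / ((α' - α'') * ρ) * Y := by
    have := norm_dirDeriv_le (A := l1 k' / ((α' - α'') * ρ)) (u := fun j => (k' j : ℂ)) (v := 0)
      (y := 0) hp hz hw (by have := hl k'; positivity)
      (fun j => by
        rw [← sub_mul, div_mul_cancel₀ _ (by positivity)]
        exact abs_le_l1 k' j)
      (fun j => by rw [← sub_mul]; have := hl k'; simp; positivity)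
      (fun j => by rw [← sub_mul]; have := hl k'; simp; positivity) hY
    simpa [dirDeriv] using this
  have e2 : ‖∑ j, (k'' j : ℂ) * fourierCoeff (dP j χ) k' p z w‖ ≤
      l1 k'' / ((α - α'') * ρ) * X := by
    have := norm_dirDeriv_le (A := l1 k'' / ((α - α'') * ρ)) (u := fun j => (k'' j : ℂ)) (v := 0)
      (y := 0) hp hz hw (by have := hl k''; positivity)
      (fun j => by
        rw [← sub_mul, div_mul_cancel₀ _ (by positivity)]
        exact abs_le_l1 k'' j)
      (fun j => by rw [← sub_mul]; have := hl k''; simp; positivity)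
      (fun j => by rw [← sub_mul]; have := hl k''; simp; positivity) hX
    simpa [dirDeriv] using this
  have hs : ∀ (i j : Fin n₂), ‖(Pi.single i 1 : Fin n₂ → ℂ) j‖ ≤ 1 := fun i j => by
    by_cases hij : j = i
    · subst hij; simp
    · simp [hij]
  have e3 : ∀ j, ‖fourierCoeff (dW j χ) k' p z w‖ ≤ 1 / ((α - α'') * R) * X := fun i => by
    have := norm_dirDeriv_le (A := 1 / ((α - α'') * R)) (u := 0) (v := 0)
      (y := Pi.single i 1) hp hz hw (by positivity)
      (fun j => by rw [← sub_mul]; simp; positivity)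
      (fun j => by rw [← sub_mul, one_div_mul_cancel (by positivity)]; simp)
      (fun j => by rw [← sub_mul, one_div_mul_cancel (by positivity)]; exact hs i j) hX
    simpa [dirDeriv, Pi.single_apply] using this
  have e4 : ∀ j, ‖fourierCoeff (dZ j χ) k' p z w‖ ≤ 1 / ((α - α'') * R) * X := fun i => by
    have := norm_dirDeriv_le (A := 1 / ((α - α'') * R)) (u := 0) (v := Pi.single i 1)
      (y := 0) hp hz hw (by positivity)
      (fun j => by rw [← sub_mul]; simp; positivity)
      (fun j => by rw [← sub_mul, one_div_mul_cancel (by positivity)]; exact hs i j)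
      (fun j => by rw [← sub_mul, one_div_mul_cancel (by positivity)]; simp) hX
    simpa [dirDeriv, Pi.single_apply] using this
  -- This is the derivative of g along (∂_w χ, -∂_z χ), whose components are already bounded by
  -- Cauchy's estimate for χ; no factor n₂ appears.
  have e5 : ‖∑ j, fourierCoeff (dW j χ) k' p z w * fourierCoeff (dZ j g) k'' p z w +
      ∑ j, (-fourierCoeff (dZ j χ) k' p z w) * fourierCoeff (dW j g) k'' p z w‖ ≤
      X / ((α - α'') * (α' - α'') * R ^ 2) * Y := by
    have hA : X / ((α - α'') * (α' - α'') * R ^ 2) * (α' * R - α'' * R) =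
        1 / ((α - α'') * R) * X := by field_simp
    have := norm_dirDeriv_le (A := X / ((α - α'') * (α' - α'') * R ^ 2)) (u := 0)
      (v := fun j => fourierCoeff (dW j χ) k' p z w)
      (y := fun j => -fourierCoeff (dZ j χ) k' p z w) hp hz hw (by positivity)
      (fun j => by rw [← sub_mul]; simp; positivity)
      (fun j => by rw [hA]; exact e3 j) (fun j => by rw [hA, norm_neg]; exact e4 j) hY
    simpa [dirDeriv] using this
  rw [bracketCoeff]
  refine (norm_add_le _ _).trans ((add_le_add (norm_sub_le _ _) e5).trans ?_)
  rw [norm_mul, norm_mul, norm_mul, norm_mul, Complex.norm_I, one_mul, one_mul]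
  have f1 := mul_le_mul hX1 e1 (norm_nonneg _) hX0
  have f2 := mul_le_mul hY1 e2 (norm_nonneg _) hY0
  refine (add_le_add_left (add_le_add f1 f2) _).trans (le_of_eq ?_)
  ring

/-- The function x e^{-xD} has maximum 1/(eD), by y ≤ e^{y-1}. -/
lemma mul_exp_le {x D : ℝ} (hD : 0 < D) (a b : ℝ) (hab : x * D + a ≤ b) :
    x * Real.exp a ≤ Real.exp b / (Real.exp 1 * D) := by
  rw [le_div_iff₀ (by positivity)]
  have h1 : x * D ≤ Real.exp (x * D - 1) := by linarith [Real.add_one_le_exp (x * D - 1)]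
  calc x * Real.exp a * (Real.exp 1 * D) = x * D * (Real.exp a * Real.exp 1) := by ring
    _ ≤ Real.exp (x * D - 1) * (Real.exp a * Real.exp 1) := by gcongr
    _ = Real.exp (x * D + a) := by rw [← Real.exp_add, ← Real.exp_add]; ring_nf
    _ ≤ Real.exp b := Real.exp_le_exp.2 hab


/-- The constant of the estimate of a single Poisson bracket. -/
def bracketConst (ρ σ R : ℝ) : ℝ := 2 / (Real.exp 1 * ρ * σ) + 1 / R ^ 2

/-- The factor |k'| is paid by the strip lost by χ and |k''| by the strip lost by g. Both then carry
the product of the two losses in the denominator, whence the 2 in `bracketConst`. -/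
lemma weighted_bracket_le {ρ σ R α α' α'' x y : ℝ} (hρ : 0 < ρ) (hσ : 0 < σ)
    (h0 : 0 ≤ α'') (h : α'' < α) (h' : α'' < α') (hx : 0 ≤ x) (hy : 0 ≤ y)
    (k' k'' : Fin n₁ → ℤ) :
    (l1 k' / ((α' - α'') * ρ) + l1 k'' / ((α - α'') * ρ) +
        1 / ((α - α'') * (α' - α'') * R ^ 2)) * (x * y) *
      Real.exp ((l1 (k' + k'') : ℝ) * (α'' * σ)) ≤
    bracketConst ρ σ R / ((α - α'') * (α' - α'')) * (x * Real.exp (l1 k' * (α * σ))) *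
      (y * Real.exp (l1 k'' * (α' * σ))) := by
  have hD : 0 < α - α'' := sub_pos.2 h
  have hd : 0 < α' - α'' := sub_pos.2 h'
  have hk' : (0 : ℝ) ≤ l1 k' := by exact_mod_cast l1_nonneg k'
  have hk'' : (0 : ℝ) ≤ l1 k'' := by exact_mod_cast l1_nonneg k''
  have e0 : Real.exp ((l1 (k' + k'') : ℝ) * (α'' * σ)) ≤
      Real.exp (l1 k' * (α'' * σ)) * Real.exp (l1 k'' * (α'' * σ)) := by
    rw [← Real.exp_add, ← add_mul]
    refine Real.exp_le_exp.2 ?_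
    have : (l1 (k' + k'') : ℝ) ≤ l1 k' + l1 k'' := by exact_mod_cast l1_add_le k' k''
    gcongr
  have e1 : Real.exp (l1 k' * (α'' * σ)) ≤ Real.exp (l1 k' * (α * σ)) :=
    Real.exp_le_exp.2 (by gcongr)
  have e2 : Real.exp (l1 k'' * (α'' * σ)) ≤ Real.exp (l1 k'' * (α' * σ)) :=
    Real.exp_le_exp.2 (by gcongr)
  have e3 := mul_exp_le (x := l1 k') (D := (α - α'') * σ) (by positivity) (l1 k' * (α'' * σ))
    (l1 k' * (α * σ)) (le_of_eq (by ring))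
  have e4 := mul_exp_le (x := l1 k'') (D := (α' - α'') * σ) (by positivity) (l1 k'' * (α'' * σ))
    (l1 k'' * (α' * σ)) (le_of_eq (by ring))
  have ha : 0 < Real.exp (l1 k' * (α'' * σ)) := Real.exp_pos _
  have hb : 0 < Real.exp (l1 k'' * (α'' * σ)) := Real.exp_pos _
  have hE : 0 < Real.exp (l1 k' * (α * σ)) := Real.exp_pos _
  have hF : 0 < Real.exp (l1 k'' * (α' * σ)) := Real.exp_pos _
  generalize Real.exp (l1 k' * (α'' * σ)) = a at *
  generalize Real.exp (l1 k'' * (α'' * σ)) = b at *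
  generalize Real.exp (l1 k' * (α * σ)) = E at *
  generalize Real.exp (l1 k'' * (α' * σ)) = F at *
  calc _ ≤ (l1 k' / ((α' - α'') * ρ) + l1 k'' / ((α - α'') * ρ) +
        1 / ((α - α'') * (α' - α'') * R ^ 2)) * (x * y) * (a * b) := by gcongr
    _ = x * y * (l1 k' * a * b / ((α' - α'') * ρ) + l1 k'' * b * a / ((α - α'') * ρ) +
        a * b / ((α - α'') * (α' - α'') * R ^ 2)) := by ring
    _ ≤ x * y * (E / (Real.exp 1 * ((α - α'') * σ)) * F / ((α' - α'') * ρ) +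
        F / (Real.exp 1 * ((α' - α'') * σ)) * E / ((α - α'') * ρ) +
        E * F / ((α - α'') * (α' - α'') * R ^ 2)) := by gcongr
    _ = _ := by
        rw [bracketConst]
        field_simp
        ring

/-- The estimate of the Poisson bracket. -/
lemma NormLE.lie {Λ : Type*} {W : Set Λ} {ρ σ R α α' α'' X Y : ℝ} {χ g : Λ → TrigPoly n₁ n₂}
    (hρ : 0 < ρ) (hσ : 0 < σ) (hR : 0 < R) (h0 : 0 ≤ α'') (h : α'' < α) (h' : α'' < α')
    (hX0 : 0 ≤ X) (hχ : NormLE W ρ σ R α χ X) (hg : NormLE W ρ σ R α' g Y) :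
    NormLE W ρ σ R α'' (fun ω => lie (χ ω) (g ω))
      (bracketConst ρ σ R / ((α - α'') * (α' - α'')) * X * Y) := by
  have hD : 0 < α - α'' := sub_pos.2 h
  have hd : 0 < α' - α'' := sub_pos.2 h'
  have hl : ∀ k : Fin n₁ → ℤ, (0 : ℝ) ≤ l1 k := fun k => by exact_mod_cast l1_nonneg k
  have hc : 0 ≤ bracketConst ρ σ R / ((α - α'') * (α' - α'')) := by
    have : 0 ≤ bracketConst ρ σ R := by rw [bracketConst]; positivity
    positivity
  set x := fun k => (harmonicNorm W (α * ρ) (α * R) χ k).toReal with hx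
  set y := fun k => (harmonicNorm W (α' * ρ) (α' * R) g k).toReal with hy
  have hx0 : ∀ k, 0 ≤ x k := fun k => ENNReal.toReal_nonneg
  have hy0 : ∀ k, 0 ≤ y k := fun k => ENNReal.toReal_nonneg
  have key : ∀ k, harmonicNorm W (α'' * ρ) (α'' * R) (fun ω => EllipticTori.lie (χ ω) (g ω)) k ≤
      ∑' k', ENNReal.ofReal ((l1 k' / ((α' - α'') * ρ) + l1 (k - k') / ((α - α'') * ρ) +
        1 / ((α - α'') * (α' - α'') * R ^ 2)) * (x k' * y (k - k'))) := by
    refine fun k => harmonicNorm_le fun ω hω p z w hp hz hw => ?_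
    rw [fourierCoeff_lie]
    refine le_trans ?_ (ENNReal.sum_le_tsum ((χ ω).coeff.support.image fun a => a.k))
    rw [← ENNReal.ofReal_sum_of_nonneg fun k' _ => by
      have := hl k'; have := hl (k - k'); have := hx0 k'; have := hy0 (k - k'); positivity]
    refine ENNReal.ofReal_le_ofReal ((norm_sum_le _ _).trans (Finset.sum_le_sum fun k' _ => ?_))
    refine norm_bracketCoeff_le hρ hR h h' (fun p z w hp hz hw => ?_)
      (fun p z w hp hz hw => ?_) hp hz hw
    · rw [← ENNReal.ofReal_le_iff_le_toReal (harmonicNorm_ne_top hχ _)]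
      exact le_harmonicNorm hω hp hz hw _
    · rw [← ENNReal.ofReal_le_iff_le_toReal (harmonicNorm_ne_top hg _)]
      exact le_harmonicNorm hω hp hz hw _
  rw [NormLE, ENNReal.ofReal_mul (by positivity), ENNReal.ofReal_mul hc]
  refine le_trans ?_ (mul_le_mul' (mul_le_mul' le_rfl hχ) hg)
  rw [anorm_eq_tsum, anorm_eq_tsum, anorm_eq_tsum]
  set G := fun k => harmonicNorm W (α' * ρ) (α' * R) g k *
      ENNReal.ofReal (Real.exp ((l1 k : ℝ) * (α' * σ))) with hG
  calc _ ≤ ∑' k, ∑' k', ENNReal.ofReal (bracketConst ρ σ R / ((α - α'') * (α' - α''))) *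
        (harmonicNorm W (α * ρ) (α * R) χ k' *
          ENNReal.ofReal (Real.exp ((l1 k' : ℝ) * (α * σ)))) * G (k - k') := by
        refine ENNReal.tsum_le_tsum fun k => (mul_le_mul' (key k) le_rfl).trans ?_
        rw [← ENNReal.tsum_mul_right]
        refine ENNReal.tsum_le_tsum fun k' => ?_
        have h1 := weighted_bracket_le (R := R) hρ hσ h0 h h' (hx0 k') (hy0 (k - k')) k' (k - k')
        rw [add_sub_cancel] at h1
        rw [← ENNReal.ofReal_mul (by
          have := hl k'; have := hl (k - k'); have := hx0 k'; have := hy0 (k - k'); positivity)]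
        refine (ENNReal.ofReal_le_ofReal h1).trans_eq ?_
        rw [ENNReal.ofReal_mul (mul_nonneg hc (mul_nonneg (hx0 k') (Real.exp_pos _).le)),
          ENNReal.ofReal_mul hc, ENNReal.ofReal_mul (hx0 k'), ENNReal.ofReal_mul (hy0 (k - k')),
          ENNReal.ofReal_toReal (harmonicNorm_ne_top hχ _),
          ENNReal.ofReal_toReal (harmonicNorm_ne_top hg _)]
    _ = ∑' k', ∑' k, ENNReal.ofReal (bracketConst ρ σ R / ((α - α'') * (α' - α''))) *
        (harmonicNorm W (α * ρ) (α * R) χ k' *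
          ENNReal.ofReal (Real.exp ((l1 k' : ℝ) * (α * σ)))) * G (k - k') := ENNReal.tsum_comm
    _ = _ := by
        simp only [ENNReal.tsum_mul_left]
        -- As in Young's inequality for convolutions, translation invariance separates the double
        -- sum into a product.
        have : ∀ k', ∑' k, G (k - k') = ∑' k, G k := fun k' => (Equiv.subRight k').tsum_eq G
        simp only [this, ENNReal.tsum_mul_right, ENNReal.tsum_mul_left]

lemma bracketConst_nonneg {ρ σ R : ℝ} (hρ : 0 < ρ) (hσ : 0 < σ) : 0 ≤ bracketConst ρ σ R := by
  rw [bracketConst]; positivity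

lemma lieConst_eq {ρ σ R : ℝ} (hρ : 0 < ρ) (hσ : 0 < σ) (hR : 0 < R) :
    lieConst ρ σ R = bracketConst ρ σ R * Real.exp 1 ^ 2 := by
  rw [bracketConst, lieConst]
  field_simp

lemma pow_div_factorial_le_exp (j : ℕ) : (j : ℝ) ^ j / (j.factorial : ℝ) ≤ Real.exp 1 ^ j := by
  rw [← Real.exp_nat_mul, mul_one]
  exact Real.pow_div_factorial_le_exp _ (Nat.cast_nonneg j) j

/-- The domain of the iterates shrinks by δ/j each time, while χ is always estimated on the original
domain. At the (i+1)-st bracket the loss for χ is therefore (i+1)δ/j, and these factors build the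
factorial in the denominator. -/
lemma NormLE.lie_iterate_step {Λ : Type*} {W : Set Λ} {ρ σ R α δ X Y : ℝ}
    {χ g : Λ → TrigPoly n₁ n₂} (hρ : 0 < ρ) (hσ : 0 < σ) (hR : 0 < R) (hδ : 0 < δ) (h0 : δ ≤ α)
    (hX0 : 0 ≤ X) (hχ : NormLE W ρ σ R α χ X) (hg : NormLE W ρ σ R α g Y) {j : ℕ} (hj : 0 < j)
    (i : ℕ) (hi : i ≤ j) :
    NormLE W ρ σ R (α - i * (δ / j)) (fun ω => (EllipticTori.lie (χ ω))^[i] (g ω))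
      ((bracketConst ρ σ R * X * (j / δ) ^ 2) ^ i / i.factorial * Y) := by
  have hj' : (0 : ℝ) < j := by exact_mod_cast hj
  induction i with
  | zero => simpa using hg
  | succ i ih =>
    have hs : ((i + 1 : ℕ) : ℝ) ≤ j := by exact_mod_cast hi
    have h1 : ((i + 1 : ℕ) : ℝ) * (δ / j) ≤ δ := by
      rw [mul_div_assoc', div_le_iff₀ hj', mul_comm]
      gcongr
    have h2 : 0 < δ / j := by positivity
    push_cast at h1
    have := NormLE.lie (α'' := α - ((i + 1 : ℕ) : ℝ) * (δ / j)) hρ hσ hR (by push_cast; linarith)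
      (by push_cast; nlinarith) (by push_cast; linarith) hX0 hχ (ih (by omega))
    simp only [Function.iterate_succ_apply']
    refine this.mono_right (le_of_eq ?_)
    rw [Nat.factorial_succ]
    push_cast
    have h3 : α - (α - (i + 1) * (δ / j)) = (i + 1) * δ / j := by ring
    have h4 : α - i * (δ / j) - (α - (i + 1) * (δ / j)) = δ / j := by ring
    rw [h3, h4, pow_succ (bracketConst ρ σ R * X * (j / δ) ^ 2)]
    generalize (bracketConst ρ σ R * X * (j / δ) ^ 2) ^ i = T
    field_simp

/-- The estimate of the terms of a Lie series. -/
lemma NormLE.lie_iterate {Λ : Type*} {W : Set Λ} {ρ σ R α δ X Y : ℝ}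
    {χ g : Λ → TrigPoly n₁ n₂} (hρ : 0 < ρ) (hσ : 0 < σ) (hR : 0 < R) (hδ : 0 < δ) (h0 : δ ≤ α)
    (hX0 : 0 ≤ X) (hY0 : 0 ≤ Y) (hχ : NormLE W ρ σ R α χ X) (hg : NormLE W ρ σ R α g Y) (j : ℕ) :
    NormLE W ρ σ R (α - δ)
      (fun ω => ((1 : ℂ) / (j.factorial : ℂ)) • (EllipticTori.lie (χ ω))^[j] (g ω))
      ((lieConst ρ σ R * (1 / δ ^ 2) * X) ^ j * Y) := by
  rcases j.eq_zero_or_pos with rfl | hj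
  · simpa using hg.mono_left (by linarith) hρ.le hσ.le hR.le
  have hj' : (0 : ℝ) < j := by exact_mod_cast hj
  have h1 := (NormLE.lie_iterate_step hρ hσ hR hδ h0 hX0 hχ hg hj j le_rfl).const_smul
    ((1 : ℂ) / (j.factorial : ℂ))
  have h2 : (j : ℝ) * (δ / j) = δ := by field_simp
  rw [h2] at h1
  refine h1.mono_right ?_
  rw [norm_div, norm_one, Complex.norm_natCast, lieConst_eq hρ hσ hR]
  have hb := bracketConst_nonneg (R := R) hρ hσ
  -- One factorial comes from the nested domains and the other from the exponential series; together
  -- they turn j^{2j} into e^{2j}.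
  calc _ = (bracketConst ρ σ R * (1 / δ ^ 2) * X) ^ j * ((j : ℝ) ^ j / (j.factorial : ℝ)) ^ 2 * Y := by
        rw [div_pow, div_pow, mul_pow, mul_pow, mul_pow, mul_pow]
        field_simp
        ring
    _ ≤ (bracketConst ρ σ R * (1 / δ ^ 2) * X) ^ j * (Real.exp 1 ^ j) ^ 2 * Y := by
        gcongr
        exact pow_div_factorial_le_exp j
    _ = _ := by rw [← pow_mul, mul_comm j 2, pow_mul, ← mul_pow]; congr 2; ring

/-! ### Estimate of the solution of a homological equation. -/

lemma fourierCoeff_diag (c : Idx n₁ n₂ → ℂ) (g : TrigPoly n₁ n₂) (k : Fin n₁ → ℤ)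
    (p : Fin n₁ → ℂ) (z w : Fin n₂ → ℂ) : fourierCoeff (diag c g) k p z w =
      ∑ a ∈ g.coeff.support with a.k = k, c a * (g.coeff a * a.eval p z w) := by
  have h : diag c g =
      ∑ a ∈ g.coeff.support, g.coeff a • AddMonoidAlgebra.single a (c a) := rfl
  rw [h, ← fourierCoeffLin_apply, map_sum, Finset.sum_filter]
  refine Finset.sum_congr rfl fun a _ => ?_
  rw [fourierCoeffLin_apply, fourierCoeff_smul, fourierCoeff_single]
  split_ifs <;> ring

lemma Idx.eval_mul (a : Idx n₁ n₂) (p : Fin n₁ → ℂ) (z w u v : Fin n₂ → ℂ) :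
    a.eval p (fun j => z j * u j) (fun j => w j * v j) =
      a.eval p z w * ∏ j, (u j ^ a.l j * v j ^ a.lbar j) := by
  simp only [Idx.eval, mul_pow, Finset.prod_mul_distrib]
  ring

lemma prod_exp_phase (a : Idx n₁ n₂) (θ : Fin n₂ → ℝ) :
    ∏ j, (Complex.exp (θ j * Complex.I) ^ a.l j * Complex.exp (-(θ j * Complex.I)) ^ a.lbar j) =
      Complex.exp (((∑ j, ((a.l j : ℝ) - a.lbar j) * θ j : ℝ) : ℂ) * Complex.I) := by
  push_cast
  rw [Finset.sum_mul, Complex.exp_sum]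
  refine Finset.prod_congr rfl fun j _ => ?_
  rw [← Complex.exp_nat_mul, ← Complex.exp_nat_mul, ← Complex.exp_add]
  congr 1
  ring

lemma Idx.re_divisor (ω : Fin n₁ → ℂ) (Ω : Fin n₂ → ℂ) (a : Idx n₁ n₂) (t : ℂ) :
    (t * a.divisor ω Ω).re = (t * ∑ j, (a.k j : ℂ) * ω j).re +
      ∑ j, ((a.l j : ℝ) - a.lbar j) * (t * Ω j).re := by
  rw [Idx.divisor, EllipticTori.divisor, mul_add, Complex.add_re, Finset.mul_sum Finset.univ (fun j => _ * Ω j),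
    Complex.re_sum]
  congr 1
  refine Finset.sum_congr rfl fun j _ => ?_
  rw [mul_left_comm]
  have : (((a.l j : ℤ) - (a.lbar j : ℤ) : ℤ) : ℂ) = (((a.l j : ℝ) - a.lbar j : ℝ) : ℂ) := by
    push_cast; rfl
  rw [this, Complex.re_ofReal_mul]

/-- The estimate of the solution of a homological equation. -/
lemma NormLE.solveHomological {Λ : Type*} {W : Set Λ} {ρ σ R α B : ℝ} {K r i : ℕ} {γ τ : ℝ}
    (hγ : 0 < γ) (hτ : 0 ≤ τ) (hK : 1 ≤ K) (hr : 1 ≤ r) (hi : i ≤ 2) {ω : Λ → Fin n₁ → ℂ}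
    {Ω : Λ → Fin n₂ → ℂ} {g : Λ → TrigPoly n₁ n₂}
    (hnr : ∀ x ∈ W, NonResonant K γ τ r (ω x) (Ω x)) (hcl : ∀ x ∈ W, InClass i (r * K) (g x))
    (hg : NormLE W ρ σ R α g B) :
    NormLE W ρ σ R α (fun x => solveHomological (ω x) (Ω x) (g x))
      (10 * (((r * K : ℕ) : ℝ) ^ τ / γ) * B) := by
  have hrK : (0 : ℝ) < ((r * K : ℕ) : ℝ) := by exact_mod_cast Nat.mul_pos hr hK
  have hη : 0 < γ / ((r * K : ℕ) : ℝ) ^ τ := by positivity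
  rw [← inv_div γ]
  set η := γ / ((r * K : ℕ) : ℝ) ^ τ with hηdef
  refine anorm_le_of_coeff (by positivity) (fun k S hS x hx p z w hp hz hw => ?_) hg
  rw [solveHomological_eq, fourierCoeff_diag]
  have h1 : ∑ a ∈ (g x).coeff.support with a.k = k, Complex.I * (a.divisor (ω x) (Ω x))⁻¹ *
      ((g x).coeff a * a.eval p z w) = Complex.I * (η : ℂ)⁻¹ *
        ∑ a ∈ (g x).coeff.support with a.k = k, (g x).coeff a * a.eval p z w *
          (a.divisor (ω x) (Ω x) * (η : ℂ)⁻¹)⁻¹ := by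
    rw [Finset.mul_sum]
    refine Finset.sum_congr rfl fun a _ => ?_
    have : (η : ℂ) ≠ 0 := by exact_mod_cast hη.ne'
    rw [mul_inv, inv_inv]
    field_simp
  rw [h1, norm_mul, norm_mul, Complex.norm_I, one_mul, norm_inv, Complex.norm_real,
    Real.norm_of_nonneg hη.le]
  -- Divisors are rescaled by the lower bound η, so each one is zero (resonant) or of modulus at
  -- least 1.
  have h2 := norm_sum_mul_inv_le ((g x).coeff.support.filter fun a => a.k = k)
    (fun a => (g x).coeff a * a.eval p z w) (fun a => a.divisor (ω x) (Ω x) * (η : ℂ)⁻¹)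
    (S := S) ?_ ?_
  · calc _ ≤ η⁻¹ * (10 * S) := by gcongr
      _ = _ := by ring
  · intro a ha
    have hga := hcl x hx
    rw [inClass_iff] at hga
    obtain ⟨hd, hk⟩ := hga a (Finsupp.mem_support_iff.1 (Finset.mem_filter.1 ha).1)
    rcases divisor_bound hγ hτ hK hr (hnr x hx) a (by rw [hd]; exact_mod_cast hi)
      (by exact_mod_cast hk) with h | h
    · left
      rw [Idx.divisor_eq_zero _ _ a h, zero_mul]
    · right
      rw [norm_mul, norm_inv, Complex.norm_real, Real.norm_of_nonneg hη.le, ← div_eq_mul_inv,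
        one_le_div hη]
      exact h
  · intro t
    -- Real phases Re(tη⁻¹Ω_j) rotate z_j and w_j in opposite senses within the polydisc, even for
    -- complex Ω.
    have h3 := hS x hx p
      (fun j => z j * Complex.exp (((t * (η : ℂ)⁻¹ * Ω x j).re : ℝ) * Complex.I))
      (fun j => w j * Complex.exp (-(((t * (η : ℂ)⁻¹ * Ω x j).re : ℝ) * Complex.I))) hp
      (fun j => by rw [norm_mul, Complex.norm_exp_ofReal_mul_I, mul_one]; exact hz j)
      (fun j => by
        rw [norm_mul, ← neg_mul, ← Complex.ofReal_neg, Complex.norm_exp_ofReal_mul_I, mul_one]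
        exact hw j)
    rw [fourierCoeff_eq_sum] at h3
    -- Since k is fixed, the part of the phase with k·ω is common to all monomials and has modulus
    -- one.
    have h4 : ∑ a ∈ (g x).coeff.support with a.k = k, (g x).coeff a * a.eval p z w *
        Complex.exp (((t * (a.divisor (ω x) (Ω x) * (η : ℂ)⁻¹)).re : ℂ) * Complex.I) =
        Complex.exp (((t * (η : ℂ)⁻¹ * ∑ j, (k j : ℂ) * ω x j).re : ℂ) * Complex.I) *
        ∑ a ∈ (g x).coeff.support with a.k = k, (g x).coeff a * a.eval p
          (fun j => z j * Complex.exp (((t * (η : ℂ)⁻¹ * Ω x j).re : ℝ) * Complex.I))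
          (fun j => w j * Complex.exp (-(((t * (η : ℂ)⁻¹ * Ω x j).re : ℝ) * Complex.I))) := by
      rw [Finset.mul_sum]
      refine Finset.sum_congr rfl fun a ha => ?_
      have e1 : t * (a.divisor (ω x) (Ω x) * (η : ℂ)⁻¹) =
          t * (η : ℂ)⁻¹ * a.divisor (ω x) (Ω x) := by ring
      rw [Idx.eval_mul, prod_exp_phase, e1, Idx.re_divisor, (Finset.mem_filter.1 ha).2,
        Complex.ofReal_add, add_mul, Complex.exp_add]
      ring
    rw [h4, norm_mul, Complex.norm_exp_ofReal_mul_I, one_mul]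
    exact h3

/-! ### The resonant part -/

/-- Under the degree bound |l-lb| ≤ 2, so l-lb is a multiple of 3 only when it is 0: cube roots of
unity detect equality. -/
lemma sum_phase_eq (ζ : ℂ) (hζ : IsPrimitiveRoot ζ 3) {l lb : ℕ} (h : l + lb ≤ 2) :
    ∑ x : Fin 3, ((ζ ^ (x : ℕ)) ^ l * ((ζ ^ (x : ℕ))⁻¹) ^ lb) = if l = lb then 3 else 0 := by
  have h0 : ζ ≠ 0 := hζ.ne_zero (by norm_num)
  have h3 : ζ ^ 3 = 1 := hζ.pow_eq_one
  have h1 : 1 + ζ + ζ ^ 2 = 0 := by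
    have := hζ.geom_sum_eq_zero (by norm_num)
    simpa [Finset.sum_range_succ] using this
  have hinv : ζ⁻¹ = ζ ^ 2 := by
    field_simp; rw [← h3]
  have hl : l ≤ 2 := by omega
  have hlb : lb ≤ 2 := by omega
  rw [Fin.sum_univ_three]
  simp only [← inv_pow, hinv]
  interval_cases l <;> interval_cases lb <;> first | omega | skip
  all_goals simp
  · norm_num
  · linear_combination h1 + ζ * h3
  · linear_combination h1 + (ζ + ζ ^ 2 * (ζ ^ 3 + 1)) * h3
  · exact h1
  · linear_combination (2 + ζ ^ 3) * h3
  · linear_combination h1 + ζ * h3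

/-- The condition l = lbar is imposed coordinate by coordinate, by averaging over an independent
cube root of unity for each z_j. -/
lemma card_mul_fourierCoeff_resonantPart {ζ : ℂ} (hζ : IsPrimitiveRoot ζ 3) {N : ℕ}
    {g : TrigPoly n₁ n₂} (hg : InClass 2 N g) (p : Fin n₁ → ℂ) (z w : Fin n₂ → ℂ) :
    3 ^ n₂ * fourierCoeff (resonantPart g) 0 p z w =
      ∑ φ : Fin n₂ → Fin 3, fourierCoeff g 0 p (fun j => z j * ζ ^ (φ j : ℕ))
        (fun j => w j * (ζ ^ (φ j : ℕ))⁻¹) := by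
  rw [resonantPart, fourierCoeff_diag, Finset.mul_sum]
  simp only [fourierCoeff_eq_sum, Idx.eval_mul]
  rw [Finset.sum_comm]
  refine Finset.sum_congr rfl fun a ha => ?_
  obtain ⟨ha, hk⟩ := Finset.mem_filter.1 ha
  have hd := (hg a (Finsupp.mem_support_iff.1 ha)).1
  have h1 : ∑ φ : Fin n₂ → Fin 3,
      ∏ j, ((ζ ^ (φ j : ℕ)) ^ a.l j * ((ζ ^ (φ j : ℕ))⁻¹) ^ a.lbar j) =
      ∏ j, ∑ x : Fin 3, ((ζ ^ (x : ℕ)) ^ a.l j * ((ζ ^ (x : ℕ))⁻¹) ^ a.lbar j) := by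
    rw [Finset.prod_univ_sum, Fintype.piFinset_univ]
  have h2 : ∀ j, a.l j + a.lbar j ≤ 2 := fun j => by
    have e1 := Finset.single_le_sum (f := a.l) (fun _ _ => Nat.zero_le _) (Finset.mem_univ j)
    have e2 := Finset.single_le_sum (f := a.lbar) (fun _ _ => Nat.zero_le _) (Finset.mem_univ j)
    omega
  have h3 : ∏ j, (if a.l j = a.lbar j then (3 : ℂ) else 0) =
      if a.l = a.lbar then 3 ^ n₂ else 0 := by
    split_ifs with h
    · simp [h]
    · obtain ⟨j, hj⟩ := Function.ne_iff.1 h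
      exact Finset.prod_eq_zero (Finset.mem_univ j) (if_neg hj)
  simp only [← mul_assoc, ← Finset.mul_sum]
  rw [h1, Finset.prod_congr rfl fun j _ => sum_phase_eq ζ hζ (h2 j), h3]
  simp only [hk, true_and]
  split_ifs <;> ring

/-- The resonant part is bounded by the function, as an average over phases. -/
lemma NormLE.resonantPart {Λ : Type*} {W : Set Λ} {ρ σ R α B : ℝ} {N : ℕ}
    {g : Λ → TrigPoly n₁ n₂} (hcl : ∀ x ∈ W, InClass 2 N (g x)) (hg : NormLE W ρ σ R α g B) :
    NormLE W ρ σ R α (fun x => resonantPart (g x)) B := by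
  rw [← one_mul B]
  refine anorm_le_of_coeff zero_le_one (fun k S hS x hx p z w hp hz hw => ?_) hg
  rw [one_mul]
  by_cases hk : k = 0
  · subst hk
    have hζ := Complex.isPrimitiveRoot_exp 3 (by norm_num)
    set ζ := Complex.exp (2 * Real.pi * Complex.I / (3 : ℕ))
    have hn : ‖ζ‖ = 1 := hζ.norm'_eq_one (by norm_num)
    have h1 := card_mul_fourierCoeff_resonantPart hζ (hcl x hx) p z w
    have h2 : ‖(3 : ℂ) ^ n₂ * fourierCoeff (EllipticTori.resonantPart (g x)) 0 p z w‖ ≤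
        ∑ φ : Fin n₂ → Fin 3, S := by
      rw [h1]
      refine (norm_sum_le _ _).trans (Finset.sum_le_sum fun φ _ => hS x hx _ _ _ hp ?_ ?_)
      · intro j; rw [norm_mul, norm_pow, hn, one_pow, mul_one]; exact hz j
      · intro j; rw [norm_mul, norm_inv, norm_pow, hn, one_pow, inv_one, mul_one]; exact hw j
    rw [norm_mul, norm_pow, Finset.sum_const, Finset.card_univ, Fintype.card_fun, Fintype.card_fin,
      Fintype.card_fin, nsmul_eq_mul] at h2
    push_cast at h2
    rw [Complex.norm_ofNat] at h2
    exact le_of_mul_le_mul_left h2 (by positivity)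
  · rw [EllipticTori.resonantPart, fourierCoeff_diag, Finset.sum_eq_zero, norm_zero]
    · exact (norm_nonneg _).trans (hS x hx p z w hp hz hw)
    · intro a ha
      rw [if_neg (fun h => hk ((Finset.mem_filter.1 ha).2.symm.trans h.1)), zero_mul]

/-- The average over the angles is bounded by the norm. -/
lemma NormLE.norm_fourierCoeff_zero_le {Λ : Type*} {W : Set Λ} {ρ σ R α B : ℝ} (hB : 0 ≤ B)
    {g : Λ → TrigPoly n₁ n₂} (hg : NormLE W ρ σ R α g B) {x : Λ} (hx : x ∈ W) {p : Fin n₁ → ℂ}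
    {z w : Fin n₂ → ℂ} (hp : ∀ j, ‖p j‖ < α * ρ) (hz : ∀ j, ‖z j‖ < α * R)
    (hw : ∀ j, ‖w j‖ < α * R) : ‖fourierCoeff (g x) 0 p z w‖ ≤ B := by
  have h1 : harmonicNorm W (α * ρ) (α * R) g 0 ≤ anorm W ρ σ R α g := by
    rw [anorm_eq_tsum]
    refine le_trans ?_ (ENNReal.le_tsum 0)
    simp [l1]
  exact (ENNReal.ofReal_le_ofReal_iff hB).1 ((le_harmonicNorm hx hp hz hw 0).trans (h1.trans hg))

lemma prod_pow_single {n : ℕ} (p : Fin n → ℂ) (j : Fin n) :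
    ∏ i, p i ^ (Pi.single j 1 : Fin n → ℕ) i = p j := by
  rw [Finset.prod_eq_single j (fun i _ hi => by rw [Pi.single_eq_of_ne hi, pow_zero])
    (fun h => absurd (Finset.mem_univ j) h), Pi.single_eq_same, pow_one]

lemma fourierCoeff_Z (r : ℕ) (H : Ham n₁ n₂) (p : Fin n₁ → ℂ) (z w : Fin n₂ → ℂ) :
    fourierCoeff (H.Z r) 0 p z w = ∑ j, H.zP r j * p j + ∑ j, H.zZ r j * (z j * w j) := by
  have h1 : ∀ j : Fin n₁, Idx.eval (Pi.single j 1, 0, 0, 0) p z w = p j := fun j => by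
    simp [Idx.eval, Idx.m, Idx.l, Idx.lbar, prod_pow_single]
  have h2 : ∀ j : Fin n₂, Idx.eval (0, Pi.single j 1, Pi.single j 1, 0) p z w = z j * w j :=
    fun j => by simp [Idx.eval, Idx.m, Idx.l, Idx.lbar, prod_pow_single]
  rw [Ham.Z, ← fourierCoeffLin_apply, map_add, map_sum, map_sum]
  simp only [fourierCoeffLin_apply, fourierCoeff_single, h1, h2, if_true]

/-- Z is evaluated where p_i = ρ/2 is the only nonzero coordinate, a point of the domain because α >
1/2. -/
lemma norm_zP_le {W : Set (Fin n₁ → ℂ)} {ρ σ R α B : ℝ} (hρ : 0 < ρ) (hR : 0 < R)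
    (hα : 1 / 2 < α) (hB : 0 ≤ B) {H : (Fin n₁ → ℂ) → Ham n₁ n₂} {r : ℕ}
    (h : NormLE W ρ σ R α (fun x => (H x).Z r) B) {x : Fin n₁ → ℂ} (hx : x ∈ W) (i : Fin n₁) :
    ‖(H x).zP r i‖ * (ρ / 2) ≤ B := by
  have h1 := h.norm_fourierCoeff_zero_le hB hx (p := Pi.single i ((ρ / 2 : ℝ) : ℂ)) (z := 0)
    (w := 0) ?_ ?_ ?_
  · rw [fourierCoeff_Z, Finset.sum_eq_single i (fun j _ hj => by rw [Pi.single_eq_of_ne hj, mul_zero])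
      (fun h => absurd (Finset.mem_univ i) h), Pi.single_eq_same] at h1
    simpa [abs_of_pos hρ] using h1
  · intro j
    by_cases hj : j = i
    · subst hj
      rw [Pi.single_eq_same, Complex.norm_real, Real.norm_of_nonneg (by positivity)]
      nlinarith
    · rw [Pi.single_eq_of_ne hj, norm_zero]; positivity
  · intro j; rw [Pi.zero_apply, norm_zero]; positivity
  · intro j; rw [Pi.zero_apply, norm_zero]; positivity

lemma norm_zZ_le {W : Set (Fin n₁ → ℂ)} {ρ σ R α B : ℝ} (hρ : 0 < ρ) (hR : 0 < R)
    (hα : 1 / 2 < α) (hB : 0 ≤ B) {H : (Fin n₁ → ℂ) → Ham n₁ n₂} {r : ℕ}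
    (h : NormLE W ρ σ R α (fun x => (H x).Z r) B) {x : Fin n₁ → ℂ} (hx : x ∈ W) (i : Fin n₂) :
    ‖(H x).zZ r i‖ * (R / 2) ^ 2 ≤ B := by
  have h2 : ∀ j, ‖(Pi.single i ((R / 2 : ℝ) : ℂ) : Fin n₂ → ℂ) j‖ < α * R := by
    intro j
    by_cases hj : j = i
    · subst hj
      rw [Pi.single_eq_same, Complex.norm_real, Real.norm_of_nonneg (by positivity)]
      nlinarith
    · rw [Pi.single_eq_of_ne hj, norm_zero]; positivity
  have h1 := h.norm_fourierCoeff_zero_le hB hx (p := 0) (z := Pi.single i ((R / 2 : ℝ) : ℂ))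
    (w := Pi.single i ((R / 2 : ℝ) : ℂ)) ?_ h2 h2
  · rw [fourierCoeff_Z, Finset.sum_eq_single (s := Finset.univ (α := Fin n₂)) i
      (fun j _ hj => by rw [Pi.single_eq_of_ne hj, mul_zero, mul_zero])
      (fun h => absurd (Finset.mem_univ i) h), Pi.single_eq_same] at h1
    simpa [abs_of_pos hR, sq] using h1
  · intro j; rw [Pi.zero_apply, norm_zero]; positivity

/-! ### The growth of the estimates -/

/-- The exponent counting how often divisors of order at least `μ` occur. -/
def growthExp (μ l s : ℕ) : ℕ := 3 * (s / μ) - (3 - l)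

/-- The weights controlling the terms of the Hamiltonians. -/
def weight (M Q : ℝ) (r l s : ℕ) : ℝ :=
  (5 * M) ^ growthExp 1 l s * Q ^ ∑ m ∈ Finset.range r.size, growthExp (2 ^ m) l s

/-- The factor produced by each Poisson bracket with `χ_i^{(r)}`. -/
def bracketFactor (M Q : ℝ) (r i : ℕ) : ℝ := 5 * M * Q ^ r.size * weight M Q r i r

/-- Since r/μ ≥ 1, a generator charges 1 + 3(r/μ) - (3-i) = 3(r/μ) - (2-i). The total credit (2-i)j
pays for the higher degree l + (2-i)j of the term acted upon. If that degree is at most 2, the last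
hypothesis makes the subtraction for this term genuine; if it is at least 3, the credit already
covers 3-l. -/
lemma growthExp_step {μ r i l s j : ℕ} (hμ : 1 ≤ μ) (hμr : μ ≤ r) (hi : i ≤ 2) (hjs : j * r ≤ s)
    (h : l + (2 - i) * j ≤ 2 → r ≤ s - j * r) :
    j * (1 + growthExp μ i r) + growthExp μ (l + (2 - i) * j) (s - j * r) ≤ growthExp μ l s := by
  have ha : 1 ≤ r / μ := (Nat.one_le_div_iff hμ).2 hμr
  have hb : l + (2 - i) * j ≤ 2 → 1 ≤ (s - j * r) / μ := fun h' =>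
    (Nat.one_le_div_iff hμ).2 (hμr.trans (h h'))
  have hc : j * (r / μ) + (s - j * r) / μ ≤ s / μ := by
    rw [Nat.le_div_iff_mul_le hμ, add_mul, mul_assoc]
    have h1 := Nat.mul_le_mul_left j (Nat.div_mul_le_self r μ)
    have h2 := Nat.div_mul_le_self (s - j * r) μ
    omega
  unfold growthExp
  generalize r / μ = a at *
  generalize (s - j * r) / μ = b at *
  generalize s / μ = c at *
  have h3 : j * (1 + (3 * a - (3 - i))) + (2 - i) * j = 3 * (j * a) := by
    have : 1 + (3 * a - (3 - i)) + (2 - i) = 3 * a := by omega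
    calc _ = j * (1 + (3 * a - (3 - i)) + (2 - i)) := by ring
      _ = _ := by rw [this]; ring
  generalize j * (1 + (3 * a - (3 - i))) = d at *
  generalize (2 - i) * j = f at *
  generalize j * a = g at *
  omega

lemma one_le_weight {M Q : ℝ} (hM : 1 ≤ M) (hQ : 1 ≤ Q) (r l s : ℕ) : 1 ≤ weight M Q r l s :=
  one_le_mul_of_one_le_of_one_le (one_le_pow₀ (by linarith)) (one_le_pow₀ hQ)

lemma weight_mono {M Q : ℝ} (hM : 1 ≤ M) (hQ : 1 ≤ Q) {r r' : ℕ} (h : r ≤ r') (l s : ℕ) :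
    weight M Q r l s ≤ weight M Q r' l s := by
  unfold weight
  refine mul_le_mul_of_nonneg_left (pow_le_pow_right₀ hQ ?_) (by positivity)
  exact Finset.sum_le_sum_of_subset (Finset.range_mono (Nat.size_le_size h))

lemma one_le_bracketFactor {M Q : ℝ} (hM : 1 ≤ M) (hQ : 1 ≤ Q) (r i : ℕ) :
    1 ≤ bracketFactor M Q r i :=
  one_le_mul_of_one_le_of_one_le
    (one_le_mul_of_one_le_of_one_le (by linarith) (one_le_pow₀ hQ)) (one_le_weight hM hQ r i r)

lemma bracketFactor_eq (M Q : ℝ) (r i : ℕ) : bracketFactor M Q r i =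
    (5 * M) ^ (1 + growthExp 1 i r) *
      Q ^ ∑ m ∈ Finset.range r.size, (1 + growthExp (2 ^ m) i r) := by
  rw [bracketFactor, weight, pow_add, pow_one, Finset.sum_add_distrib, Finset.sum_const,
    Finset.card_range, smul_eq_mul, mul_one, pow_add]
  ring

/-- `growthExp_step` is applied at scale 1 for the powers of 5M and at each scale 2^m ≤ r for the
powers of Q. -/
lemma bracketFactor_pow_mul_weight_le {M Q : ℝ} (hM : 1 ≤ M) (hQ : 1 ≤ Q) {r i l s j : ℕ}
    (hr : 1 ≤ r) (hi : i ≤ 2) (hjs : j * r ≤ s) (h : l + (2 - i) * j ≤ 2 → r ≤ s - j * r) :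
    bracketFactor M Q r i ^ j * weight M Q r (l + (2 - i) * j) (s - j * r) ≤ weight M Q r l s := by
  rw [bracketFactor_eq, weight, weight, mul_pow, mul_mul_mul_comm, ← pow_mul, ← pow_mul, ← pow_add,
    ← pow_add]
  refine mul_le_mul (pow_le_pow_right₀ (by linarith) ?_) (pow_le_pow_right₀ hQ ?_)
    (by positivity) (by positivity)
  · rw [mul_comm]; exact growthExp_step le_rfl hr hi hjs h
  · rw [mul_comm, Finset.mul_sum, ← Finset.sum_add_distrib]
    refine Finset.sum_le_sum fun m hm => growthExp_step Nat.one_le_two_pow ?_ hi hjs h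
    exact Nat.lt_size.1 (Finset.mem_range.1 hm)

lemma sum_div_two_pow_le (n s : ℕ) : ∑ m ∈ Finset.range n, s / 2 ^ m ≤ 2 * s := by
  have h := Nat.geom_sum_le (b := 2) le_rfl s n
  omega

/-- The estimate in terms of a single power. -/
lemma pow_mul_pow_le {M Q : ℝ} (hM : 1 ≤ M) (hQ : 1 ≤ Q) {e f s : ℕ} (he : e ≤ 3 * s)
    (hf : f ≤ 6 * s) (hs : 1 ≤ s) :
    2 * ((5 * M) ^ e * Q ^ f) ≤ (M ^ 3 * Q ^ 6 * 2 ^ 8) ^ s := by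
  -- The factor 2⁸ in 𝒜 absorbs 5³ = 125 at each order, together with the overall loss 2.
  have h2 : (2 : ℝ) * 125 ^ s ≤ (2 ^ 8) ^ s := by
    obtain ⟨t, rfl⟩ := Nat.exists_eq_add_of_le' hs
    have : (125 : ℝ) ^ t ≤ (2 ^ 8) ^ t := by gcongr; norm_num
    rw [pow_succ, pow_succ]
    nlinarith [pow_pos (by norm_num : (0 : ℝ) < 125) t]
  calc 2 * ((5 * M) ^ e * Q ^ f) ≤ 2 * ((5 * M) ^ (3 * s) * Q ^ (6 * s)) := by
        gcongr
        · linarith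
    _ = (M ^ 3 * Q ^ 6) ^ s * (2 * 125 ^ s) := by
        rw [pow_mul, pow_mul, mul_pow, mul_pow, mul_pow]; norm_num; ring
    _ ≤ (M ^ 3 * Q ^ 6) ^ s * (2 ^ 8) ^ s := by gcongr
    _ = _ := by rw [← mul_pow]

lemma two_mul_weight_le {M Q : ℝ} (hM : 1 ≤ M) (hQ : 1 ≤ Q) (r l : ℕ) {s : ℕ} (hs : 1 ≤ s) :
    2 * weight M Q r l s ≤ (M ^ 3 * Q ^ 6 * 2 ^ 8) ^ s := by
  refine pow_mul_pow_le hM hQ ?_ ?_ hs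
  · simp [growthExp]
  · calc _ ≤ ∑ m ∈ Finset.range r.size, 3 * (s / 2 ^ m) :=
          Finset.sum_le_sum fun m _ => Nat.sub_le _ _
      _ = 3 * ∑ m ∈ Finset.range r.size, s / 2 ^ m := by rw [Finset.mul_sum]
      _ ≤ 3 * (2 * s) := Nat.mul_le_mul_left _ (sum_div_two_pow_le _ _)
      _ = _ := by ring

/-- For i ≤ 2 the count lies strictly below 3(r/μ), which leaves room for the extra factor at each
scale. -/
lemma two_mul_bracketFactor_le {M Q : ℝ} (hM : 1 ≤ M) (hQ : 1 ≤ Q) {r i : ℕ} (hr : 1 ≤ r)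
    (hi : i ≤ 2) : 2 * bracketFactor M Q r i ≤ (M ^ 3 * Q ^ 6 * 2 ^ 8) ^ r := by
  have h : ∀ μ, 1 ≤ μ → μ ≤ r → 1 + growthExp μ i r ≤ 3 * (r / μ) := fun μ hμ hμr => by
    have ha : 1 ≤ r / μ := (Nat.one_le_div_iff hμ).2 hμr
    unfold growthExp
    omega
  rw [bracketFactor_eq]
  refine pow_mul_pow_le hM hQ ?_ ?_ hr
  · simpa using h 1 le_rfl hr
  · calc _ ≤ ∑ m ∈ Finset.range r.size, 3 * (r / 2 ^ m) :=
          Finset.sum_le_sum fun m hm =>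
            h _ Nat.one_le_two_pow (Nat.lt_size.1 (Finset.mem_range.1 hm))
      _ = 3 * ∑ m ∈ Finset.range r.size, r / 2 ^ m := by rw [Finset.mul_sum]
      _ ≤ 3 * (2 * r) := Nat.mul_le_mul_left _ (sum_div_two_pow_le _ _)
      _ = _ := by ring

/-- The base of the powers that control the small divisors, with `t = 4 + τ`. -/
lemma rpow_le_pow_size {t : ℝ} (ht : 4 ≤ t) {r : ℕ} (hr : 1 ≤ r) :
    16 * (r : ℝ) ^ 2 * (r : ℝ) ^ t ≤ ((2 : ℝ) ^ (2 * t)) ^ r.size := by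
  have hr0 : (0 : ℝ) < r := by exact_mod_cast hr
  -- With n binary digits the comparison of exponents is 4 + n(2+t) ≤ 2tn. For t ≥ 4 this is ensured
  -- by n ≥ 2, so r = 1 is checked directly.
  rcases hr.eq_or_lt with rfl | hr2
  · have h1 : Nat.size 1 = 1 := by decide
    rw [h1, pow_one]
    have : (2 : ℝ) ^ (8 : ℝ) ≤ (2 : ℝ) ^ (2 * t) :=
      Real.rpow_le_rpow_of_exponent_le (by norm_num) (by linarith)
    have h8 : (2 : ℝ) ^ (8 : ℝ) = 256 := by
      rw [show (8 : ℝ) = ((8 : ℕ) : ℝ) by norm_num, Real.rpow_natCast]; norm_num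
    simp only [Nat.cast_one, Real.one_rpow]
    linarith
  · have hn : 2 ≤ r.size := Nat.lt_size.2 (by omega)
    have hn' : (2 : ℝ) ≤ (r.size : ℝ) := by exact_mod_cast hn
    have hlt : (r : ℝ) ≤ (2 : ℝ) ^ (r.size : ℝ) := by
      rw [Real.rpow_natCast]
      exact_mod_cast (Nat.lt_size_self r).le
    rw [mul_assoc, ← Real.rpow_natCast (r : ℝ) 2, ← Real.rpow_add hr0, ← Real.rpow_natCast,
      ← Real.rpow_mul (by norm_num)]
    have h16 : (16 : ℝ) = (2 : ℝ) ^ (4 : ℝ) := by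
      rw [show (4 : ℝ) = ((4 : ℕ) : ℝ) by norm_num, Real.rpow_natCast]; norm_num
    calc (16 : ℝ) * (r : ℝ) ^ (((2 : ℕ) : ℝ) + t)
        ≤ 16 * ((2 : ℝ) ^ (r.size : ℝ)) ^ (((2 : ℕ) : ℝ) + t) := by gcongr
      _ = (2 : ℝ) ^ (4 + (r.size : ℝ) * (((2 : ℕ) : ℝ) + t)) := by
          rw [← Real.rpow_mul (by norm_num), h16, ← Real.rpow_add (by norm_num)]
      _ ≤ _ := Real.rpow_le_rpow_of_exponent_le (by norm_num) (by push_cast; nlinarith)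

/-- The estimate of a Lie series with modified coefficients. -/
lemma NormLE.lieSeries {Λ : Type*} {W : Set Λ} {ρ σ R α δ B U E M Q x : ℝ} {r i : ℕ}
    {χ : Λ → TrigPoly n₁ n₂} {F : Λ → ℕ → ℕ → TrigPoly n₁ n₂} (hρ : 0 < ρ) (hσ : 0 < σ)
    (hR : 0 < R) (hδ : 0 < δ) (h0 : δ ≤ α) (hB : 0 ≤ B) (hU : 0 ≤ U) (hE : 0 ≤ E) (hM : 1 ≤ M)
    (hQ : 1 ≤ Q) (hx0 : 0 ≤ x) (hx1 : x < 1) (hr : 1 ≤ r) (hi : i ≤ 2)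
    (hχ : NormLE W ρ σ R α χ B)
    (hΓ : lieConst ρ σ R * (1 / δ ^ 2) * B ≤ 2 ^ (2 - i) * (x * bracketFactor M Q r i))
    (hF : ∀ l s, NormLE W ρ σ R α (fun ω => F ω l s) (E / 2 ^ l * U * weight M Q r l s))
    (hF0 : ∀ ω ∈ W, ∀ l s, l ≤ 2 → s < r → F ω l s = 0) (l s : ℕ) {c : ℕ → ℂ}
    (hc : ∀ j, ‖c j‖ ≤ 1) {J : ℕ} (hJ : J ≤ s / r + 1) :
    NormLE W ρ σ R (α - δ) (fun ω => ∑ j ∈ Finset.range J, c j • ((1 : ℂ) / (j.factorial : ℂ)) •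
        (EllipticTori.lie (χ ω))^[j] (F ω (l + (2 - i) * j) (s - j * r)))
      (E / 2 ^ l * (U / (1 - x)) * weight M Q r l s) := by
  have hw := one_le_weight hM hQ r l s
  have hX := one_le_bracketFactor hM hQ r i
  have hC : 0 ≤ lieConst ρ σ R * (1 / δ ^ 2) * B := by
    have : 0 ≤ lieConst ρ σ R := by rw [lieConst]; positivity
    positivity
  have key : ∀ j ∈ Finset.range J, NormLE W ρ σ R (α - δ) (fun ω => c j •
      ((1 : ℂ) / (j.factorial : ℂ)) •
        (EllipticTori.lie (χ ω))^[j] (F ω (l + (2 - i) * j) (s - j * r)))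
      (E / 2 ^ l * U * weight M Q r l s * x ^ j) := by
    intro j hj
    have hjs : j * r ≤ s := by
      have : j ≤ s / r := by have := Finset.mem_range.1 hj; omega
      exact (Nat.le_div_iff_mul_le hr).1 this
    -- Terms of degree at most 2 and order below r vanish; elsewhere the hypothesis of
    -- `growthExp_step` holds.
    by_cases hz : l + (2 - i) * j ≤ 2 ∧ s - j * r < r
    · refine NormLE.zero.congr fun ω hω => ?_
      rw [hF0 ω hω _ _ hz.1 hz.2, lie_iterate_zero, smul_zero, smul_zero]
    · have h1 := bracketFactor_pow_mul_weight_le hM hQ hr hi (l := l) hjs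
        (fun h => by by_contra h'; exact hz ⟨h, not_le.1 h'⟩)
      have hw' := one_le_weight hM hQ r (l + (2 - i) * j) (s - j * r)
      have h2 := (NormLE.lie_iterate hρ hσ hR hδ h0 hB
        (by positivity) hχ (hF (l + (2 - i) * j) (s - j * r)) j).const_smul (c j)
      refine h2.mono_right ?_
      calc _ ≤ 1 * ((2 ^ (2 - i) * (x * bracketFactor M Q r i)) ^ j *
            (E / 2 ^ (l + (2 - i) * j) * U * weight M Q r (l + (2 - i) * j) (s - j * r))) := by
            gcongr
            exact hc j
        -- The factor 2^{(2-i)j} of the generators cancels against the decay 2^{-(2-i)j} due to the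
        -- higher degree.
        _ = E / 2 ^ l * U * (bracketFactor M Q r i ^ j *
            weight M Q r (l + (2 - i) * j) (s - j * r)) * x ^ j := by
            rw [mul_pow, mul_pow, ← pow_mul, pow_add]
            field_simp
        _ ≤ _ := by gcongr
  refine (NormLE.sum key fun j _ => by positivity).mono_right ?_
  rw [← Finset.mul_sum]
  have hg : ∑ j ∈ Finset.range J, x ^ j ≤ (1 - x)⁻¹ := by
    rw [← tsum_geometric_of_lt_one hx0 hx1]
    exact (summable_geometric_of_lt_one hx0 hx1).sum_le_tsum _ fun j _ => by positivity
  calc _ ≤ E / 2 ^ l * U * weight M Q r l s * (1 - x)⁻¹ := by gcongr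
    _ = _ := by ring

/-! ### The constants, the domains and the size of the generating functions. -/

lemma lieConst_pos {ρ σ R : ℝ} (hρ : 0 < ρ) (hσ : 0 < σ) (hR : 0 < R) : 0 < lieConst ρ σ R := by
  rw [lieConst]; positivity

lemma one_le_constM (K : ℕ) (ρ σ R E γ τ : ℝ) : 1 ≤ constM K ρ σ R E γ τ := le_max_left _ _

lemma le_constM (K : ℕ) (ρ σ R E γ τ : ℝ) :
    4 * Real.pi ^ 4 * E * (K : ℝ) ^ τ / γ * lieConst ρ σ R ≤ constM K ρ σ R E γ τ :=
  le_max_right _ _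

/-- The base of the powers controlling the small divisors. -/
def divisorBase (τ : ℝ) : ℝ := (2 : ℝ) ^ (2 * (4 + τ))

lemma one_le_divisorBase {τ : ℝ} (hτ : 0 ≤ τ) : 1 ≤ divisorBase τ :=
  Real.one_le_rpow (by norm_num) (by linarith)

lemma constA_eq (K : ℕ) (ρ σ R E γ τ : ℝ) : constA K ρ σ R E γ τ =
    constM K ρ σ R E γ τ ^ 3 * divisorBase τ ^ 6 * 2 ^ 8 := by
  rw [constA, divisorBase, ← Real.rpow_mul_natCast (by norm_num)]
  congr 3
  push_cast
  ring

lemma delta_pos {r : ℕ} (hr : 1 ≤ r) : 0 < delta r := by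
  have : (0 : ℝ) < r := by exact_mod_cast hr
  rw [delta]; positivity

lemma one_div_delta_sq {r : ℕ} : 1 / delta r ^ 2 = 4 * Real.pi ^ 4 * (r : ℝ) ^ 4 := by
  rw [delta, div_pow, one_pow, one_div_one_div]
  ring

/-- Telescoping of 1/(n+1)² ≤ 1/n - 1/(n+1), in a form suited to induction. -/
lemma dom_le (r : ℕ) : dom (r + 1) ≤ 3 / (2 * Real.pi ^ 2) * (2 - 1 / ((r : ℝ) + 1)) := by
  induction r with
  | zero =>
    rw [dom, dom, delta]
    push_cast
    refine le_of_eq ?_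
    field_simp
    norm_num
  | succ r ih =>
    rw [dom]
    refine (add_le_add_left ih _).trans ?_
    rw [delta]
    have h1 : 3 * (1 / (2 * Real.pi ^ 2 * ((r + 1 + 1 : ℕ) : ℝ) ^ 2)) =
        3 / (2 * Real.pi ^ 2) * (1 / ((r : ℝ) + 1 + 1) ^ 2) := by
      push_cast; field_simp
    rw [h1, ← mul_add]
    refine mul_le_mul_of_nonneg_left ?_ (by positivity)
    push_cast
    have h2 : 1 / ((r : ℝ) + 1) - 1 / ((r : ℝ) + 1 + 1) - 1 / ((r : ℝ) + 1 + 1) ^ 2 =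
        1 / (((r : ℝ) + 1) * ((r : ℝ) + 1 + 1) ^ 2) := by field_simp; ring
    have h3 : 0 ≤ 1 / (((r : ℝ) + 1) * ((r : ℝ) + 1 + 1) ^ 2) := by positivity
    linarith

lemma dom_le_third (r : ℕ) : dom r ≤ 1 / 3 := by
  cases r with
  | zero => rw [dom]; norm_num
  | succ r =>
    refine (dom_le r).trans ?_
    have hπ : (9 : ℝ) ≤ Real.pi ^ 2 := by nlinarith [Real.pi_gt_three]
    have h1 : (0 : ℝ) ≤ 1 / ((r : ℝ) + 1) := by positivity
    calc _ ≤ 3 / (2 * 9) * (2 : ℝ) := by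
          gcongr
          · have : 1 / ((r : ℝ) + 1) ≤ 1 := by
              rw [div_le_one (by positivity)]; linarith [(Nat.cast_nonneg r : (0 : ℝ) ≤ r)]
            linarith
          · linarith
      _ = _ := by norm_num

/-- The constant M contains the 4π⁴ of 1/δ_r² = 4π⁴r⁴, together with K^τ/γ and the bracket constant.
What remains is r^{4+τ}, and Q^{`r.size`} covers it with 16r² to spare: this is the small ratio of
the Lie series. The 5 in `bracketFactor` comes from 10·2 = 4·5, with 10 the multiplier constant and
2 the bound for U. -/
lemma scaled_solution_le {K r i : ℕ} {ρ σ R E γ τ U : ℝ} (hρ : 0 < ρ) (hσ : 0 < σ) (hR : 0 < R)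
    (hE : 0 < E) (hγ : 0 < γ) (hτ : 0 ≤ τ) (hK : 1 ≤ K) (hr : 1 ≤ r) (hi : i ≤ 2)
    (hU : U ≤ 2) :
    lieConst ρ σ R * (1 / delta r ^ 2) * (10 * (((r * K : ℕ) : ℝ) ^ τ / γ) *
        (E / 2 ^ i * U * weight (constM K ρ σ R E γ τ) (divisorBase τ) r i r)) ≤
      2 ^ (2 - i) * (1 / (16 * (r : ℝ) ^ 2) *
        bracketFactor (constM K ρ σ R E γ τ) (divisorBase τ) r i) := by
  have hr0 : (0 : ℝ) < r := by exact_mod_cast hr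
  have hK0 : (0 : ℝ) < K := by exact_mod_cast hK
  have hM := one_le_constM K ρ σ R E γ τ
  have hM' := le_constM K ρ σ R E γ τ
  have hC := lieConst_pos hρ hσ hR
  have hQ := one_le_divisorBase hτ
  have hw := one_le_weight hM hQ r i r
  rw [bracketFactor]
  generalize weight (constM K ρ σ R E γ τ) (divisorBase τ) r i r = w at *
  generalize constM K ρ σ R E γ τ = M at *
  generalize lieConst ρ σ R = C at *
  have hs := rpow_le_pow_size (t := 4 + τ) (by linarith) hr
  change _ ≤ divisorBase τ ^ r.size at hs
  have h2 : (2 : ℝ) ^ (2 - i) = 4 / 2 ^ i := by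
    rw [eq_div_iff (by positivity), ← pow_add, Nat.sub_add_cancel hi]; norm_num
  rw [Real.rpow_add hr0, show (4 : ℝ) = ((4 : ℕ) : ℝ) by norm_num, Real.rpow_natCast] at hs
  rw [one_div_delta_sq, Nat.cast_mul, Real.mul_rpow hr0.le hK0.le, h2]
  calc _ = 4 * Real.pi ^ 4 * E * (K : ℝ) ^ τ / γ * C * (10 / 2 ^ i * U * w *
        ((r : ℝ) ^ 4 * (r : ℝ) ^ τ)) := by ring
    _ ≤ 4 * Real.pi ^ 4 * E * (K : ℝ) ^ τ / γ * C * (10 / 2 ^ i * 2 * w *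
        ((r : ℝ) ^ 4 * (r : ℝ) ^ τ)) := by gcongr
    _ ≤ M * (10 / 2 ^ i * 2 * w * ((r : ℝ) ^ 4 * (r : ℝ) ^ τ)) := by gcongr
    _ = 4 / 2 ^ i * (1 / (16 * (r : ℝ) ^ 2) * (5 * M *
        (16 * (r : ℝ) ^ 2 * ((r : ℝ) ^ 4 * (r : ℝ) ^ τ)) * w)) := by
        field_simp
        norm_num
    _ ≤ _ := by gcongr

/-! ### Propagation of the estimates through the three transformations of a step. -/

/-- `F` is bounded with the constants of the `r`-th step, multiplied by `U`. -/
def StepBound {Λ : Type*} (W : Set Λ) (K : ℕ) (ρ σ R E γ τ : ℝ) (r : ℕ) (α U : ℝ)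
    (F : Λ → ℕ → ℕ → TrigPoly n₁ n₂) : Prop :=
  ∀ l s, NormLE W ρ σ R α (fun ω => F ω l s)
    (E / 2 ^ l * U * weight (constM K ρ σ R E γ τ) (divisorBase τ) r l s)

/-- A generating function is bounded with the constants of the `r`-th step. -/
def GeneratorBound {Λ : Type*} (W : Set Λ) (K : ℕ) (ρ σ R E γ τ : ℝ) (r i : ℕ) (α : ℝ)
    (χ : Λ → TrigPoly n₁ n₂) : Prop :=
  ∃ B, 0 ≤ B ∧ NormLE W ρ σ R α χ B ∧ lieConst ρ σ R * (1 / delta r ^ 2) * B ≤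
    2 ^ (2 - i) * (1 / (16 * (r : ℝ) ^ 2) *
      bracketFactor (constM K ρ σ R E γ τ) (divisorBase τ) r i)

section

variable {Λ : Type*} {W : Set Λ} {K r : ℕ} {ρ σ R E γ τ α U : ℝ}

lemma StepBound.generatorBound {i : ℕ} (hρ : 0 < ρ) (hσ : 0 < σ) (hR : 0 < R)
    (hE : 0 < E) (hγ : 0 < γ) (hτ : 0 ≤ τ) (hK : 1 ≤ K) (hr : 1 ≤ r) (hi : i ≤ 2) (hU0 : 0 ≤ U)
    (hU : U ≤ 2) {F : Λ → ℕ → ℕ → TrigPoly n₁ n₂} (hF : StepBound W K ρ σ R E γ τ r α U F)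
    (hcl : ∀ x ∈ W, InClass i (r * K) (F x i r)) {ω : Λ → Fin n₁ → ℂ} {Ω : Λ → Fin n₂ → ℂ}
    (hnr : ∀ x ∈ W, NonResonant K γ τ r (ω x) (Ω x)) :
    GeneratorBound W K ρ σ R E γ τ r i α fun x => solveHomological (ω x) (Ω x) (F x i r) := by
  refine ⟨_, ?_, NormLE.solveHomological hγ hτ hK hr hi hnr hcl (hF i r),
    scaled_solution_le hρ hσ hR hE hγ hτ hK hr hi hU⟩
  have := one_le_weight (one_le_constM K ρ σ R E γ τ) (one_le_divisorBase hτ) r i r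
  positivity

lemma StepBound.lieSeries_coeff {i : ℕ} (hρ : 0 < ρ) (hσ : 0 < σ) (hR : 0 < R) (hE : 0 < E)
    (hτ : 0 ≤ τ) (hr : 1 ≤ r) (hα : delta r ≤ α) (hi : i ≤ 2) (hU0 : 0 ≤ U)
    {χ : Λ → TrigPoly n₁ n₂} (hχ : GeneratorBound W K ρ σ R E γ τ r i α χ)
    {F : Λ → ℕ → ℕ → TrigPoly n₁ n₂} (hF : StepBound W K ρ σ R E γ τ r α U F)
    (hF0 : ∀ ω ∈ W, ∀ l s, l ≤ 2 → s < r → F ω l s = 0) (l s : ℕ) {c : ℕ → ℂ}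
    (hc : ∀ j, ‖c j‖ ≤ 1) {J : ℕ} (hJ : J ≤ s / r + 1) :
    NormLE W ρ σ R (α - delta r)
      (fun ω => ∑ j ∈ Finset.range J, c j • ((1 : ℂ) / (j.factorial : ℂ)) •
        (lie (χ ω))^[j] (F ω (l + (2 - i) * j) (s - j * r)))
      (E / 2 ^ l * (U / (1 - 1 / (16 * (r : ℝ) ^ 2))) *
        weight (constM K ρ σ R E γ τ) (divisorBase τ) r l s) := by
  obtain ⟨B, hB, hχ, hΓ⟩ := hχ
  have hr0 : (1 : ℝ) ≤ r := by exact_mod_cast hr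
  refine NormLE.lieSeries hρ hσ hR (delta_pos hr) hα hB hU0 hE.le (one_le_constM _ _ _ _ _ _ _)
    (one_le_divisorBase hτ) (by positivity) ?_ hr hi hχ hΓ hF hF0 l s hc hJ
  rw [div_lt_one (by positivity)]
  nlinarith

lemma StepBound.lieSeries {i : ℕ} (hρ : 0 < ρ) (hσ : 0 < σ) (hR : 0 < R) (hE : 0 < E)
    (hτ : 0 ≤ τ) (hr : 1 ≤ r) (hα : delta r ≤ α) (hi : i ≤ 2) (hU0 : 0 ≤ U)
    {χ : Λ → TrigPoly n₁ n₂} (hχ : GeneratorBound W K ρ σ R E γ τ r i α χ)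
    {F : Λ → ℕ → ℕ → TrigPoly n₁ n₂} (hF : StepBound W K ρ σ R E γ τ r α U F)
    (hF0 : ∀ ω ∈ W, ∀ l s, l ≤ 2 → s < r → F ω l s = 0) :
    StepBound W K ρ σ R E γ τ r (α - delta r) (U / (1 - 1 / (16 * (r : ℝ) ^ 2)))
      fun ω => lieSeries r (2 - i) (χ ω) (F ω) := by
  intro l s
  refine (StepBound.lieSeries_coeff hρ hσ hR hE hτ hr hα hi hU0 hχ hF hF0 l s
    (c := fun _ => 1) (by simp) le_rfl).congr fun ω _ => ?_
  simp only [one_smul]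
  rfl

lemma StepBound.fI (hρ : 0 < ρ) (hσ : 0 < σ) (hR : 0 < R) (hE : 0 < E) (hτ : 0 ≤ τ)
    (hr : 1 ≤ r) (hα : delta r ≤ α) (hU0 : 0 ≤ U) {H : Λ → Ham n₁ n₂}
    (hH : ∀ x ∈ W, (H x).HasForm K (r - 1))
    (hχ : GeneratorBound W K ρ σ R E γ τ r 0 α fun x => (H x).chi0 r)
    (hF : StepBound W K ρ σ R E γ τ r α U fun x => (H x).f) :
    StepBound W K ρ σ R E γ τ r (α - delta r) (U / (1 - 1 / (16 * (r : ℝ) ^ 2)))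
      fun x => (H x).fI r := by
  intro l s
  have h1 := StepBound.lieSeries hρ hσ hR hE hτ hr hα (by norm_num) hU0 hχ hF
    (fun x hx l s hl hs => (hH x hx).2 l s hl (by omega)) l s
  by_cases h : l = 0 ∧ s = r
  · refine NormLE.zero.congr fun x _ => ?_
    beta_reduce
    rw [Ham.fI, if_pos h]
  · refine h1.congr fun x hx => ?_
    beta_reduce
    rw [Ham.fI_eq hr (hH x hx), if_neg h, sub_zero]

/-- The exceptional component (0, 2r) is a truncated Lie series with coefficient 1/2 at j = 1, so it
obeys the same bound. -/
lemma StepBound.fII (hρ : 0 < ρ) (hσ : 0 < σ) (hR : 0 < R) (hE : 0 < E) (hτ : 0 ≤ τ)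
    (hr : 1 ≤ r) (hα : delta r ≤ α) (hU0 : 0 ≤ U) {H : Λ → Ham n₁ n₂}
    (hH : ∀ x ∈ W, (H x).HasForm K (r - 1))
    (hχ : GeneratorBound W K ρ σ R E γ τ r 1 α fun x => (H x).chi1 r)
    (hF : StepBound W K ρ σ R E γ τ r α U fun x => (H x).fI r) :
    StepBound W K ρ σ R E γ τ r (α - delta r) (U / (1 - 1 / (16 * (r : ℝ) ^ 2)))
      fun x => (H x).fII r := by
  intro l s
  have hF0 : ∀ x ∈ W, ∀ l s, l ≤ 2 → s < r → (H x).fI r l s = 0 :=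
    fun x hx l s hl hs => Ham.fI_zero hr (hH x hx) l s hl (Or.inl hs)
  by_cases h : l ≤ 1 ∧ s = r
  · refine NormLE.zero.congr fun x _ => ?_
    beta_reduce
    rw [Ham.fII, if_pos h]
  by_cases h' : l = 0 ∧ s = 2 * r
  · obtain ⟨rfl, rfl⟩ := h'
    refine (StepBound.lieSeries_coeff hρ hσ hR hE hτ hr hα (by norm_num) hU0 hχ hF hF0 0 (2 * r)
      (c := fun j => if j = 1 then 1 / 2 else 1) (fun j => ?_) (J := 2) ?_).congr fun x hx => ?_
    · split_ifs <;> norm_num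
    · rw [Nat.mul_div_cancel _ hr]; norm_num
    · beta_reduce
      rw [Ham.fII, if_neg (by omega), if_neg (by omega), if_pos ⟨rfl, rfl⟩]
      simp [Finset.sum_range_succ, (by omega : 2 * r - r = r)]
  · refine (StepBound.lieSeries hρ hσ hR hE hτ hr hα (by norm_num) hU0 hχ hF hF0 l s).congr
      fun x hx => ?_
    beta_reduce
    rw [Ham.fII_eq hr (hH x hx), if_neg (by omega), if_neg h', sub_zero, sub_zero]

/-- For l = 2 and r dividing s, the coefficients n/(n+1)! and 1/(n+1)! are 1/n! times those of a
convex combination of f and Z. As Z is the resonant part of f, this combination satisfies the bound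
of f. -/
lemma StepBound.fNext (hρ : 0 < ρ) (hσ : 0 < σ) (hR : 0 < R) (hE : 0 < E) (hτ : 0 ≤ τ)
    (hr : 1 ≤ r) (hα : delta r ≤ α) (hU0 : 0 ≤ U) {H : Λ → Ham n₁ n₂}
    (hH : ∀ x ∈ W, (H x).HasForm K (r - 1))
    (hχ : GeneratorBound W K ρ σ R E γ τ r 2 α fun x => (H x).chi2 r)
    (hF : StepBound W K ρ σ R E γ τ r α U fun x => (H x).fII r) :
    StepBound W K ρ σ R E γ τ r (α - delta r) (U / (1 - 1 / (16 * (r : ℝ) ^ 2)))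
      fun x => (H x).fNext r := by
  intro l s
  have hF0 : ∀ x ∈ W, ∀ l s, l ≤ 2 → s < r → (H x).fII r l s = 0 :=
    fun x hx l s hl hs => Ham.fII_zero hr (hH x hx) l s hl (Or.inl hs)
  by_cases h : l = 2 ∧ r ∣ s
  swap
  · refine (StepBound.lieSeries hρ hσ hR hE hτ hr hα (by norm_num) hU0 hχ hF hF0 l s).congr
      fun x hx => ?_
    rcases lt_trichotomy l 2 with hl | hl | hl
    · exact Ham.fNext_of_le_one hr (hH x hx) (by omega) s
    · subst hl
      exact Ham.fNext_of_not_dvd hr (hH x hx) (fun hd => h ⟨rfl, hd⟩)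
    · exact Ham.fNext_of_two_lt hl s
  obtain ⟨rfl, J, rfl⟩ := h
  rcases Nat.lt_or_ge J 2 with hJ | hJ
  · refine NormLE.zero.congr fun x _ => ?_
    beta_reduce
    rw [Ham.fNext, if_pos ⟨le_rfl, by nlinarith⟩]
  obtain ⟨n, rfl⟩ := Nat.exists_eq_add_of_le' (by omega : 1 ≤ J)
  have hJ0 : ((n : ℂ) + 1) ≠ 0 := by exact_mod_cast Nat.succ_ne_zero n
  -- Replacing the component (2, r) by the convex combination presents `fNext` as an ordinary
  -- truncated Lie series.
  set F' : Λ → ℕ → ℕ → TrigPoly n₁ n₂ := fun x l' s' => if l' = 2 ∧ s' = r then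
    ((n : ℂ) / (n + 1)) • (H x).fII r 2 r + ((1 : ℂ) / (n + 1)) • (H x).Z r
    else (H x).fII r l' s' with hF'
  have hw := fun l' s' => one_le_weight (one_le_constM K ρ σ R E γ τ) (one_le_divisorBase hτ) r l' s'
  have hb : StepBound W K ρ σ R E γ τ r α U F' := by
    intro l' s'
    by_cases h : l' = 2 ∧ s' = r
    · obtain ⟨rfl, rfl⟩ := h
      have h0 := hF 2 s'
      have hZ : NormLE W ρ σ R α (fun x => (H x).Z s') _ :=
        (NormLE.resonantPart (fun x hx => Ham.fII_mem hr (hH x hx) 2 s') h0).congr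
          fun x hx => Ham.Z_eq hr (hH x hx)
      have := hw 2 s'
      refine (((h0.const_smul ((n : ℂ) / (n + 1))).add (hZ.const_smul ((1 : ℂ) / (n + 1)))
        (by positivity) (by positivity)).mono_right (le_of_eq ?_)).congr fun x _ => ?_
      · have e1 : ‖(n : ℂ) / (n + 1)‖ = n / (n + 1) := by
          rw [norm_div, Complex.norm_natCast]; congr 1; exact_mod_cast Complex.norm_natCast (n + 1)
        have e2 : ‖(1 : ℂ) / (n + 1)‖ = 1 / (n + 1) := by
          rw [norm_div, norm_one]; congr 1; exact_mod_cast Complex.norm_natCast (n + 1)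
        rw [e1, e2, ← add_mul, ← add_div, div_self (by positivity), one_mul]
      · simp only [hF', and_self, if_true]
    · refine (hF l' s').congr fun x _ => ?_
      simp only [hF', if_neg h]
  refine (StepBound.lieSeries_coeff hρ hσ hR hE hτ hr hα le_rfl hU0 hχ hb
    (fun x hx l' s' hl hs => ?_) 2 (r * (n + 1)) (c := fun _ => 1) (by simp)
    (J := n + 1) ?_).congr fun x hx => ?_
  · simp only [hF', if_neg (by omega : ¬(l' = 2 ∧ s' = r))]
    exact hF0 x hx l' s' hl hs
  · rw [Nat.mul_div_cancel_left _ hr]; omega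
  · have hlt : r < r * (n + 1) := by nlinarith
    have hrn : r * (n + 1) - n * r = r := by rw [mul_add, mul_comm]; omega
    beta_reduce
    rw [Ham.fNext, if_neg (fun h => absurd h.2 (not_le.2 hlt)), if_neg (by omega), if_pos ⟨rfl, dvd_mul_right _ _⟩,
      Nat.mul_div_cancel_left _ hr, Finset.sum_range_succ, add_comm]
    simp only [one_smul, Nat.sub_self, zero_mul, add_zero, Nat.add_sub_cancel]
    congr 1
    · refine Finset.sum_congr rfl fun j hj => ?_
      have hj := Finset.mem_range.1 hj
      have hne : r * (n + 1) - j * r ≠ r := by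
        have : (j + 2) * r ≤ (n + 1) * r := Nat.mul_le_mul_right r (by omega)
        rw [mul_comm r]
        nlinarith [Nat.sub_add_cancel ((Nat.mul_le_mul_right r (by omega) : j * r ≤ (n + 1) * r))]
      simp only [hF', if_neg (fun h : 2 = 2 ∧ r * (n + 1) - j * r = r => hne h.2)]
    · simp only [hF', hrn, and_self, if_true]
      rw [lie_iterate_add, lie_iterate_eq _ n (_ • _), lie_iterate_eq _ n (_ • _), map_smul,
        map_smul, ← lie_iterate_eq, ← lie_iterate_eq, smul_add, smul_smul, smul_smul,
        Nat.factorial_succ]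
      have hn0 : (n.factorial : ℂ) ≠ 0 := by exact_mod_cast n.factorial_ne_zero
      congr 2
      · push_cast; field_simp; ring
      · push_cast; field_simp

end

/-! ### Estimates of a whole step and of the change of the frequencies. -/

section

variable {W : Set (Fin n₁ → ℂ)} {K r : ℕ} {ρ σ R E γ τ U : ℝ}

/-- The estimates of a normalization step. -/
structure StepEstimates (W : Set (Fin n₁ → ℂ)) (K : ℕ) (ρ σ R E γ τ : ℝ) (r : ℕ) (U : ℝ)
    (H : (Fin n₁ → ℂ) → Ham n₁ n₂) : Prop where
  chi0 : GeneratorBound W K ρ σ R E γ τ r 0 (1 - dom (r - 1)) fun x => (H x).chi0 r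
  chi1 : GeneratorBound W K ρ σ R E γ τ r 1 (1 - dom (r - 1) - delta r) fun x => (H x).chi1 r
  chi2 : GeneratorBound W K ρ σ R E γ τ r 2 (1 - dom (r - 1) - 2 * delta r) fun x => (H x).chi2 r
  resonant : NormLE W ρ σ R (1 - dom (r - 1) - 2 * delta r) (fun x => (H x).Z r)
    (E / 4 * (2 * weight (constM K ρ σ R E γ τ) (divisorBase τ) r 2 r))
  next : StepBound W K ρ σ R E γ τ r (1 - dom r) U fun x => (H x).fNext r

lemma dom_eq (hr : 1 ≤ r) : dom r = dom (r - 1) + 3 * delta r := by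
  obtain ⟨n, rfl⟩ := Nat.exists_eq_add_of_le' hr
  rfl

lemma dom_nonneg (r : ℕ) : 0 ≤ dom r := by
  induction r with
  | zero => exact le_rfl
  | succ r ih =>
    rw [dom]
    have := delta_pos (Nat.succ_pos r)
    positivity

/-- Each transformation divides the constant by the same y < 1, and three of them lead from U to at
most V. All intermediate constants are at most V ≤ 2, as the bounds for the generators require. -/
lemma stepEstimates {V : ℝ} (hρ : 0 < ρ) (hσ : 0 < σ) (hR : 0 < R) (hE : 0 < E) (hγ : 0 < γ)
    (hτ : 0 ≤ τ) (hK : 1 ≤ K) (hr : 1 ≤ r) (hU0 : 0 ≤ U) (hV : V ≤ 2)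
    (hUV : U ≤ V * (1 - 1 / (16 * (r : ℝ) ^ 2)) ^ 3) {H : (Fin n₁ → ℂ) → Ham n₁ n₂}
    (hH : ∀ x ∈ W, (H x).HasForm K (r - 1))
    (hnr : ∀ x ∈ W, NonResonant K γ τ r (H x).ω (H x).Ω)
    (hF : StepBound W K ρ σ R E γ τ r (1 - dom (r - 1)) U fun x => (H x).f) :
    StepEstimates W K ρ σ R E γ τ r V H := by
  have hd := dom_eq hr
  have hd3 := dom_le_third r
  have hδ := delta_pos hr
  have hr1 : (1 : ℝ) ≤ r := by exact_mod_cast hr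
  set y := 1 - 1 / (16 * (r : ℝ) ^ 2) with hy
  have hy0 : 0 < y := by
    rw [hy, sub_pos, div_lt_one (by positivity)]; nlinarith
  have hy1 : y ≤ 1 := by
    rw [hy]
    have : 0 ≤ 1 / (16 * (r : ℝ) ^ 2) := by positivity
    linarith
  have hU3 : U / y / y / y ≤ V := by
    rw [div_div, div_div, div_le_iff₀ (by positivity)]
    calc U ≤ _ := hUV
      _ = _ := by ring
  have hle : ∀ {v : ℝ}, 0 ≤ v → v ≤ v / y := fun hv => le_div_self hv hy0 hy1
  have h2 : U / y / y ≤ 2 := (hle (by positivity)).trans (hU3.trans hV)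
  have h1 : U / y ≤ 2 := (hle (by positivity)).trans h2
  have h0 : U ≤ 2 := (hle hU0).trans h1
  have hχ0 := StepBound.generatorBound hρ hσ hR hE hγ hτ hK hr (by norm_num : 0 ≤ 2) hU0 h0 hF
    (fun x hx => (hH x hx).1 0 r) hnr
  have hI := StepBound.fI hρ hσ hR hE hτ hr (by linarith) hU0 hH hχ0 hF
  have hχ1 := StepBound.generatorBound hρ hσ hR hE hγ hτ hK hr (by norm_num : 1 ≤ 2)
    (by positivity) h1 hI (fun x hx => Ham.fI_mem (hH x hx) 1 r) hnr
  have hII := StepBound.fII hρ hσ hR hE hτ hr (by linarith) (by positivity) hH hχ1 hI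
  have hχ2 := StepBound.generatorBound hρ hσ hR hE hγ hτ hK hr le_rfl
    (by positivity) h2 hII (fun x hx => Ham.fII_mem hr (hH x hx) 2 r) hnr
  have hN := StepBound.fNext hρ hσ hR hE hτ hr (by linarith) (by positivity) hH hχ2 hII
  have e2 : 1 - dom (r - 1) - delta r - delta r = 1 - dom (r - 1) - 2 * delta r := by ring
  have e3 : 1 - dom (r - 1) - delta r - delta r - delta r = 1 - dom r := by rw [hd]; ring
  have hw := fun l s =>
    one_le_weight (one_le_constM K ρ σ R E γ τ) (one_le_divisorBase hτ) r l s
  rw [e3] at hN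
  rw [e2] at hχ2 hII
  refine ⟨hχ0, hχ1, hχ2, ?_, fun l s => (hN l s).mono_right ?_⟩
  · refine ((NormLE.resonantPart (fun x hx => Ham.fII_mem hr (hH x hx) 2 r) (hII 2 r)).congr
      fun x hx => Ham.Z_eq hr (hH x hx)).mono_right ?_
    have := hw 2 r
    calc _ ≤ E / 2 ^ 2 * 2 * weight (constM K ρ σ R E γ τ) (divisorBase τ) r 2 r := by gcongr
      _ = _ := by ring
  · have := hw l s
    gcongr

lemma GeneratorBound.scaledNorm_le {i : ℕ} {α : ℝ} {χ : (Fin n₁ → ℂ) → TrigPoly n₁ n₂}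
    (hρ : 0 < ρ) (hσ : 0 < σ) (hR : 0 < R) (hτ : 0 ≤ τ) (hr : 1 ≤ r) (hi : i ≤ 2)
    (h : GeneratorBound W K ρ σ R E γ τ r i α χ) :
    scaledNorm W ρ σ R r α χ ≤ ENNReal.ofReal (constA K ρ σ R E γ τ ^ r) := by
  obtain ⟨B, hB, hχ, hΓ⟩ := h
  have hC : 0 ≤ lieConst ρ σ R * (1 / delta r ^ 2) := by
    have := lieConst_pos hρ hσ hR; positivity
  rw [scaledNorm]
  refine (mul_le_mul' le_rfl hχ).trans ?_
  rw [← ENNReal.ofReal_mul hC]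
  refine ENNReal.ofReal_le_ofReal (hΓ.trans ?_)
  have hM := one_le_constM K ρ σ R E γ τ
  have hQ := one_le_divisorBase hτ
  have hX := one_le_bracketFactor hM hQ r i
  rw [constA_eq]
  refine le_trans ?_ (two_mul_bracketFactor_le hM hQ hr hi)
  have h1 : (1 : ℝ) / (16 * (r : ℝ) ^ 2) ≤ 1 / 16 := by
    have : (1 : ℝ) ≤ r := by exact_mod_cast hr
    exact one_div_le_one_div_of_le (by norm_num) (by nlinarith)
  have h2 : (2 : ℝ) ^ (2 - i) ≤ 2 ^ 2 := pow_le_pow_right₀ (by norm_num) (Nat.sub_le 2 i)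
  calc _ ≤ (2 : ℝ) ^ 2 * (1 / 16 * bracketFactor (constM K ρ σ R E γ τ) (divisorBase τ) r i) := by
        gcongr
    _ ≤ _ := by linarith

lemma mul_weight_le (hτ : 0 ≤ τ) (hr : 1 ≤ r) :
    2 * (constM K ρ σ R E γ τ * weight (constM K ρ σ R E γ τ) (divisorBase τ) r 2 r) ≤
      constA K ρ σ R E γ τ ^ r := by
  have hM := one_le_constM K ρ σ R E γ τ
  have hQ := one_le_divisorBase hτ
  have hw := one_le_weight hM hQ r 2 r
  rw [constA_eq]
  refine le_trans ?_ (two_mul_bracketFactor_le hM hQ hr le_rfl)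
  rw [bracketFactor]
  have h1 : 1 ≤ divisorBase τ ^ r.size := one_le_pow₀ hQ
  have h2 : constM K ρ σ R E γ τ ≤ 5 * constM K ρ σ R E γ τ * divisorBase τ ^ r.size := by
    nlinarith
  gcongr

/-- Converts the energy bound into units of γ, which is how the frequency shifts are measured. -/
lemma mul_lieConst_le (hρ : 0 < ρ) (hσ : 0 < σ) (hR : 0 < R) (hE : 0 < E) (hγ : 0 < γ)
    (hτ : 0 ≤ τ) (hK : 1 ≤ K) : E * lieConst ρ σ R ≤ γ * constM K ρ σ R E γ τ := by
  have hK1 : 1 ≤ (K : ℝ) ^ τ := Real.one_le_rpow (by exact_mod_cast hK) hτ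
  have hC := lieConst_pos hρ hσ hR
  have hπ : 1 ≤ 4 * Real.pi ^ 4 := by
    have : 1 ≤ Real.pi ^ 4 := one_le_pow₀ (by linarith [Real.pi_gt_three])
    linarith
  have h1 : 1 ≤ 4 * Real.pi ^ 4 * (K : ℝ) ^ τ := one_le_mul_of_one_le_of_one_le hπ hK1
  calc E * lieConst ρ σ R ≤ 4 * Real.pi ^ 4 * (K : ℝ) ^ τ * (E * lieConst ρ σ R) :=
        le_mul_of_one_le_left (by positivity) h1
    _ = γ * (4 * Real.pi ^ 4 * E * (K : ℝ) ^ τ / γ * lieConst ρ σ R) := by field_simp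
    _ ≤ _ := by gcongr; exact le_constM _ _ _ _ _ _ _

lemma half_lt_domain (hr : 1 ≤ r) : 1 / 2 < 1 - dom (r - 1) - 2 * delta r := by
  have := dom_eq hr
  have := dom_le_third r
  have := delta_pos hr
  linarith

lemma StepEstimates.norm_zP_le {H : (Fin n₁ → ℂ) → Ham n₁ n₂} (hρ : 0 < ρ) (hσ : 0 < σ)
    (hR : 0 < R) (hE : 0 < E) (hγ : 0 < γ) (hτ : 0 ≤ τ) (hK : 1 ≤ K) (hr : 1 ≤ r)
    (h : StepEstimates W K ρ σ R E γ τ r U H) {x : Fin n₁ → ℂ} (hx : x ∈ W) (i : Fin n₁) :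
    ‖(H x).zP r i‖ ≤ γ * σ * constA K ρ σ R E γ τ ^ r := by
  have hw := one_le_weight (one_le_constM K ρ σ R E γ τ) (one_le_divisorBase hτ) r 2 r
  have hM := one_le_constM K ρ σ R E γ τ
  have h1 := EllipticTori.norm_zP_le hρ hR (half_lt_domain hr) (by positivity) h.resonant hx i
  have h2 := mul_lieConst_le hρ hσ hR hE hγ hτ hK
  have h3 := mul_weight_le (K := K) (ρ := ρ) (σ := σ) (R := R) (E := E) (γ := γ) hτ hr
  generalize weight (constM K ρ σ R E γ τ) (divisorBase τ) r 2 r = w at *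
  generalize constM K ρ σ R E γ τ = M at *
  have h4 : 1 / (ρ * σ) ≤ lieConst ρ σ R := by
    rw [lieConst]
    have : (1 : ℝ) / (ρ * σ) ≤ 2 * Real.exp 1 / (ρ * σ) := by
      gcongr
      linarith [Real.add_one_le_exp 1]
    have : 0 ≤ Real.exp 1 ^ 2 / R ^ 2 := by positivity
    linarith
  have h5 : E ≤ γ * σ * M * ρ := by
    have : E * (1 / (ρ * σ)) ≤ γ * M := (mul_le_mul_of_nonneg_left h4 hE.le).trans h2
    rw [mul_one_div, div_le_iff₀ (by positivity)] at this
    linarith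
  have h6 : ‖(H x).zP r i‖ * (ρ / 2) ≤ γ * σ * M * w * (ρ / 2) := by
    calc _ ≤ E / 4 * (2 * w) := h1
      _ ≤ γ * σ * M * ρ / 4 * (2 * w) := by gcongr
      _ = _ := by ring
  refine (le_of_mul_le_mul_right h6 (by positivity)).trans ?_
  rw [mul_assoc]
  refine mul_le_mul_of_nonneg_left (le_trans ?_ h3) (by positivity)
  have : 0 ≤ M * w := by positivity
  linarith

lemma StepEstimates.norm_zZ_le {H : (Fin n₁ → ℂ) → Ham n₁ n₂} (hρ : 0 < ρ) (hσ : 0 < σ)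
    (hR : 0 < R) (hE : 0 < E) (hγ : 0 < γ) (hτ : 0 ≤ τ) (hK : 1 ≤ K) (hr : 1 ≤ r)
    (h : StepEstimates W K ρ σ R E γ τ r U H) {x : Fin n₁ → ℂ} (hx : x ∈ W) (i : Fin n₂) :
    ‖(H x).zZ r i‖ ≤ γ * constA K ρ σ R E γ τ ^ r := by
  have hw := one_le_weight (one_le_constM K ρ σ R E γ τ) (one_le_divisorBase hτ) r 2 r
  have hM := one_le_constM K ρ σ R E γ τ
  have h1 := EllipticTori.norm_zZ_le hρ hR (half_lt_domain hr) (by positivity) h.resonant hx i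
  have h2 := mul_lieConst_le hρ hσ hR hE hγ hτ hK
  have h3 := mul_weight_le (K := K) (ρ := ρ) (σ := σ) (R := R) (E := E) (γ := γ) hτ hr
  generalize weight (constM K ρ σ R E γ τ) (divisorBase τ) r 2 r = w at *
  generalize constM K ρ σ R E γ τ = M at *
  have h4 : 1 / R ^ 2 ≤ lieConst ρ σ R := by
    rw [lieConst]
    have : (1 : ℝ) / R ^ 2 ≤ Real.exp 1 ^ 2 / R ^ 2 := by
      gcongr
      nlinarith [Real.add_one_le_exp 1]
    have : 0 ≤ 2 * Real.exp 1 / (ρ * σ) := by positivity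
    linarith
  have h5 : E ≤ γ * M * R ^ 2 := by
    have : E * (1 / R ^ 2) ≤ γ * M := (mul_le_mul_of_nonneg_left h4 hE.le).trans h2
    rwa [mul_one_div, div_le_iff₀ (by positivity)] at this
  have h6 : ‖(H x).zZ r i‖ * (R / 2) ^ 2 ≤ γ * (2 * (M * w)) * (R / 2) ^ 2 := by
    calc _ ≤ E / 4 * (2 * w) := h1
      _ ≤ γ * M * R ^ 2 / 4 * (2 * w) := by gcongr
      _ = _ := by ring
  exact (le_of_mul_le_mul_right h6 (by positivity)).trans (by gcongr)

/-! ### Induction over the normalization steps. -/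

/-- The factor lost in the first `r` steps. -/
def lossFactor (r : ℕ) : ℝ := (2 * r + 1) / (r + 1)

lemma lossFactor_le_two (r : ℕ) : lossFactor r ≤ 2 := by
  rw [lossFactor, div_le_iff₀ (by positivity)]; linarith

lemma lossFactor_nonneg (r : ℕ) : 0 ≤ lossFactor r := by rw [lossFactor]; positivity

/-- The factor is 2 - 1/(r+1); its increments, of order r⁻², dominate the relative loss 3/(16(r+1)²)
bounding that of the three Lie series. -/
lemma lossFactor_step (r : ℕ) :
    lossFactor r ≤ lossFactor (r + 1) * (1 - 1 / (16 * ((r + 1 : ℕ) : ℝ) ^ 2)) ^ 3 := by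
  have hr : (0 : ℝ) ≤ r := Nat.cast_nonneg r
  push_cast
  have h1 : 1 - 3 * (1 / (16 * ((r : ℝ) + 1) ^ 2)) ≤ (1 - 1 / (16 * ((r : ℝ) + 1) ^ 2)) ^ 3 := by
    have hx : 0 ≤ 1 / (16 * ((r : ℝ) + 1) ^ 2) := by positivity
    have hx1 : 1 / (16 * ((r : ℝ) + 1) ^ 2) ≤ 1 := by
      rw [div_le_one (by positivity)]; nlinarith
    nlinarith [mul_nonneg (sq_nonneg (1 / (16 * ((r : ℝ) + 1) ^ 2))) (sub_nonneg.2 hx1)]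
  refine le_trans ?_ (mul_le_mul_of_nonneg_left h1 (lossFactor_nonneg _))
  rw [lossFactor, lossFactor]
  push_cast
  have h2 : (2 * ((r : ℝ) + 1) + 1) / (r + 1 + 1) * (1 - 3 * (1 / (16 * ((r : ℝ) + 1) ^ 2))) -
      (2 * r + 1) / (r + 1) = (10 * r + 7) / (16 * (r + 1) ^ 2 * (r + 2)) := by
    field_simp
    ring
  have h3 : 0 ≤ (10 * (r : ℝ) + 7) / (16 * (r + 1) ^ 2 * (r + 2)) := by positivity
  linarith

section

variable {ε : ℝ} {H₀ : (Fin n₁ → ℂ) → Ham n₁ n₂}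

/-- Passing from r to r+1 may add a dyadic scale to the weights; monotonicity makes the previous
bounds usable with the new weights. -/
lemma normalize_stepEstimates_of_stepBound (hρ : 0 < ρ) (hσ : 0 < σ) (hR : 0 < R) (hE : 0 < E)
    (hγ : 0 < γ) (hτ : 0 ≤ τ) (hK : 1 ≤ K) (hform : ∀ x ∈ W, (H₀ x).HasForm K 0)
    (hnr : ∀ x ∈ W, NonResonant K γ τ (r + 1) (Ham.normalize ε (H₀ x) r).ω
      (Ham.normalize ε (H₀ x) r).Ω)
    (hb : StepBound W K ρ σ R E γ τ r (1 - dom r) (lossFactor r)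
      fun x => (Ham.normalize ε (H₀ x) r).f) :
    StepEstimates W K ρ σ R E γ τ (r + 1) (lossFactor (r + 1))
      fun x => Ham.normalize ε (H₀ x) r := by
  refine stepEstimates hρ hσ hR hE hγ hτ hK (Nat.succ_pos r) (lossFactor_nonneg r)
    (lossFactor_le_two _) (lossFactor_step r)
    (fun x hx => Ham.normalize_hasForm ε (hform x hx) r) hnr fun l s => ?_
  refine (hb l s).mono_right ?_
  have := weight_mono (one_le_constM K ρ σ R E γ τ) (one_le_divisorBase hτ) (Nat.le_succ r) l s
  have := lossFactor_nonneg r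
  gcongr

lemma normalize_stepBound (hρ : 0 < ρ) (hσ : 0 < σ) (hR : 0 < R) (hE : 0 < E)
    (hγ : 0 < γ) (hτ : 0 ≤ τ) (hK : 1 ≤ K) (hform : ∀ x ∈ W, (H₀ x).HasForm K 0)
    (h0 : ∀ l s, NormLE W ρ σ R 1 (fun x => (H₀ x).f l s) (E / 2 ^ l)) (r : ℕ)
    (hnr : ∀ x ∈ W, ∀ j < r, NonResonant K γ τ (j + 1) (Ham.normalize ε (H₀ x) j).ω
      (Ham.normalize ε (H₀ x) j).Ω) :
    StepBound W K ρ σ R E γ τ r (1 - dom r) (lossFactor r)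
      fun x => (Ham.normalize ε (H₀ x) r).f := by
  induction r with
  | zero =>
    intro l s
    rw [dom, sub_zero]
    refine (h0 l s).mono_right ?_
    have := one_le_weight (one_le_constM K ρ σ R E γ τ) (one_le_divisorBase hτ) 0 l s
    have h1 : lossFactor 0 = 1 := by simp [lossFactor]
    rw [h1, mul_one]
    exact le_mul_of_one_le_right (by positivity) this
  | succ r ih =>
    exact (normalize_stepEstimates_of_stepBound hρ hσ hR hE hγ hτ hK hform
      (fun x hx => hnr x hx r (Nat.lt_succ_self r))
      (ih fun x hx j hj => hnr x hx j (hj.trans (Nat.lt_succ_self r)))).next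

/-- The terms of order zero are not modified. -/
lemma normalize_f_zero (H : Ham n₁ n₂) {l : ℕ} (hl : 3 ≤ l) (r : ℕ) :
    (Ham.normalize ε H r).f l 0 = H.f l 0 := by
  induction r with
  | zero => rfl
  | succ r ih =>
    change (Ham.normalize ε H r).fNext (r + 1) l 0 = _
    rw [Ham.fNext_of_two_lt hl, lieSeries_of_lt (Nat.succ_pos r), Ham.fII, if_neg (by omega),
      if_neg (by omega), if_neg (by omega), if_neg (by omega)]
    simp only [Nat.zero_div, zero_add, Finset.sum_range_one, Nat.factorial_zero, Nat.cast_one,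
      div_one, one_smul, Function.iterate_zero, id, add_zero, zero_mul, Nat.sub_zero]
    rw [Ham.fI, if_neg (by omega), if_neg (by omega)]
    simpa using ih

end

end

end EllipticTori

end

/-! ### Conclusion. -/

theorem mainTheorem5 (n₁ n₂ K : ℕ) (hn₁ : 1 ≤ n₁) (hK : 1 ≤ K)
    (ρ σ R Ebar γ τ ε : ℝ) (hρ : 0 < ρ) (hσ : 0 < σ) (hR : 0 < R) (hE : 0 < Ebar)
    (hγ : 0 < γ) (hτ : (n₁ : ℝ) - 1 ≤ τ) (hε : 0 ≤ ε)
    -- the parameter `ω^{(0)}` ranges over `W`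
    (W : Set (Fin n₁ → ℂ)) (Ω₀ : (Fin n₁ → ℂ) → Fin n₂ → ℂ)
    (f₀ : (Fin n₁ → ℂ) → ℕ → ℕ → EllipticTori.TrigPoly n₁ n₂)
    -- `H r ω` is `H^{(r)}` at the parameter value `ω`
    (H : ℕ → (Fin n₁ → ℂ) → EllipticTori.Ham n₁ n₂)
    (hH : ∀ r ω, H r ω = EllipticTori.Ham.normalize ε ⟨ω, Ω₀ ω, f₀ ω⟩ r)
    (hform : ∀ ω ∈ W, (H 0 ω).HasForm K 0)
    (r : ℕ) (hr : 1 ≤ r)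
    (hnonres : ∀ ω ∈ W, ∀ j, 1 ≤ j → j ≤ r →
      EllipticTori.NonResonant K γ τ j (H (j - 1) ω).ω (H (j - 1) ω).Ω) :
    (∀ ω ∈ W, ∀ j, 1 ≤ j → j ≤ r →
      (H (j - 1) ω).HasForm K (j - 1) ∧ EllipticTori.StepPerformed K ε j (H (j - 1) ω)) ∧
    ((∀ l s, EllipticTori.anorm W ρ σ R 1 (fun ω => f₀ ω l s) ≤ ENNReal.ofReal (Ebar / 2 ^ l)) →
      EllipticTori.scaledNorm W ρ σ R r (1 - EllipticTori.dom (r - 1))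
          (fun ω => (H (r - 1) ω).chi0 r) ≤
        ENNReal.ofReal (EllipticTori.constA K ρ σ R Ebar γ τ ^ r) ∧
      EllipticTori.scaledNorm W ρ σ R r (1 - EllipticTori.dom (r - 1) - EllipticTori.delta r)
          (fun ω => (H (r - 1) ω).chi1 r) ≤
        ENNReal.ofReal (EllipticTori.constA K ρ σ R Ebar γ τ ^ r) ∧
      EllipticTori.scaledNorm W ρ σ R r (1 - EllipticTori.dom (r - 1) - 2 * EllipticTori.delta r)
          (fun ω => (H (r - 1) ω).chi2 r) ≤
        ENNReal.ofReal (EllipticTori.constA K ρ σ R Ebar γ τ ^ r) ∧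
      (∀ l s, (l ≤ 2 → r < s) →
        EllipticTori.anorm W ρ σ R (1 - EllipticTori.dom r) (fun ω => (H r ω).f l s) ≤
          ENNReal.ofReal (Ebar / 2 ^ l * EllipticTori.constA K ρ σ R Ebar γ τ ^ s)) ∧
      (∀ ω ∈ W, ∀ i, ‖(H r ω).ω i - (H (r - 1) ω).ω i‖ ≤
        γ * σ * (ε * EllipticTori.constA K ρ σ R Ebar γ τ) ^ r) ∧
      (∀ ω ∈ W, ∀ i, ‖(H r ω).Ω i - (H (r - 1) ω).Ω i‖ ≤
        γ * (ε * EllipticTori.constA K ρ σ R Ebar γ τ) ^ r)) := by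
  obtain rfl : H = fun r ω => EllipticTori.Ham.normalize ε ⟨ω, Ω₀ ω, f₀ ω⟩ r := funext₂ hH
  have hτ0 : 0 ≤ τ := by
    have : (1 : ℝ) ≤ n₁ := by exact_mod_cast hn₁
    linarith
  have hforms := fun ω hω => EllipticTori.Ham.normalize_hasForm ε (hform ω hω)
  refine ⟨fun ω hω j hj hjr => ⟨hforms ω hω (j - 1), EllipticTori.Ham.stepPerformed ε hγ hτ0 hK hj
    (hforms ω hω (j - 1)) (hnonres ω hω j hj hjr)⟩, fun hf => ?_⟩
  obtain ⟨r, rfl⟩ := Nat.exists_eq_add_of_le' hr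
  have hb := EllipticTori.normalize_stepBound (W := W) (ε := ε)
    (H₀ := fun ω => ⟨ω, Ω₀ ω, f₀ ω⟩) hρ hσ hR hE hγ hτ0 hK hform hf r
    fun ω hω j hj => hnonres ω hω (j + 1) (Nat.succ_pos j) (by omega)
  have hs := EllipticTori.normalize_stepEstimates_of_stepBound (ε := ε) hρ hσ hR hE hγ hτ0 hK hform
    (fun ω hω => hnonres ω hω (r + 1) hr le_rfl) hb
  have hA : EllipticTori.constA K ρ σ R Ebar γ τ ^ (r + 1) * ε ^ (r + 1) =
      (ε * EllipticTori.constA K ρ σ R Ebar γ τ) ^ (r + 1) := by rw [mul_pow, mul_comm]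
  have hεn : ‖(ε : ℂ) ^ (r + 1)‖ = ε ^ (r + 1) := by
    rw [norm_pow, Complex.norm_real, Real.norm_of_nonneg hε]
  refine ⟨hs.chi0.scaledNorm_le hρ hσ hR hτ0 hr (by norm_num),
    hs.chi1.scaledNorm_le hρ hσ hR hτ0 hr (by norm_num),
    hs.chi2.scaledNorm_le hρ hσ hR hτ0 hr le_rfl, fun l s hls => ?_, fun ω hω i => ?_,
    fun ω hω i => ?_⟩
  -- At s = 0 the bound has no power of 𝒜 to absorb the loss factor 2; there the components are
  -- those of H⁽⁰⁾, unchanged.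
  · rcases Nat.eq_zero_or_pos s with rfl | hs0
    · have hl : 3 ≤ l := by omega
      have hd : 1 - EllipticTori.dom (r + 1) ≤ 1 := by
        have h1 := EllipticTori.half_lt_domain hr
        have h2 := EllipticTori.dom_nonneg (r + 1)
        linarith
      have h0 : EllipticTori.NormLE W ρ σ R 1 (fun ω => f₀ ω l 0) (Ebar / 2 ^ l) := hf l 0
      rw [pow_zero, mul_one]
      exact (h0.mono_left hd hρ.le hσ.le hR.le).congr fun ω _ =>
        EllipticTori.normalize_f_zero ⟨ω, Ω₀ ω, f₀ ω⟩ hl (r + 1)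
    · refine (hs.next l s).mono_right ?_
      rw [mul_assoc, EllipticTori.constA_eq]
      refine mul_le_mul_of_nonneg_left (le_trans ?_ (EllipticTori.two_mul_weight_le
        (EllipticTori.one_le_constM K ρ σ R Ebar γ τ) (EllipticTori.one_le_divisorBase hτ0)
        (r + 1) l hs0)) (by positivity)
      have := EllipticTori.one_le_weight (EllipticTori.one_le_constM K ρ σ R Ebar γ τ)
        (EllipticTori.one_le_divisorBase hτ0) (r + 1) l s
      exact mul_le_mul_of_nonneg_right (EllipticTori.lossFactor_le_two _) (by linarith)
  · have h1 := hs.norm_zP_le hρ hσ hR hE hγ hτ0 hK hr hω i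
    have h2 : ∀ a b : ℂ, a + b - a = b := fun a b => add_sub_cancel_left a b
    simp only [Nat.add_sub_cancel, EllipticTori.Ham.normalize, EllipticTori.Ham.step, h2]
    rw [norm_mul, hεn, ← hA, ← mul_assoc, mul_comm]
    exact mul_le_mul_of_nonneg_right h1 (by positivity)
  · have h1 := hs.norm_zZ_le hρ hσ hR hE hγ hτ0 hK hr hω i
    have h2 : ∀ a b : ℂ, a + b - a = b := fun a b => add_sub_cancel_left a b
    simp only [Nat.add_sub_cancel, EllipticTori.Ham.normalize, EllipticTori.Ham.step, h2]
    rw [norm_mul, norm_mul, Complex.norm_I, one_mul, hεn, ← hA, ← mul_assoc, mul_comm]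
    exact mul_le_mul_of_nonneg_right h1 (by positivity)
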